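/- **Maps.** A rooted planar map is a connected graph (loops and multiple edges allowed) drawn on the sphere without crossings, with one distinguished oriented edge, up to orientation-preserving homeomorphism. Each edge is cut into two half-edges; $\tau$ exchanges the two halves of every edge, $\sigma(h)$ is the half-edge following $h$ in clockwise order around the same vertex, and the root half-edge $h_r$ is the half of the root edge at its origin. (Equivalently: a finite set of half-edges with a permutation $\sigma$ and a fixed-point-free involution $\tau$ generating a transitive group, and with #orbits$(\sigma)$ + #orbits$(\sigma\tau)$ = #orbits$(\tau)+2$, up to isomorphism preserving the root half-edge.) The map is bridgeless if deleting any single edge leaves it connected. Let $\mathcal B_n$ be the set of rooted bridgeless planar maps with $n$ edges. **Sticky trees.** Plane trees are drawn with the root on top; the root has depth $0$, and the prefix order lists a node before its sub-trees, which are taken from left to right. A sticky tree is a plane tree with a labelling $\ell$ of its nodes by natural numbers such that, for every node $u$, of depth $d$ and with sub-tree $S_u$ rooted at $u$: (1) $\ell(u)\le d$; (2) if $d>0$, some node $v$ of $S_u$ (possibly $u$) has $\ell(v)<d$; (3) if $v\in S_u$ has $\ell(v)=d$, then every node of $S_u$ that precedes $v$ in prefix order has label at least $d$. Let $\mathcal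 S_n$ be the set of sticky trees with $n$ edges. **The map $\mathrm S$.** Exploring a half-edge $h$ means: mark $h$ and $\tau(h)$ as visited; put $h'=\sigma(\tau(h))$; as long as $h'$ is not visited, explore $h'$ and then replace $h'$ by $\sigma(h')$. Given a rooted map $M$, start with $h'=h_r$ and nothing visited and, as long as $h'$ is not visited, explore $h'$ and then replace $h'$ by $\sigma(h')$. The exploration tree has a root node, which is a copy of the root vertex, and one node for each explored half-edge $h$, which is a copy of the vertex at $\tau(h)$; its parent is the node from which $h$ was explored, and the children of a node are placed from right to left (that is, clockwise) in the order of their exploration. Label each node by the depth of the first visited node that is a copy of the same vertex. The resulting labelled plane tree is $\mathrm S(M)$. **The map $\mathrm R$.** Given a labelled plane tree $T$, attach to each node a plug on its left, so that clockwise around a node one meets its plug, the half-edge to its parent (if any), and the half-edges to its children from right to left. For the nodes $u$ whose label equals their depth, in increasing order of depth, glue the plugs of $u=u_0$ and of the descendants $u_1,\dots,u_k$ of $u$ with the same label as $u$, in prefix order: if the half-edges clockwise after the plug of $u_i$ form the sequence $A_i$, the vertices $u_0,\dots,u_k$ are merged into one vertex with clockwise cyclic order $A_0,A_1,\dots,A_k$,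 without plugs. The process fails if at such a step the plugs to be glued are not all in the same face. If it succeeds and no plug is left, the result, rooted at the right-most edge of the root node pointing away from it, is $\mathrm R(T)$. **Theorem.** For every $n\ge 1$: $\mathrm S$ is a bijection from $\mathcal B_n$ to $\mathcal S_n$ (in particular $\mathrm S(B)\in\mathcal S_n$ for every $B\in\mathcal B_n$); for every $T\in\mathcal S_n$, the map $\mathrm R(T)$ is defined and belongs to $\mathcal B_n$; and $\mathrm R$ is the inverse of $\mathrm S$, that is, $\mathrm R(\mathrm S(B))=B$ for all $B\in\mathcal B_n$ and $\mathrm S(\mathrm R(T))=T$ for all $T\in\mathcal S_n$. -/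

import Mathlib

/-! ## Plane trees -/

/-- Plane trees whose nodes carry an element of `α`; the list of children is read from left to
right. -/
inductive PlaneTree (α : Type) : Type
  | node (a : α) (children : List (PlaneTree α)) : PlaneTree α

namespace PlaneTree

variable {α β γ : Type}

mutual
/-- The nodes of a plane tree in prefix order.  A node is recorded as a pair: its address (the list
of indices of the children chosen, from left to right and counted from `0`, on the way down from the
root) and the element of `α` it carries.  So the root has address `[]`, the depth of a node is the
length of its address, and `v` lies in the sub-tree rooted at `u` iff the address of `u` is an
initial segment of that of `v`. -/
def nodes : PlaneTree α → List (List ℕ × α)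
  | node a cs => ([], a) :: forestNodes 0 cs
/-- The nodes of the trees of a forest, whose first tree is the `i`-th child of a common parent;
addresses are relative to that parent. -/
def forestNodes : ℕ → List (PlaneTree α) → List (List ℕ × α)
  | _, [] => []
  | i, t :: ts => (nodes t).map (fun x => (i :: x.1, x.2)) ++ forestNodes (i + 1) ts
end

mutual
/-- Change what the nodes carry, keeping the shape. -/
def map (f : α → β) : PlaneTree α → PlaneTree β
  | node a cs => node (f a) (mapForest f cs)
/-- The same for forests. -/
def mapForest (f : α → β) : List (PlaneTree α) → List (PlaneTree β)
  | [] => []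
  | t :: ts => map f t :: mapForest f ts
end

mutual
/-- Exchange left and right everywhere. -/
def mirror : PlaneTree α → PlaneTree α
  | node a cs => node a (mirrorForest cs)
/-- The same for forests. -/
def mirrorForest : List (PlaneTree α) → List (PlaneTree α)
  | [] => []
  | t :: ts => mirrorForest ts ++ [mirror t]
end

/-- The number of edges: every node but the root has an edge to its parent. -/
def numEdges (T : PlaneTree α) : ℕ := T.nodes.length - 1

mutual
theorem nodes_map (f : α → β) : ∀ T : PlaneTree α,
    (T.map f).nodes = T.nodes.map (fun x => (x.1, f x.2))
  | node a cs => by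
      simp only [map, nodes, List.map_cons, forestNodes_map f cs 0]
theorem forestNodes_map (f : α → β) : ∀ (ts : List (PlaneTree α)) (i : ℕ),
    forestNodes i (mapForest f ts) = (forestNodes i ts).map (fun x => (x.1, f x.2))
  | [], _ => by simp [mapForest, forestNodes]
  | t :: ts, i => by
      simp [mapForest, forestNodes, nodes_map f t, forestNodes_map f ts (i + 1)]
end

mutual
theorem map_map (f : α → β) (g : β → γ) : ∀ T : PlaneTree α, (T.map f).map g = T.map (g ∘ f)
  | node a cs => by simp only [map, mapForest_mapForest f g cs, Function.comp]
theorem mapForest_mapForest (f : α → β) (g : β → γ) : ∀ ts : List (PlaneTree α),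
    mapForest g (mapForest f ts) = mapForest (g ∘ f) ts
  | [] => by simp only [mapForest]
  | t :: ts => by simp only [mapForest, map_map f g t, mapForest_mapForest f g ts]
end

mutual
/-- The listing `nodes` runs through the addresses in increasing lexicographic order, so on
addresses the prefix order is the order `<` of `List ℕ`. -/
theorem pairwise_nodes : ∀ T : PlaneTree α, T.nodes.Pairwise (fun x y => x.1 < y.1)
  | node a cs => by
      rw [nodes, List.pairwise_cons]
      refine ⟨fun y hy => ?_, (pairwise_forestNodes cs 0).1⟩
      obtain ⟨j, l, h, -⟩ := (pairwise_forestNodes cs 0).2 y hy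
      rw [h]
      exact List.nil_lt_cons j l
theorem pairwise_forestNodes : ∀ (ts : List (PlaneTree α)) (i : ℕ),
    (forestNodes i ts).Pairwise (fun x y => x.1 < y.1) ∧
      ∀ y ∈ forestNodes i ts, ∃ j l, y.1 = j :: l ∧ i ≤ j
  | [], _ => by simp [forestNodes]
  | t :: ts, i => by
      have h1 := pairwise_nodes t
      have h2 := pairwise_forestNodes ts (i + 1)
      constructor
      · rw [forestNodes, List.pairwise_append]
        refine ⟨?_, h2.1, ?_⟩
        · rw [List.pairwise_map]
          exact h1.imp fun h => List.cons_lt_cons_iff.2 (Or.inr ⟨rfl, h⟩)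
        · intro x hx y hy
          obtain ⟨z, -, rfl⟩ := List.mem_map.1 hx
          obtain ⟨j, l, h, hj⟩ := h2.2 y hy
          rw [h]
          exact List.cons_lt_cons_iff.2 (Or.inl hj)
      · intro y hy
        rw [forestNodes, List.mem_append] at hy
        rcases hy with hy | hy
        · obtain ⟨z, -, rfl⟩ := List.mem_map.1 hy
          exact ⟨i, z.1, rfl, le_rfl⟩
        · obtain ⟨j, l, h, hj⟩ := h2.2 y hy
          exact ⟨j, l, h, by omega⟩
end

/-- Sticky trees: the elements carried by the nodes are their labels, and `u.1.length` is the depth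
of the node `u`. -/
structure IsSticky (T : PlaneTree ℕ) : Prop where
  label_le_depth : ∀ u ∈ T.nodes, u.2 ≤ u.1.length
  exists_label_lt : ∀ u ∈ T.nodes, 0 < u.1.length →
    ∃ v ∈ T.nodes, u.1 <+: v.1 ∧ v.2 < u.1.length
  depth_le_of_before : ∀ u ∈ T.nodes, ∀ v ∈ T.nodes, u.1 <+: v.1 → v.2 = u.1.length →
    ∀ w ∈ T.nodes, u.1 <+: w.1 → w.1 < v.1 → u.1.length ≤ w.2

end PlaneTree

/-- The sticky trees with `n` edges. -/
def stickyTrees (n : ℕ) : Set (PlaneTree ℕ) := {T | T.IsSticky ∧ T.numEdges = n}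

/-! ## Rooted maps -/

/-- Finitely many half-edges with the permutation `σ` (the next half-edge in clockwise order around
the same vertex), the fixed-point-free involution `τ` (the other half of the same edge) and a root
half-edge.  Vertices, edges and faces are the orbits of `σ`, `τ` and `σ * τ`. -/
structure RotationSystem where
  D : Type
  [instFintype : Fintype D]
  [instDecidableEq : DecidableEq D]
  σ : Equiv.Perm D
  τ : Equiv.Perm D
  root : D
  τ_τ : ∀ h, τ (τ h) = h
  τ_ne : ∀ h, τ h ≠ h

namespace RotationSystem

attribute [instance] instFintype instDecidableEq

/-- The number of orbits of a permutation. -/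
noncomputable def numOrbits {D : Type} (f : Equiv.Perm D) : ℕ :=
  Nat.card (Quotient (Equiv.Perm.SameCycle.setoid f))

noncomputable def numVertices (M : RotationSystem) : ℕ := numOrbits M.σ

noncomputable def numEdges (M : RotationSystem) : ℕ := numOrbits M.τ

noncomputable def numFaces (M : RotationSystem) : ℕ := numOrbits (M.σ * M.τ)

/-- The graph with all the vertices of `M`, but only the edges whose half-edges are in `A`, is
connected. -/
def ConnectedBy (M : RotationSystem) (A : Set M.D) : Prop :=
  ∀ x y : M.D, Relation.EqvGen (fun a b => M.σ.SameCycle a b ∨ (a ∈ A ∧ b = M.τ a)) x y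

/-- Rooted planar maps: connected, and drawn on the sphere (Euler characteristic `2`). -/
structure IsPlanarMap (M : RotationSystem) : Prop where
  connected : M.ConnectedBy Set.univ
  euler : M.numVertices + M.numFaces = M.numEdges + 2

/-- The edge of the half-edge `h` is a bridge: its deletion disconnects the map. -/
def IsBridge (M : RotationSystem) (h : M.D) : Prop := ¬ M.ConnectedBy {h, M.τ h}ᶜ

structure IsBridgelessPlanarMap (M : RotationSystem) : Prop extends M.IsPlanarMap where
  bridgeless : ∀ h, ¬ M.IsBridge h

/-- Isomorphism of rooted maps (orientation-preserving homeomorphism of drawings). -/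
def Iso (M M' : RotationSystem) : Prop :=
  ∃ e : M.D ≃ M'.D, (∀ h, e (M.σ h) = M'.σ (e h)) ∧ (∀ h, e (M.τ h) = M'.τ (e h)) ∧
    e M.root = M'.root

instance setoid : Setoid RotationSystem where
  r := Iso
  iseqv :=
    { refl := fun M => ⟨Equiv.refl _, fun _ => rfl, fun _ => rfl, rfl⟩
      symm := by
        rintro M M' ⟨e, h1, h2, h3⟩
        refine ⟨e.symm, fun h => ?_, fun h => ?_, ?_⟩
        · rw [Equiv.symm_apply_eq, h1, Equiv.apply_symm_apply]
        · rw [Equiv.symm_apply_eq, h2, Equiv.apply_symm_apply]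
        · rw [Equiv.symm_apply_eq, h3]
      trans := by
        rintro M M' M'' ⟨e, h1, h2, h3⟩ ⟨f, g1, g2, g3⟩
        refine ⟨e.trans f, fun h => ?_, fun h => ?_, ?_⟩
        · simp [h1, g1]
        · simp [h2, g2]
        · simp [h3, g3] }

end RotationSystem

/-- Rooted maps up to isomorphism. -/
abbrev RootedMap : Type 1 := Quotient RotationSystem.setoid

/-- The rooted bridgeless planar maps with `n` edges. -/
def bridgelessMaps (n : ℕ) : Set RootedMap :=
  {B | ∃ M : RotationSystem, M.IsBridgelessPlanarMap ∧ M.numEdges = n ∧ B = ⟦M⟧}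

/-! ## The exploration -/

/-- The loop `while h is not visited: Explore(h); h ← σ(h)`, started with the set `V` of visited
half-edges, where `Explore(h)` marks `h` and `τ(h)` as visited and then runs the same loop from
`σ(τ(h))`.  Returns the exploration trees of the successive `h`, in the order of exploration, and
the set of visited half-edges at the end.  The node reached through `h` carries `τ(h)`, a half-edge
adjacent to the vertex it is a copy of. -/
def exploreAux {D : Type} [Fintype D] [DecidableEq D] (σ τ : Equiv.Perm D) (V : Finset D) (h : D) :
    {r : List (PlaneTree D) × Finset D // V ⊆ r.2} :=
  if _hV : h ∈ V then ⟨([], V), Finset.Subset.refl V⟩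
  else
    let below := exploreAux σ τ (insert h (insert (τ h) V)) (σ (τ h))
    let next := exploreAux σ τ below.1.2 (σ h)
    ⟨(PlaneTree.node (τ h) below.1.1 :: next.1.1, next.1.2), fun _ hx =>
      next.2 (below.2 (Finset.mem_insert_of_mem (Finset.mem_insert_of_mem hx)))⟩
termination_by Vᶜ.card
decreasing_by
  · refine Finset.card_lt_card (Finset.ssubset_iff_of_subset ?_ |>.2 ⟨h, ?_, ?_⟩)
    · intro x hx
      simp only [Finset.mem_compl, Finset.mem_insert, not_or] at hx ⊢
      exact hx.2.2
    · simpa using _hV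
    · simp
  · have hb := below.2
    refine Finset.card_lt_card (Finset.ssubset_iff_of_subset ?_ |>.2 ⟨h, ?_, ?_⟩)
    · intro x hx
      simp only [Finset.mem_compl] at hx ⊢
      exact fun hx' => hx (hb (Finset.mem_insert_of_mem (Finset.mem_insert_of_mem hx')))
    · simpa using _hV
    · simpa using hb (Finset.mem_insert_self _ _)

/-- The result of `exploreAux`, without the proof that visited half-edges stay visited; see
`explore_of_mem` and `explore_of_notMem` for its defining equations. -/
def explore {D : Type} [Fintype D] [DecidableEq D] (σ τ : Equiv.Perm D) (V : Finset D) (h : D) :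
    List (PlaneTree D) × Finset D :=
  (exploreAux σ τ V h).1

theorem subset_explore {D : Type} [Fintype D] [DecidableEq D] (σ τ : Equiv.Perm D) (V : Finset D)
    (h : D) : V ⊆ (explore σ τ V h).2 :=
  (exploreAux σ τ V h).2

theorem explore_of_mem {D : Type} [Fintype D] [DecidableEq D] (σ τ : Equiv.Perm D) {V : Finset D}
    {h : D} (hV : h ∈ V) : explore σ τ V h = ([], V) := by
  rw [explore, exploreAux, dif_pos hV]

theorem explore_of_notMem {D : Type} [Fintype D] [DecidableEq D] (σ τ : Equiv.Perm D)
    {V : Finset D} {h : D} (hV : h ∉ V) :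
    explore σ τ V h =
      (PlaneTree.node (τ h) (explore σ τ (insert h (insert (τ h) V)) (σ (τ h))).1 ::
        (explore σ τ (explore σ τ (insert h (insert (τ h) V)) (σ (τ h))).2 (σ h)).1,
       (explore σ τ (explore σ τ (insert h (insert (τ h) V)) (σ (τ h))).2 (σ h)).2) := by
  rw [explore, exploreAux, dif_neg hV]
  rfl

namespace RotationSystem

/-- The exploration tree: the root node is a copy of the root vertex, from which the half-edges are
inspected in clockwise order, beginning with the root half-edge.  Here the children of a node are
listed in the order of their exploration, so `nodes` lists the nodes in the order of the visits. -/
def searchTree (M : RotationSystem) : PlaneTree M.D :=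
  .node M.root (explore M.σ M.τ ∅ M.root).1

/-- The label of the vertex adjacent to `h`: the depth of the node of its first visit. -/
def vertexLabel (M : RotationSystem) (h : M.D) : ℕ :=
  ((M.searchTree.nodes.find? (fun x => decide (M.σ.SameCycle x.2 h))).map
    (fun x => x.1.length)).getD 0

/-- The labelled exploration tree.  The tree is drawn with its root on top, so the clockwise order
in which the children of a node are explored, starting from the edge to its parent, is the order
from right to left, whence the `mirror`. -/
def labelledTree (M : RotationSystem) : PlaneTree ℕ :=
  (M.searchTree.map M.vertexLabel).mirror

theorem explore_equivariant {D D' : Type} [Fintype D] [DecidableEq D] [Fintype D'] [DecidableEq D']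
    (σ τ : Equiv.Perm D) (σ' τ' : Equiv.Perm D') (e : D ≃ D') (hσ : ∀ h, e (σ h) = σ' (e h))
    (hτ : ∀ h, e (τ h) = τ' (e h)) (n : ℕ) :
    ∀ (V : Finset D) (h : D), Vᶜ.card ≤ n →
      explore σ' τ' (V.map e.toEmbedding) (e h) =
        (PlaneTree.mapForest e (explore σ τ V h).1,
          (explore σ τ V h).2.map e.toEmbedding) := by
  induction n using Nat.strong_induction_on with
  | _ n ih =>
    intro V h hn
    by_cases hV : h ∈ V
    · have hV' : e h ∈ V.map e.toEmbedding := by simpa using hV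
      simp [explore_of_mem _ _ hV, explore_of_mem _ _ hV', PlaneTree.mapForest]
    · have hV' : e h ∉ V.map e.toEmbedding := by simpa using hV
      have key : ∀ W : Finset D, V ⊆ W → h ∈ W → Wᶜ.card < n := by
        intro W hW hh
        refine lt_of_lt_of_le (Finset.card_lt_card
          (Finset.ssubset_iff_of_subset ?_ |>.2 ⟨h, ?_, ?_⟩)) hn
        · exact Finset.compl_subset_compl.2 hW
        · simpa using hV
        · simpa using hh
      have hsub := subset_explore σ τ (insert h (insert (τ h) V)) (σ (τ h))
      have h1 := ih _ (key (insert h (insert (τ h) V))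
        (fun x hx => Finset.mem_insert_of_mem (Finset.mem_insert_of_mem hx))
        (Finset.mem_insert_self _ _)) (insert h (insert (τ h) V)) (σ (τ h)) le_rfl
      have h2 := ih _ (key (explore σ τ (insert h (insert (τ h) V)) (σ (τ h))).2
        (fun x hx => hsub (Finset.mem_insert_of_mem (Finset.mem_insert_of_mem hx)))
        (hsub (Finset.mem_insert_self _ _)))
        (explore σ τ (insert h (insert (τ h) V)) (σ (τ h))).2 (σ h) le_rfl
      have e1 : (insert h (insert (τ h) V)).map e.toEmbedding
          = insert (e h) (insert (τ' (e h)) (V.map e.toEmbedding)) := by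
        simp [Finset.map_insert, hτ]
      rw [e1, hσ, hτ] at h1
      rw [hσ] at h2
      rw [explore_of_notMem _ _ hV, explore_of_notMem _ _ hV']
      simp only [h1, h2, PlaneTree.mapForest, PlaneTree.map, hτ]

theorem labelledTree_eq_of_iso {M M' : RotationSystem} (h : Iso M M') :
    M.labelledTree = M'.labelledTree := by
  obtain ⟨e, hσ, hτ, hr⟩ := h
  have hE : M'.searchTree = M.searchTree.map e := by
    have := explore_equivariant M.σ M.τ M'.σ M'.τ e hσ hτ _ ∅ M.root le_rfl
    rw [Finset.map_empty, hr] at this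
    rw [searchTree, searchTree, this, PlaneTree.map, hr]
  have hcyc : ∀ x y, M'.σ.SameCycle (e x) (e y) ↔ M.σ.SameCycle x y := by
    intro x y
    have hc : M'.σ = (e.symm.trans M.σ).trans e := by
      ext z; simp [hσ]
    have hz : ∀ (k : ℤ) (z : M.D), (M'.σ ^ k) (e z) = e ((M.σ ^ k) z) := by
      intro k z
      have : M'.σ = e.permCongr M.σ := by rw [hc]; rfl
      rw [this, ← Equiv.permCongrHom_coe, ← map_zpow]
      simp [Equiv.permCongr_apply]
    simp [Equiv.Perm.SameCycle, hz]
  have hL : ∀ x, M'.vertexLabel (e x) = M.vertexLabel x := by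
    intro x
    rw [vertexLabel, vertexLabel, hE, PlaneTree.nodes_map, List.find?_map]
    simp only [Function.comp_def, hcyc, Option.map_map]
  rw [labelledTree, labelledTree, hE, PlaneTree.map_map]
  congr 2
  funext x
  exact (hL x).symm

end RotationSystem

/-- The labelled exploration tree of a rooted map. -/
def mapToTree : RootedMap → PlaneTree ℕ :=
  Quotient.lift RotationSystem.labelledTree fun _ _ h => RotationSystem.labelledTree_eq_of_iso h

/-! ## Gluing plugs -/

namespace PlaneTree

variable (T : PlaneTree ℕ)

/-- The non-root nodes in prefix order; they stand also for the edges to their parents. -/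
def nonRootNodes : List (List ℕ × ℕ) := T.nodes.filter (fun x => decide (x.1 ≠ []))

abbrev Node : Type := {x // x ∈ T.nodes}

abbrev Edge : Type := {x // x ∈ T.nonRootNodes}

/-- `(v, false)` is the half at `v` of the edge from `v` to its parent, `(v, true)` is the half at
the parent. -/
abbrev HalfEdge : Type := T.Edge × Bool

/-- Half-edges, and one plug for every node. -/
abbrev Dart : Type := T.HalfEdge ⊕ T.Node

/-- Exchange the two halves of every edge. -/
def flip : Equiv.Perm T.HalfEdge := (Equiv.refl T.Edge).prodCongr Equiv.boolNot

/-- The edges to the children of `u`, from left to right. -/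
def childEdges (u : List ℕ) : List T.Edge :=
  T.nonRootNodes.attach.filter (fun v => decide (v.1.1.dropLast = u))

/-- What is attached to the node `u`, in clockwise order: its plug (on the left of `u`), the
half-edge to its parent unless `u` is the root, and the half-edges to its children from right to
left. -/
def around (u : T.Node) : List T.Dart :=
  Sum.inr u ::
    ((if h : u.1 ∈ T.nonRootNodes then [Sum.inl (⟨u.1, h⟩, false)] else []) ++
      (T.childEdges u.1.1).reverse.map (fun v => Sum.inl (v, true)))

/-- The clockwise rotation around the nodes of the tree with its plugs. -/
def initialRotation : Equiv.Perm T.Dart :=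
  (T.nodes.attach.map (fun u => (T.around u).formPerm)).prod

/-- With clockwise rotation `σ`, the plugs `p` and `q` are in the same face.  Plugs are dangling:
the contour of a face passes by them. -/
def SameFace (σ : Equiv.Perm T.Dart) (p q : T.Node) : Prop :=
  (σ * Equiv.Perm.sumCongr T.flip 1).SameCycle (Sum.inr p) (Sum.inr q)

/-- The nodes in the sub-tree rooted at `u` (including `u`) with the label of `u`, in prefix
order. -/
def glueClass (u : T.Node) : List T.Node :=
  T.nodes.attach.filter (fun v => decide (u.1.1 <+: v.1.1 ∧ v.1.2 = u.1.2))

/-- Remove a plug from its vertex. -/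
def removePlug (σ : Equiv.Perm T.Dart) (p : T.Node) : Equiv.Perm T.Dart :=
  Equiv.swap (Sum.inr p) (σ (Sum.inr p)) * σ

/-- Merge the vertices that carry the plugs `p₀, …, pₖ`: if in clockwise order these vertices are
`(p₀, A₀), …, (pₖ, Aₖ)`, they become one vertex `(p₀, A₀, …, pₖ, Aₖ)`, from which the plugs are then
removed. -/
def mergePlugs (σ : Equiv.Perm T.Dart) (ps : List T.Node) : Equiv.Perm T.Dart :=
  ps.foldl T.removePlug ((ps.map Sum.inr).formPerm * σ)

open Classical in
/-- Glue the plugs of `u` and of its descendants with the same label; this fails if they are not all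
in the same face. -/
noncomputable def glue (σ : Equiv.Perm T.Dart) (u : T.Node) : Option (Equiv.Perm T.Dart) :=
  if ∀ p ∈ T.glueClass u, ∀ q ∈ T.glueClass u, T.SameFace σ p q then
    some (T.mergePlugs σ (T.glueClass u))
  else none

/-- The nodes that are not derived (the label equals the depth), in increasing order of depth. -/
def gluingOrder : List T.Node :=
  (List.range T.nodes.length).flatMap fun d =>
    T.nodes.attach.filter (fun u => decide (u.1.1.length = d ∧ u.1.2 = d))

/-- The rotation after all gluings, if none of them fails. -/
noncomputable def finalRotation : Option (Equiv.Perm T.Dart) :=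
  T.gluingOrder.foldlM T.glue T.initialRotation

/-- A rotation for which no plug is left next to a half-edge, as a permutation of half-edges. -/
noncomputable def restrictRotation (σ : Equiv.Perm T.Dart)
    (h : ∀ x : T.HalfEdge, (σ (Sum.inl x)).isLeft) : Equiv.Perm T.HalfEdge :=
  Equiv.ofBijective (fun x => (σ (Sum.inl x)).getLeft (h x)) <|
    Finite.injective_iff_bijective.1 fun x y hxy => by
      have h' : σ (Sum.inl x) = σ (Sum.inl y) := by
        rw [← Sum.inl_getLeft _ (h x), ← Sum.inl_getLeft _ (h y)]
        exact congrArg Sum.inl hxy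
      exact Sum.inl_injective (σ.injective h')

/-- The rooted map with half-edges those of `T`, clockwise rotation `σ` and root half-edge `r`. -/
def toRotationSystem (σ : Equiv.Perm T.HalfEdge) (r : T.HalfEdge) : RotationSystem where
  D := T.HalfEdge
  σ := σ
  τ := T.flip
  root := r
  τ_τ := fun h => by
    obtain ⟨v, b⟩ := h
    simp [flip]
  τ_ne := fun h hh => by
    have := congrArg Prod.snd hh
    simp [flip] at this

end PlaneTree

open Classical in
/-- The map obtained from a labelled tree by gluing plugs, if the gluings succeed and use up all
plugs.  The root is the right-most edge of the root node, pointing away from it. -/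
noncomputable def treeToMap (T : PlaneTree ℕ) : Option RootedMap :=
  T.finalRotation.bind fun σ =>
    (T.childEdges []).getLast?.bind fun v =>
      if h : ∀ x : T.HalfEdge, (σ (Sum.inl x)).isLeft then
        some ⟦T.toRotationSystem (T.restrictRotation σ h) (v, true)⟧
      else none

-- The exploration of a connected map uses every edge once. It thus cuts the vertices open and
-- leaves a plane tree with the same edges. To go back, it suffices to know for each node at which
-- node the rotation continues after its last half-edge. This is a permutation `π` of the nodes, and
-- `IsGlued π ρ` says that `ρ` is the rotation so obtained.
--
-- Planarity is a property of `π`. The vertices of the glued map are the cycles of `π`. Its faces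
-- are the cycles of `π * T.prevNode`, where `prevNode` is the cyclic predecessor in prefix order: a
-- contour that starts after the plug of a node next passes the place of the plug of the previous
-- node (`PartiallyGlued.sameCycle_first`, `numFaces_of_isGlued`). Euler's relation becomes a count
-- of the orbits of `π` and `π * p` which holds exactly when `π` is noncrossing
-- (`numOrbits_add_eq_iff_noncrossing`, `IsGlued.euler_iff`).
--
-- The exploration goes from right to left, and the loop at a node stops on a half-edge already
-- visited. Hence `π` sends each node to itself, to an ancestor or to a later node in prefix order
-- (`exists_glued_iso`). Conversely, if `π` has this property, the exploration of the glued map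
-- retraces the tree (`exists_explores_glued`, `map_owner_searchTree`).
--
-- For planar maps the labels encode `π`. A noncrossing permutation sends the largest node of a
-- cycle to the smallest one. By the previous property the smallest is an ancestor of the largest,
-- hence of all nodes of the cycle, since descendants form an interval. So the label of a node is
-- the depth of the topmost node of its cycle, an ancestor of it. This determines the cycles, and
-- the cycles determine `π` (`Noncrossing.eq_of_sameCycle_iff`). Condition (3) of sticky trees
-- expresses the absence of crossings. Condition (2) says that each proper sub-tree is glued to
-- something outside it, so that the edge above it is not a bridge (`isSticky_of_glued`,
-- `IsSticky.connectedBy`).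
--
-- In the other direction, the labels of a sticky tree define classes, and running through each
-- class in prefix order gives the noncrossing permutation `IsSticky.perm`. The successive gluings
-- never fail, because gluing some cycles of a noncrossing permutation does not separate the members
-- of another cycle (`Noncrossing.sameCycle_of_partial`, `IsSticky.gluedOn_glue`).

open Equiv.Perm

/-! ## Counting the orbits of a permutation -/

namespace RotationSystem

variable {X Y : Type}

theorem sameCycle_induction [Finite X] {f : Equiv.Perm X} {S : X → Prop}
    (h : ∀ x, S x → S (f x)) {x y : X} (hxy : f.SameCycle x y) (hx : S x) : S y := by
  obtain ⟨n, rfl⟩ := hxy.exists_nat_pow_eq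
  clear hxy
  induction n with
  | zero => simpa using hx
  | succ n ih => rw [pow_succ', Equiv.Perm.mul_apply]; exact h _ ih

/-- On a finite set forward iteration returns from `f x` to `x`, so closure under `f` also gives
closure under preimages. -/
theorem mem_of_apply_mem [Finite X] {f : Equiv.Perm X} {S : X → Prop}
    (h : ∀ x, S x → S (f x)) {x : X} (hx : S (f x)) : S x :=
  sameCycle_induction h (sameCycle_apply_left.2 SameCycle.rfl) hx

theorem sameCycle_apply_self (f : Equiv.Perm X) (x : X) : f.SameCycle x (f x) :=
  sameCycle_apply_right.2 SameCycle.rfl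

/-- Correspondence between the orbits of two permutations. -/
theorem sameCycle_iff_of_retract [Finite X] [Finite Y] {f : Equiv.Perm X} {g : Equiv.Perm Y}
    (i : Y → X) (r : X → Y) (h1 : ∀ y, f.SameCycle (i y) (i (g y)))
    (h2 : ∀ x, g.SameCycle (r x) (r (f x)))
    (h4 : ∀ x, f.SameCycle (i (r x)) x) (x x' : X) :
    f.SameCycle x x' ↔ g.SameCycle (r x) (r x') := by
  constructor
  · intro h
    exact sameCycle_induction (S := fun z => g.SameCycle (r x) (r z))
      (fun z hz => hz.trans (h2 z)) h SameCycle.rfl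
  · intro h
    have := sameCycle_induction (S := fun z => f.SameCycle (i (r x)) (i z))
      (fun z hz => hz.trans (h1 z)) h SameCycle.rfl
    exact ((h4 x).symm.trans this).trans (h4 x')

theorem numOrbits_eq_of_retract [Finite X] [Finite Y] {f : Equiv.Perm X} {g : Equiv.Perm Y}
    (i : Y → X) (r : X → Y) (h1 : ∀ y, f.SameCycle (i y) (i (g y)))
    (h2 : ∀ x, g.SameCycle (r x) (r (f x))) (h3 : ∀ y, g.SameCycle (r (i y)) y)
    (h4 : ∀ x, f.SameCycle (i (r x)) x) : numOrbits f = numOrbits g := by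
  have key := sameCycle_iff_of_retract i r h1 h2 h4
  refine Nat.card_eq_of_bijective
    (Quotient.map (sa := SameCycle.setoid f) (sb := SameCycle.setoid g) r
      fun a b hab => (key a b).1 hab) ⟨?_, ?_⟩
  · rintro ⟨a⟩ ⟨b⟩ hab
    exact Quotient.sound ((key a b).2 (Quotient.exact hab))
  · rintro ⟨y⟩
    exact ⟨Quotient.mk (SameCycle.setoid f) (i y), Quotient.sound (h3 y)⟩

/-- Multiplying by `swap a b` redirects the arrow into `a` to `b` and the arrow into `b` to `a`.
This splices the two cycles into one and leaves the others alone. -/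
theorem sameCycle_swap_mul [Finite X] [DecidableEq X] {f : Equiv.Perm X} {a b : X}
    (hab : ¬ f.SameCycle a b) (x y : X) :
    (Equiv.swap a b * f).SameCycle x y ↔ f.SameCycle x y ∨
      (f.SameCycle x a ∧ f.SameCycle y b) ∨ (f.SameCycle x b ∧ f.SameCycle y a) := by
  set f' := Equiv.swap a b * f with hf'
  have hval : ∀ x, f x ≠ a → f x ≠ b → f' x = f x := fun x h1 h2 => by
    simp [f', Equiv.swap_apply_of_ne_of_ne h1 h2]
  have hvala : ∀ x, f x = a → f' x = b := fun x h => by simp [f', h]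
  have hvalb : ∀ x, f x = b → f' x = a := fun x h => by simp [f', h]
  have hab' : f'.SameCycle a b := by
    have hc : f (f.symm a) = a := by simp
    have h1 : f'.SameCycle (f.symm a) b := by
      rw [← hvala _ hc]; exact sameCycle_apply_self _ _
    -- Otherwise `f'` would follow the `f`-cycle of `a` unchanged up to the preimage of `a`, from
    -- which it goes to `b`.
    by_contra hcon
    have hcl : ∀ x, (f.SameCycle a x ∧ f'.SameCycle a x) → (f.SameCycle a (f x) ∧
        f'.SameCycle a (f x)) := by
      rintro x ⟨hx1, hx2⟩
      have hx3 : f.SameCycle a (f x) := hx1.trans (sameCycle_apply_self _ _)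
      refine ⟨hx3, ?_⟩
      have hxb : f x ≠ b := fun h => hab (h ▸ hx3)
      by_cases hxa : f x = a
      · exact absurd (hx2.trans (hvala x hxa ▸ sameCycle_apply_self f' x)) hcon
      · rw [← hval x hxa hxb]; exact hx2.trans (sameCycle_apply_self _ _)
    have := sameCycle_induction hcl (y := f.symm a)
      (sameCycle_symm_apply_right.2 SameCycle.rfl) ⟨SameCycle.rfl, SameCycle.rfl⟩
    exact hcon (this.2.trans h1)
  constructor
  · intro h
    refine sameCycle_induction (f := f') (S := fun y => f.SameCycle x y ∨
      (f.SameCycle x a ∧ f.SameCycle y b) ∨ (f.SameCycle x b ∧ f.SameCycle y a)) ?_ h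
      (Or.inl SameCycle.rfl)
    intro z hz
    have hz1 := sameCycle_apply_self f z
    by_cases h1 : f z = a
    · rw [hvala z h1]
      rw [h1] at hz1
      rcases hz with hz | ⟨hz, hz'⟩ | ⟨hz, hz'⟩
      · exact Or.inr (Or.inl ⟨hz.trans hz1, SameCycle.rfl⟩)
      · exact absurd (hz1.symm.trans hz') hab
      · exact Or.inl hz
    · by_cases h2 : f z = b
      · rw [hvalb z h2]
        rw [h2] at hz1
        rcases hz with hz | ⟨hz, hz'⟩ | ⟨hz, hz'⟩
        · exact Or.inr (Or.inr ⟨hz.trans hz1, SameCycle.rfl⟩)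
        · exact Or.inl hz
        · exact absurd (hz'.symm.trans hz1) hab
      · rw [hval z h1 h2]
        rcases hz with hz | ⟨hz, hz'⟩ | ⟨hz, hz'⟩
        · exact Or.inl (hz.trans hz1)
        · exact Or.inr (Or.inl ⟨hz, hz1.symm.trans hz'⟩)
        · exact Or.inr (Or.inr ⟨hz, hz1.symm.trans hz'⟩)
  · have hstep : ∀ z, f'.SameCycle z (f z) := by
      intro z
      have hz1 := sameCycle_apply_self f' z
      by_cases h1 : f z = a
      · rw [hvala z h1] at hz1; rw [h1]; exact hz1.trans hab'.symm
      · by_cases h2 : f z = b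
        · rw [hvalb z h2] at hz1; rw [h2]; exact hz1.trans hab'
        · rwa [hval z h1 h2] at hz1
    have hsub : ∀ {u v}, f.SameCycle u v → f'.SameCycle u v := fun {u v} h =>
      sameCycle_induction (S := fun v => f'.SameCycle u v)
        (fun z hz => hz.trans (hstep z)) h SameCycle.rfl
    rintro (h | ⟨h1, h2⟩ | ⟨h1, h2⟩)
    · exact hsub h
    · exact (hsub h1).trans (hab'.trans (hsub h2).symm)
    · exact (hsub h1).trans (hab'.symm.trans (hsub h2).symm)

/-- The orbit of `a` is absorbed by that of `b`; the orbits of `f` other than that of `a` correspond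
to the orbits of the product. -/
theorem numOrbits_swap_mul_of_not_sameCycle [Finite X] [DecidableEq X] {f : Equiv.Perm X} {a b : X}
    (hab : ¬ f.SameCycle a b) : numOrbits (Equiv.swap a b * f) + 1 = numOrbits f := by
  classical
  set f' := Equiv.swap a b * f with hf'
  have key := sameCycle_swap_mul hab
  let Q := Quotient (SameCycle.setoid f)
  let qa : Q := Quotient.mk (SameCycle.setoid f) a
  have hcard : Nat.card Q = Nat.card {c : Q // c ≠ qa} + 1 := by
    rw [← Finite.card_option, Nat.card_congr (Equiv.optionSubtypeNe qa)]
  have hsub : ∀ u v, f.SameCycle u v → f'.SameCycle u v := fun u v h => (key u v).2 (Or.inl h)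
  have hbij : Nat.card {c : Q // c ≠ qa} = Nat.card (Quotient (SameCycle.setoid f')) := by
    refine Nat.card_eq_of_bijective (fun c => Quotient.map (sa := SameCycle.setoid f)
      (sb := SameCycle.setoid f') id hsub c.1) ⟨?_, ?_⟩
    · rintro ⟨⟨x⟩, hx⟩ ⟨⟨y⟩, hy⟩ hxy
      have hx' : ¬ f.SameCycle x a := fun h => hx (Quotient.sound h)
      have hy' : ¬ f.SameCycle y a := fun h => hy (Quotient.sound h)
      have h : f'.SameCycle x y := Quotient.exact hxy
      rw [key] at h
      refine Subtype.ext (Quotient.sound ?_)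
      rcases h with h | ⟨h1, h2⟩ | ⟨h1, h2⟩
      · exact h
      · exact absurd h1 hx'
      · exact absurd h2 hy'
    · rintro ⟨y⟩
      by_cases hy : f.SameCycle y a
      · refine ⟨⟨Quotient.mk (SameCycle.setoid f) b, fun h => hab ?_⟩, ?_⟩
        · exact SameCycle.symm (Quotient.exact h)
        · exact Quotient.sound ((key _ _).2 (Or.inr (Or.inr ⟨SameCycle.rfl, hy⟩)))
      · exact ⟨⟨Quotient.mk (SameCycle.setoid f) y, fun h => hy (Quotient.exact h)⟩, rfl⟩
  rw [numOrbits, numOrbits, ← hbij]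
  exact hcard.symm

/-- A second multiplication by the swap gives back `f`, so the merging count applies to the product
once `a` and `b` are known to be separated there. -/
theorem numOrbits_swap_mul_of_sameCycle [Finite X] [DecidableEq X] {f : Equiv.Perm X} {a b : X}
    (hne : a ≠ b) (hab : f.SameCycle a b) :
    numOrbits (Equiv.swap a b * f) = numOrbits f + 1 := by
  set f' := Equiv.swap a b * f with hf'
  have hff : Equiv.swap a b * f' = f := by rw [hf', ← mul_assoc, Equiv.swap_mul_self, one_mul]
  by_cases h : f'.SameCycle a b
  · exfalso
    have hval : ∀ x, f x ≠ a → f x ≠ b → f' x = f x := fun x h1 h2 => by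
      simp [f', Equiv.swap_apply_of_ne_of_ne h1 h2]
    -- the `f`-walk from `a` reaches `b` first; after the swap it closes up at `a`
    have hex : ∃ n, (f ^ (n + 1)) a = b := by
      obtain ⟨n, hn⟩ := hab.exists_nat_pow_eq
      cases n with
      | zero => exact absurd (by simpa using hn) hne
      | succ n => exact ⟨n, hn⟩
    classical
    let n := Nat.find hex
    have hn : (f ^ (n + 1)) a = b := Nat.find_spec hex
    have hmin : ∀ m < n, (f ^ (m + 1)) a ≠ b := fun m hm => Nat.find_min hex hm
    have hret : ∀ m, 0 < m → m ≤ n → (f ^ m) a ≠ a := by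
      intro m hm hmn h1
      have h2 : (f ^ (n + 1)) a = (f ^ (n + 1 - m)) a := by
        conv_lhs => rw [show n + 1 = (n + 1 - m) + m by omega, pow_add, Equiv.Perm.mul_apply, h1]
      refine hmin (n - m) (by omega) ?_
      rw [← hn, h2, show n + 1 - m = n - m + 1 by omega]
    have hcl : ∀ x, (∃ m ≤ n, x = (f ^ m) a) → (∃ m ≤ n, f' x = (f ^ m) a) := by
      rintro x ⟨m, hm, rfl⟩
      have hs : f ((f ^ m) a) = (f ^ (m + 1)) a := by rw [pow_succ', Equiv.Perm.mul_apply]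
      rcases hm.lt_or_eq with hm | hm
      · refine ⟨m + 1, hm, ?_⟩
        rw [hval, hs]
        · rw [hs]; exact hret _ (by omega) hm
        · rw [hs]; exact hmin m hm
      · refine ⟨0, by omega, ?_⟩
        rw [hm] at hs ⊢
        simp [f', hs, hn]
    obtain ⟨m, hm, hb⟩ := sameCycle_induction hcl h ⟨0, by omega, by simp⟩
    cases m with
    | zero => exact hne (by simpa using hb.symm)
    | succ m => exact hmin m (by omega) hb.symm
  · have := numOrbits_swap_mul_of_not_sameCycle h
    rw [hff] at this
    exact this.symm

theorem numOrbits_one [Finite X] : numOrbits (1 : Equiv.Perm X) = Nat.card X := by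
  symm
  refine Nat.card_eq_of_bijective (Quotient.mk (SameCycle.setoid 1)) ⟨fun x y h => ?_,
    Quotient.mk_surjective⟩
  exact sameCycle_one.1 (Quotient.exact h)

theorem numOrbits_eq_one {f : Equiv.Perm X} (x : X) (h : ∀ y, f.SameCycle y x) :
    numOrbits f = 1 := by
  have : Unique (Quotient (SameCycle.setoid f)) :=
    { default := Quotient.mk _ x
      uniq := by rintro ⟨y⟩; exact Quotient.sound (h y) }
  exact Nat.card_unique

end RotationSystem

/-! ## Noncrossing permutations -/

namespace RotationSystem

variable {X : Type}

/-- The cycles of `π` are the blocks of a noncrossing partition (for the linear order given by the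
rank `rk`), each of them run through in increasing order. -/
def Noncrossing (rk : X → ℕ) (π : Equiv.Perm X) : Prop :=
  ∀ x z, (rk x < rk z → rk z < rk (π x) → rk x < rk (π z) ∧ rk (π z) < rk (π x)) ∧
    (rk (π x) ≤ rk z → rk z ≤ rk x → rk (π x) ≤ rk (π z) ∧ rk (π z) ≤ rk x)

/-- `p` is the cyclic predecessor for the linear order given by the rank `rk`. -/
structure IsCyclicPred (rk : X → ℕ) (p : Equiv.Perm X) : Prop where
  inj : Function.Injective rk
  pred : ∀ x, rk x ≠ 0 → rk (p x) + 1 = rk x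
  last : ∀ x, rk x = 0 → ∀ y, rk y ≤ rk (p x)

/-- The elements of rank in `[b, x)` are permuted among themselves. -/
def ClosedIco (rk : X → ℕ) (π : Equiv.Perm X) (b x : ℕ) : Prop :=
  ∀ z, b ≤ rk z ∧ rk z < x → b ≤ rk (π z) ∧ rk (π z) < x

variable [Finite X] {rk : X → ℕ} {p : Equiv.Perm X}

theorem sameCycle_of_closedIco (hp : IsCyclicPred rk p) {π : Equiv.Perm X}
    (hπ : Noncrossing rk π) (b : X) (n : ℕ) : ∀ x : X, rk x = rk b + n →
    ClosedIco rk π (rk b) (rk x) → (π * p).SameCycle x b := by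
  induction n using Nat.strong_induction_on with
  | _ n ih =>
    intro x hx hcl
    rcases Nat.eq_zero_or_pos n with hn | hn
    · have : x = b := hp.inj (by omega)
      rw [this]
    · have hy := hp.pred x (by omega)
      set y := p x
      have h1 := hcl y ⟨by omega, by omega⟩
      have h2 : ∀ z, rk (π y) ≤ rk z ∧ rk z ≤ rk y → rk (π y) ≤ rk (π z) ∧ rk (π z) ≤ rk y :=
        fun z hz => (hπ y z).2 hz.1 hz.2
      have h3 := ih (rk (π y) - rk b) (by omega) (π y) (by omega) (by
        intro z hz
        have h4 := hcl z ⟨by omega, by omega⟩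
        refine ⟨h4.1, ?_⟩
        by_contra h5
        have := mem_of_apply_mem h2 (x := z) ⟨by omega, by omega⟩
        omega)
      have h4 : (π * p).SameCycle x (π y) := sameCycle_apply_self (π * p) x
      exact h4.trans h3

/-- Along the walk from `κ`, the current element `x` is either of rank at least that of `κ`, or the
interval from `x` up to `κ` (excluded) is closed. A step below `κ` enlarges this interval downwards
by a closed arc. -/
theorem closedIco_of_sameCycle (hp : IsCyclicPred rk p) {π : Equiv.Perm X}
    (hπ : Noncrossing rk π) {κ b : X} (hfix : ∀ x, rk κ ≤ rk x → π x = x)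
    (h : (π * p).SameCycle κ b) (hb : rk b < rk κ) : ClosedIco rk π (rk b) (rk κ) := by
  have hlt : ∀ z, rk z < rk κ → rk (π z) < rk κ := by
    intro z hz
    by_contra h1
    have := hfix (π z) (by omega)
    have := π.injective this
    rw [this] at h1
    omega
  have key := sameCycle_induction (S := fun x => rk κ ≤ rk x ∨ ClosedIco rk π (rk x) (rk κ))
    (f := π * p) (fun x hx => ?_) h (Or.inl le_rfl)
  · rcases key with h1 | h1
    · omega
    · exact h1
  · change rk κ ≤ rk (π (p x)) ∨ ClosedIco rk π (rk (π (p x))) (rk κ)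
    by_cases h0 : rk x = 0
    · have := hp.last x h0 κ
      rw [hfix _ this]
      exact Or.inl this
    · have hy := hp.pred x h0
      set y := p x
      by_cases hyk : rk κ ≤ rk y
      · rw [hfix _ hyk]; exact Or.inl hyk
      · right
        have hcl : ClosedIco rk π (rk x) (rk κ) := by
          rcases hx with hx | hx
          · intro z hz; omega
          · exact hx
        have h1 : rk (π y) < rk x := by
          by_contra h1
          have := mem_of_apply_mem hcl (x := y) ⟨by omega, hlt y (by omega)⟩
          omega
        intro z hz
        rcases Nat.lt_or_ge (rk z) (rk x) with h2 | h2
        · have := (hπ y z).2 hz.1 (by omega)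
          omega
        · have := hcl z ⟨h2, hz.2⟩
          omega

/-- The product inserts the fixed point `κ` into the cycle of `b`: the arc from the preimage `a` of
`b` now goes to `κ`, and `κ` goes to `b`. The descent from `κ` to `b` crosses nothing exactly when
the interval it spans is closed, and the ascent from `a` to `κ` is then harmless too. -/
theorem noncrossing_swap_mul_iff [DecidableEq X] (hinj : Function.Injective rk)
    {π : Equiv.Perm X} {κ b : X} (hfix : ∀ x, rk κ ≤ rk x → π x = x) (hb : rk b < rk κ) :
    Noncrossing rk (Equiv.swap κ b * π) ↔ Noncrossing rk π ∧ ClosedIco rk π (rk b) (rk κ) := by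
  have hlt : ∀ z, rk z < rk κ → rk (π z) < rk κ := by
    intro z hz
    by_contra h1
    have := hfix (π z) (by omega)
    have := π.injective this
    rw [this] at h1
    omega
  obtain ⟨a, ha⟩ : ∃ a, π a = b := ⟨π.symm b, by simp⟩
  have hak : rk a < rk κ := by
    by_contra h
    rw [hfix a (by omega)] at ha
    rw [ha] at h; omega
  set π' := Equiv.swap κ b * π with hπ'
  have va : π' a = κ := by simp [π', ha]
  have vk : π' κ = b := by simp [π', hfix κ le_rfl]
  have vo : ∀ x, x ≠ a → x ≠ κ → π' x = π x := by
    intro x h1 h2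
    have h3 : π x ≠ b := fun h => h1 (π.injective (h.trans ha.symm))
    have h4 : π x ≠ κ := fun h => h2 (π.injective (h.trans (hfix κ le_rfl).symm))
    simp [π', Equiv.swap_apply_of_ne_of_ne h4 h3]
  have hne : ∀ {x y : X}, rk x ≠ rk y → x ≠ y := fun h h' => h (h' ▸ rfl)
  have hgt : ∀ x, rk κ < rk x → π' x = x := fun x hx => by
    rw [vo x (hne (by omega)) (hne (by omega)), hfix x hx.le]
  constructor
  · intro h
    have hcl : ClosedIco rk π (rk b) (rk κ) := by
      intro z hz
      refine ⟨?_, hlt z hz.2⟩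
      by_cases hza : z = a
      · rw [hza, ha]
      · have := (h κ z).2 (by rw [vk]; exact hz.1) hz.2.le
        rw [vk, vo z hza (hne (by omega))] at this
        exact this.1
    have hba : rk b ≤ rk a :=
      (mem_of_apply_mem hcl (x := a) (by rw [ha]; exact ⟨le_rfl, hb⟩)).1
    have hoo : ∀ z, rk a < rk z ∧ rk z < rk κ → rk a < rk (π z) ∧ rk (π z) < rk κ := by
      intro z hz
      have := (h a z).1 hz.1 (by rw [va]; exact hz.2)
      rwa [va, vo z (hne (by omega)) (hne (by omega))] at this
    refine ⟨fun x z => ?_, hcl⟩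
    by_cases hxk : rk κ ≤ rk x
    · rw [hfix x hxk]
      refine ⟨fun h1 h2 => by omega, fun h1 h2 => ?_⟩
      have : z = x := hinj (by omega)
      rw [this, hfix x hxk]; omega
    · have hx2 := hlt x (by omega)
      by_cases hxa : x = a
      · rw [hxa, ha]
        refine ⟨fun h1 h2 => by omega, fun h1 h2 => ?_⟩
        have h3 := hcl z ⟨h1, by omega⟩
        refine ⟨h3.1, ?_⟩
        by_contra h4
        have := mem_of_apply_mem hoo (x := z) ⟨by omega, h3.2⟩
        omega
      · have h1 := h x z
        rw [vo x hxa (hne (by omega))] at h1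
        by_cases hza : z = a
        · rw [hza, va] at h1
          rw [hza]
          refine ⟨fun h2 h3 => ?_, fun h2 h3 => ?_⟩
          · have := h1.1 h2 h3; omega
          · have := h1.2 h2 h3; omega
        · refine ⟨fun h2 h3 => ?_, fun h2 h3 => ?_⟩
          · rw [vo z hza (hne (by omega))] at h1; exact h1.1 h2 h3
          · rw [vo z hza (hne (by omega))] at h1; exact h1.2 h2 h3
  · rintro ⟨h, hcl⟩ x z
    have hba : rk b ≤ rk a :=
      (mem_of_apply_mem hcl (x := a) (by rw [ha]; exact ⟨le_rfl, hb⟩)).1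
    have hcc : ∀ z, rk b ≤ rk z ∧ rk z ≤ rk a → rk b ≤ rk (π z) ∧ rk (π z) ≤ rk a := by
      intro z hz
      have := (h a z).2 (by rw [ha]; exact hz.1) hz.2
      rwa [ha] at this
    rcases lt_trichotomy (rk x) (rk κ) with hxk | hxk | hxk
    · by_cases hxa : x = a
      · rw [hxa, va]
        refine ⟨fun h1 h2 => ?_, fun h1 h2 => by omega⟩
        rw [vo z (hne (by omega)) (hne (by omega))]
        have h3 := hcl z ⟨by omega, h2⟩
        refine ⟨?_, h3.2⟩
        by_contra h4
        have := mem_of_apply_mem hcc (x := z) ⟨h3.1, by omega⟩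
        omega
      · have hx2 := hlt x hxk
        rw [vo x hxa (hne (by omega))]
        have hpa : π x ≠ b := fun h => hxa (π.injective (h.trans ha.symm))
        have hpa' : rk (π x) ≠ rk b := fun h => hpa (hinj h)
        have hxa' : rk x ≠ rk a := fun h => hxa (hinj h)
        by_cases hza : z = a
        · rw [hza, va]
          have h1 := h x a
          rw [ha] at h1
          refine ⟨fun h2 h3 => ?_, fun h2 h3 => ?_⟩
          · have h4 := h1.1 h2 h3
            have := mem_of_apply_mem hcl (x := x) ⟨by omega, by omega⟩; omega
          · have h4 := h1.2 h2 h3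
            have := hcl x ⟨by omega, by omega⟩; omega
        · refine ⟨fun h2 h3 => ?_, fun h2 h3 => ?_⟩
          · rw [vo z hza (hne (by omega))]; exact (h x z).1 h2 h3
          · rw [vo z hza (hne (by omega))]; exact (h x z).2 h2 h3
    · have : x = κ := hinj hxk
      subst this
      rw [vk]
      refine ⟨fun h1 h2 => by omega, fun h1 h2 => ?_⟩
      by_cases hza : z = a
      · rw [hza, va]; omega
      · by_cases hzk : z = x
        · rw [hzk, vk]; omega
        · have h3 : rk z ≠ rk x := fun h => hzk (hinj h)
          rw [vo z hza hzk]
          have := hcl z ⟨h1, by omega⟩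
          omega
    · rw [hgt x hxk]
      refine ⟨fun h1 h2 => by omega, fun h1 h2 => ?_⟩
      have : z = x := hinj (by omega)
      rw [this, hgt x hxk]; omega

theorem sameCycle_cyclicPred {X : Type} {rk : X → ℕ} {p : Equiv.Perm X} (hp : IsCyclicPred rk p)
    {x₀ : X} (h₀ : rk x₀ = 0) (n : ℕ) :
    ∀ x, rk x = n → p.SameCycle x x₀ := by
  induction n with
  | zero => intro x hx; rw [hp.inj (hx.trans h₀.symm)]
  | succ n ih =>
    intro x hx
    have := hp.pred x (by omega)
    exact (sameCycle_apply_self p x).trans (ih _ (by omega))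

/-- Induction on a bound for the ranks of the moved elements. Let `κ` be the largest moved element
and `b` its image. Then `π` is `swap κ b` times a permutation `π₀` that fixes `κ`, so `π` has one
orbit fewer than `π₀`. The sum is preserved exactly if the swap splits an orbit of `π₀ * p`;
otherwise it drops by `2`. For noncrossing `π₀`, splitting is the closure condition under which the
product remains noncrossing. -/
theorem numOrbits_add_numOrbits_mul_pred (hp : IsCyclicPred rk p) {x₀ : X} (h₀ : rk x₀ = 0)
    (k : ℕ) : ∀ π : Equiv.Perm X, (∀ x, k ≤ rk x → π x = x) →
    numOrbits π + numOrbits (π * p) ≤ Nat.card X + 1 ∧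
      (numOrbits π + numOrbits (π * p) = Nat.card X + 1 ↔ Noncrossing rk π) := by
  classical
  induction k with
  | zero =>
    intro π hπ
    have : π = 1 := Equiv.ext fun x => hπ x (Nat.zero_le _)
    subst this
    have h1 : numOrbits p = 1 := numOrbits_eq_one x₀ fun y => sameCycle_cyclicPred hp h₀ _ y rfl
    rw [one_mul, numOrbits_one, h1]
    refine ⟨le_rfl, ⟨fun _ x z => ?_, fun _ => rfl⟩⟩
    simp only [Equiv.Perm.one_apply]
    omega
  | succ k ih =>
    intro π hπ
    by_cases hk : ∃ κ, rk κ = k ∧ π κ ≠ κ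
    · obtain ⟨κ, hκ, hne⟩ := hk
      set b := π κ with hb
      have hbk : rk b < rk κ := by
        have h1 : rk b ≠ rk κ := fun h => hne (hp.inj h)
        by_contra h2
        exact hne (π.injective (hπ b (by omega)))
      set π₀ := Equiv.swap κ b * π with hπ₀
      have hsw : Equiv.swap κ b * π₀ = π := by
        rw [hπ₀, ← mul_assoc, Equiv.swap_mul_self, one_mul]
      have hfix : ∀ x, rk κ ≤ rk x → π₀ x = x := by
        intro x hx
        rcases hx.lt_or_eq with h | h
        · have h1 : π x = x := hπ x (by omega)
          have h2 : x ≠ κ := fun h' => by rw [h'] at h; omega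
          have h3 : x ≠ b := fun h' => by rw [h'] at h; omega
          simp [π₀, h1, Equiv.swap_apply_of_ne_of_ne h2 h3]
        · have : x = κ := hp.inj h.symm
          subst this
          simp [π₀, ← hb]
      obtain ⟨ih1, ih2⟩ := ih π₀ fun x hx => hfix x (by omega)
      have hns : ¬ π₀.SameCycle κ b := fun h => by
        have := h.eq_of_left (hfix κ le_rfl)
        rw [← this] at hbk; omega
      have c1 := numOrbits_swap_mul_of_not_sameCycle hns
      rw [hsw] at c1
      have hsp : Equiv.swap κ b * (π₀ * p) = π * p := by rw [← mul_assoc, hsw]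
      have hnc := noncrossing_swap_mul_iff hp.inj hfix hbk
      rw [hsw] at hnc
      by_cases hs : (π₀ * p).SameCycle κ b
      · have c2 := numOrbits_swap_mul_of_sameCycle (Ne.symm hne) hs
        rw [hsp] at c2
        refine ⟨by omega, ?_⟩
        rw [hnc, ← ih2]
        constructor
        · intro h
          have h1 : numOrbits π₀ + numOrbits (π₀ * p) = Nat.card X + 1 := by omega
          exact ⟨h1, closedIco_of_sameCycle hp (ih2.1 h1) hfix hs hbk⟩
        · rintro ⟨h, -⟩; omega
      · have c2 := numOrbits_swap_mul_of_not_sameCycle hs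
        rw [hsp] at c2
        refine ⟨by omega, ⟨fun h => by omega, fun h => ?_⟩⟩
        have h1 := hnc.1 h
        exact absurd (sameCycle_of_closedIco hp h1.1 b (rk κ - rk b) κ (by omega) h1.2) hs
    · push Not at hk
      refine ih π fun x hx => ?_
      rcases hx.lt_or_eq with h | h
      · exact hπ x h
      · exact hk x h.symm

/-- The genus formula for noncrossing permutations. -/
theorem numOrbits_add_eq_iff_noncrossing (hp : IsCyclicPred rk p) {x₀ : X} (h₀ : rk x₀ = 0)
    (π : Equiv.Perm X) :
    numOrbits π + numOrbits (π * p) = Nat.card X + 1 ↔ Noncrossing rk π := by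
  obtain ⟨m, hm⟩ : ∃ m, ∀ x, rk x < m := by
    obtain ⟨m, hm⟩ := (Set.finite_range rk).bddAbove
    exact ⟨m + 1, fun x => Nat.lt_succ_of_le (hm ⟨x, rfl⟩)⟩
  exact (numOrbits_add_numOrbits_mul_pred hp h₀ m π fun x hx => absurd (hm x) (by omega)).2

/-- Each element goes to the next larger one of its cycle, and the largest to the smallest, so the
partition into cycles leaves no choice. -/
theorem Noncrossing.eq_of_sameCycle_iff (hinj : Function.Injective rk) {π π' : Equiv.Perm X}
    (h : Noncrossing rk π) (h' : Noncrossing rk π')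
    (hs : ∀ x y, π.SameCycle x y ↔ π'.SameCycle x y) : π = π' := by
  have hup : ∀ {π : Equiv.Perm X}, Noncrossing rk π → ∀ x y, π.SameCycle x y →
      rk x < rk (π x) → ¬ (rk x < rk y ∧ rk y < rk (π x)) := by
    intro π h x y hxy hx hy
    have := sameCycle_induction (S := fun z => rk x < rk z ∧ rk z < rk (π x))
      (fun z hz => (h x z).1 hz.1 hz.2) hxy.symm hy
    omega
  have hdown : ∀ {π : Equiv.Perm X}, Noncrossing rk π → ∀ x y, π.SameCycle x y →
      rk (π x) ≤ rk x → rk (π x) ≤ rk y ∧ rk y ≤ rk x := by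
    intro π h x y hxy hx
    exact sameCycle_induction (S := fun z => rk (π x) ≤ rk z ∧ rk z ≤ rk x)
      (fun z hz => (h x z).2 hz.1 hz.2) hxy ⟨hx, le_rfl⟩
  refine Equiv.ext fun x => hinj ?_
  have a1 : π.SameCycle x (π' x) := (hs _ _).2 (sameCycle_apply_self π' x)
  have a2 : π'.SameCycle x (π x) := (hs _ _).1 (sameCycle_apply_self π x)
  rcases Nat.lt_or_ge (rk x) (rk (π x)) with h1 | h1 <;>
    rcases Nat.lt_or_ge (rk x) (rk (π' x)) with h2 | h2
  · have := hup h x _ a1 h1; have := hup h' x _ a2 h2; omega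
  · have := hdown h' x _ a2 h2; omega
  · have := hdown h x _ a1 h1; omega
  · have := hdown h' x _ a2 h2; have := hdown h x _ a1 h1; omega

/-- The largest element of a cycle of a noncrossing permutation: its image is the smallest one. -/
theorem Noncrossing.exists_last {π : Equiv.Perm X} (h : Noncrossing rk π) (x : X) :
    ∃ y, π.SameCycle x y ∧ ∀ z, π.SameCycle x z → rk (π y) ≤ rk z ∧ rk z ≤ rk y := by
  obtain ⟨y, hy, hmax⟩ := Set.exists_max_image {z | π.SameCycle x z} rk (Set.toFinite _)
    ⟨x, SameCycle.rfl⟩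
  refine ⟨y, hy, fun z hz => ?_⟩
  exact sameCycle_induction (S := fun z => rk (π y) ≤ rk z ∧ rk z ≤ rk y)
      (fun z hz => (h y z).2 hz.1 hz.2) (SameCycle.symm hy |>.trans hz)
      ⟨hmax _ (SameCycle.trans hy (sameCycle_apply_self π y)), le_rfl⟩

/-- Glue only the cycles in `Q`: two elements of another cycle are still in the same face. -/
theorem Noncrossing.sameCycle_of_partial (hp : IsCyclicPred rk p) {π πQ : Equiv.Perm X}
    (h : Noncrossing rk π) {Q : X → Prop} (hQ : ∀ x, Q x → πQ x = π x)
    (hnQ : ∀ x, ¬ Q x → πQ x = x) (hinv : ∀ x, Q x → Q (π x)) {u v : X} (hu : ¬ Q u) (hv : ¬ Q v)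
    (huv : π.SameCycle u v) : (πQ * p).SameCycle u v := by
  have hncQ : Noncrossing rk πQ := by
    intro x z
    by_cases hx : Q x
    · rw [hQ x hx]
      by_cases hz : Q z
      · rw [hQ z hz]; exact h x z
      · rw [hnQ z hz]; omega
    · rw [hnQ x hx]
      refine ⟨fun _ _ => by omega, fun h1 h2 => ?_⟩
      have : z = x := hp.inj (by omega)
      rw [this, hnQ x hx]; omega
  wlog hlt : rk u < rk v generalizing u v with H
  · rcases Nat.lt_or_ge (rk v) (rk u) with h1 | h1
    · exact (H hv hu huv.symm h1).symm
    · have : u = v := hp.inj (by omega)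
      rw [this]
  have hne : ∀ z, Q z → π z ≠ u ∧ π z ≠ v := fun z hz =>
    ⟨fun h => hu (h ▸ hinv z hz), fun h => hv (h ▸ hinv z hz)⟩
  -- An arc of a cycle in `Q` leaving the interval strictly between `u` and `v` would separate `u`
  -- from `v`, which lie in one cycle of `π`.
  have hcl : ClosedIco rk πQ (rk u + 1) (rk v) := by
    intro z hz
    by_cases hzQ : Q z
    · rw [hQ z hzQ]
      have h1 : rk (π z) ≠ rk u := fun h => (hne z hzQ).1 (hp.inj h)
      have h2 : rk (π z) ≠ rk v := fun h => (hne z hzQ).2 (hp.inj h)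
      by_contra h3
      rcases Nat.lt_or_ge (rk (π z)) (rk u) with h4 | h4
      · have := sameCycle_induction (S := fun w => rk (π z) ≤ rk w ∧ rk w ≤ rk z)
          (fun w hw => (h z w).2 hw.1 hw.2) huv ⟨by omega, by omega⟩
        omega
      · have := sameCycle_induction (S := fun w => rk z < rk w ∧ rk w < rk (π z))
          (fun w hw => (h z w).1 hw.1 hw.2) huv.symm ⟨by omega, by omega⟩
        omega
    · rw [hnQ z hzQ]; exact hz
  have hsucc : rk (p.symm u) = rk u + 1 := by
    by_cases h0 : rk (p.symm u) = 0
    · have := hp.last _ h0 v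
      rw [Equiv.apply_symm_apply] at this; omega
    · have := hp.pred _ h0
      rw [Equiv.apply_symm_apply] at this; omega
  -- The walk descends from `v` to the successor of `u`; its next step reaches `u`, because `πQ`
  -- fixes `u`.
  have h1 := sameCycle_of_closedIco hp hncQ (p.symm u) (rk v - (rk u + 1)) v (by omega)
    (by rw [hsucc]; exact hcl)
  have h2 := sameCycle_apply_self (πQ * p) (p.symm u)
  rw [Equiv.Perm.mul_apply, Equiv.apply_symm_apply, hnQ u hu] at h2
  exact (h1.trans h2).symm

end RotationSystem

/-! ## Addresses in plane trees -/

section Lex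

theorem List.lt_append_cons (l : List ℕ) (i : ℕ) (m : List ℕ) : l < l ++ i :: m := by
  induction l with
  | nil => exact List.nil_lt_cons i m
  | cons a l ih => exact List.cons_lt_cons_iff.2 (Or.inr ⟨rfl, ih⟩)

theorem List.IsPrefix.lex_le {l m : List ℕ} (h : l <+: m) : l ≤ m := by
  obtain ⟨r, rfl⟩ := h
  cases r with
  | nil => simp
  | cons i r => exact (List.lt_append_cons l i r).le

theorem List.append_lt_append_iff (l : List ℕ) {m n : List ℕ} : l ++ m < l ++ n ↔ m < n := by
  induction l with
  | nil => simp
  | cons a l ih => simp [ih]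

theorem List.append_le_append_iff (l : List ℕ) {m n : List ℕ} : l ++ m ≤ l ++ n ↔ m ≤ n := by
  rw [← not_lt, ← not_lt, List.append_lt_append_iff]

/-- What is to the right of a node is to the right of its descendants. -/
theorem List.lt_of_lt_of_not_prefix {l w m : List ℕ} (h : l < w) (hw : ¬ l <+: w) (hm : l <+: m) :
    m < w := by
  obtain ⟨r, rfl⟩ := hm
  induction l generalizing w with
  | nil => simp at hw
  | cons a l ih =>
    cases w with
    | nil => simp at h
    | cons b w =>
      rw [List.cons_lt_cons_iff] at h
      rw [List.cons_append, List.cons_lt_cons_iff]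
      rcases h with h | ⟨rfl, h⟩
      · exact Or.inl h
      · exact Or.inr ⟨rfl, ih h (by simpa using hw)⟩

/-- The descendants of a node form an interval. -/
theorem List.prefix_of_between {l w m : List ℕ} (h1 : l ≤ w) (h2 : w ≤ m) (hm : l <+: m) :
    l <+: w := by
  rcases h1.lt_or_eq with h | rfl
  · by_contra hw
    exact absurd (List.lt_of_lt_of_not_prefix h hw hm) (not_lt.2 h2)
  · exact List.prefix_rfl

/-- Used to place whatever comes between two consecutive siblings in the sub-tree of the first. -/
theorem List.prefix_of_ge_of_lt_succ {l w : List ℕ} {i : ℕ} (h1 : l ++ [i] ≤ w)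
    (h2 : w < l ++ [i + 1]) : l ++ [i] <+: w := by
  have hl : l <+: w := List.prefix_of_between ((List.lt_append_cons l i []).le.trans h1) h2.le
    (List.prefix_append _ _)
  obtain ⟨r, rfl⟩ := hl
  rw [List.append_le_append_iff] at h1
  rw [List.append_lt_append_iff] at h2
  cases r with
  | nil => exact absurd h1 (by simp)
  | cons j r =>
    rw [← not_lt, List.cons_lt_cons_iff] at h1
    rw [List.cons_lt_cons_iff] at h2
    have : j = i := by
      push Not at h1
      rcases h2 with h2 | ⟨h2, h3⟩
      · omega
      · simp at h3
    subst this
    exact ⟨r, by simp⟩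

theorem List.lt_succ_of_prefix {l m : List ℕ} {i j : ℕ} (hij : i < j) (h : l ++ [i] <+: m) :
    m < l ++ [j] := by
  obtain ⟨r, rfl⟩ := h
  rw [List.append_assoc, List.append_lt_append_iff]
  exact List.cons_lt_cons_iff.2 (Or.inl hij)

theorem List.exists_concat_prefix {l m : List ℕ} (h : l <+: m) (hne : m ≠ l) :
    ∃ i, l ++ [i] <+: m := by
  obtain ⟨r, rfl⟩ := h
  cases r with
  | nil => simp at hne
  | cons i r => exact ⟨i, r, by simp⟩

end Lex

namespace PlaneTree

variable {α β : Type}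

/-- The sub-tree at an address. -/
def subtree? : PlaneTree α → List ℕ → Option (PlaneTree α)
  | t, [] => some t
  | node _ cs, i :: l => cs[i]?.bind fun t => subtree? t l

theorem subtree?_append (T : PlaneTree α) (l m : List ℕ) :
    T.subtree? (l ++ m) = (T.subtree? l).bind fun t => t.subtree? m := by
  induction l generalizing T with
  | nil => simp [subtree?]
  | cons i l ih =>
    cases T with
    | node a cs =>
      simp only [List.cons_append, subtree?, Option.bind_assoc]
      congr 1
      funext t
      exact ih t

theorem mem_forestNodes {ts : List (PlaneTree α)} {i : ℕ} {x : List ℕ × α} :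
    x ∈ forestNodes i ts ↔ ∃ j t m, ts[j]? = some t ∧ (m, x.2) ∈ t.nodes ∧ x.1 = (i + j) :: m := by
  induction ts generalizing i with
  | nil => simp [forestNodes]
  | cons t ts ih =>
    rw [forestNodes, List.mem_append, ih]
    constructor
    · rintro (h | ⟨j, s, m, h1, h2, h3⟩)
      · obtain ⟨⟨m, a⟩, hz, rfl⟩ := List.mem_map.1 h
        exact ⟨0, t, m, by simp, hz, by simp⟩
      · exact ⟨j + 1, s, m, by simpa using h1, h2, by rw [h3]; congr 1; omega⟩
    · rintro ⟨j, s, m, h1, h2, h3⟩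
      cases j with
      | zero =>
        left
        simp only [List.getElem?_cons_zero, Option.some.injEq] at h1
        subst h1
        exact List.mem_map.2 ⟨(m, x.2), h2, by ext1 <;> simp [h3]⟩
      | succ j => exact Or.inr ⟨j, s, m, by simpa using h1, h2, by rw [h3]; congr 1; omega⟩

theorem mem_nodes_nil {a b : α} {cs : List (PlaneTree α)} :
    (([] : List ℕ), b) ∈ (node a cs).nodes ↔ b = a := by
  rw [nodes, List.mem_cons, mem_forestNodes]
  simp

theorem mem_nodes_cons {a b : α} {cs : List (PlaneTree α)} {i : ℕ} {l : List ℕ} :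
    (i :: l, b) ∈ (node a cs).nodes ↔ ∃ t, cs[i]? = some t ∧ (l, b) ∈ t.nodes := by
  rw [nodes, List.mem_cons, mem_forestNodes]
  constructor
  · rintro (h | ⟨j, t, m, h1, h2, h3⟩)
    · simp at h
    · simp only [zero_add, List.cons.injEq] at h3
      obtain ⟨rfl, rfl⟩ := h3
      exact ⟨t, h1, h2⟩
  · rintro ⟨t, h1, h2⟩
    exact Or.inr ⟨i, t, l, h1, h2, by simp⟩

theorem mem_nodes_iff_subtree? {T : PlaneTree α} {l : List ℕ} {a : α} :
    (l, a) ∈ T.nodes ↔ ∃ cs, T.subtree? l = some (node a cs) := by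
  induction l generalizing T with
  | nil =>
    cases T with
    | node b cs => rw [mem_nodes_nil]; simp [subtree?, eq_comm]
  | cons i l ih =>
    cases T with
    | node b cs =>
      rw [mem_nodes_cons, subtree?]
      constructor
      · rintro ⟨t, h1, h2⟩
        obtain ⟨cs', h⟩ := ih.1 h2
        exact ⟨cs', by simp [h1, h]⟩
      · rintro ⟨cs', h⟩
        obtain ⟨t, h1, h2⟩ := Option.bind_eq_some_iff.1 h
        exact ⟨t, h1, ih.2 ⟨cs', h2⟩⟩

/-- There is a node at the address `l`. -/
def Has (T : PlaneTree α) (l : List ℕ) : Prop := ∃ a, (l, a) ∈ T.nodes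

theorem has_iff {T : PlaneTree α} {l : List ℕ} : T.Has l ↔ ∃ t, T.subtree? l = some t := by
  simp only [Has, mem_nodes_iff_subtree?]
  constructor
  · rintro ⟨a, cs, h⟩; exact ⟨_, h⟩
  · rintro ⟨⟨a, cs⟩, h⟩; exact ⟨a, cs, h⟩

theorem has_nil (T : PlaneTree α) : T.Has [] := has_iff.2 ⟨T, by simp [subtree?]⟩

theorem Has.of_prefix {T : PlaneTree α} {l m : List ℕ} (h : T.Has m) (hl : l <+: m) : T.Has l := by
  obtain ⟨r, rfl⟩ := hl
  obtain ⟨t, ht⟩ := has_iff.1 h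
  rw [subtree?_append] at ht
  obtain ⟨s, hs, -⟩ := Option.bind_eq_some_iff.1 ht
  exact has_iff.2 ⟨s, hs⟩

theorem exists_numChildren (T : PlaneTree α) (l : List ℕ) : ∃ k, ∀ i, T.Has (l ++ [i]) ↔ i < k := by
  simp only [has_iff, subtree?_append]
  cases h : T.subtree? l with
  | none => exact ⟨0, by simp⟩
  | some t =>
    cases t with
    | node a cs => exact ⟨cs.length, fun i => by
      simp [subtree?, ← Option.isSome_iff_exists]⟩

theorem Has.of_le {T : PlaneTree α} {l : List ℕ} {i j : ℕ} (h : T.Has (l ++ [j])) (hij : i ≤ j) :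
    T.Has (l ++ [i]) := by
  obtain ⟨k, hk⟩ := T.exists_numChildren l
  rw [hk] at h ⊢
  omega

theorem Has.exists_last_child {T : PlaneTree α} {l : List ℕ} {j : ℕ} (h : T.Has (l ++ [j])) :
    ∃ i, T.Has (l ++ [i]) ∧ ¬ T.Has (l ++ [i + 1]) := by
  obtain ⟨k, hk⟩ := T.exists_numChildren l
  refine ⟨k - 1, ?_⟩
  simp only [hk] at h ⊢
  omega

theorem nodup_nodes (T : PlaneTree α) : T.nodes.Nodup :=
  T.pairwise_nodes.imp fun h h' => by rw [h'] at h; exact lt_irrefl _ h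

theorem eq_of_mem_nodes {T : PlaneTree α} {l : List ℕ} {a b : α} (ha : (l, a) ∈ T.nodes)
    (hb : (l, b) ∈ T.nodes) : a = b := by
  obtain ⟨cs, h⟩ := mem_nodes_iff_subtree?.1 ha
  obtain ⟨cs', h'⟩ := mem_nodes_iff_subtree?.1 hb
  rw [h] at h'
  simp only [Option.some.injEq, node.injEq] at h'
  exact h'.1

theorem has_map {f : α → β} {T : PlaneTree α} {l : List ℕ} : (T.map f).Has l ↔ T.Has l := by
  simp only [Has, nodes_map, List.mem_map, Prod.mk.injEq, Prod.exists]
  constructor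
  · rintro ⟨-, l', a, h, rfl, -⟩; exact ⟨a, h⟩
  · rintro ⟨a, h⟩; exact ⟨f a, l, a, h, rfl, rfl⟩

mutual
theorem length_lt_length_nodes : ∀ (T : PlaneTree α), ∀ x ∈ T.nodes, x.1.length < T.nodes.length
  | node a cs => by
    intro x hx
    rw [nodes, List.mem_cons] at hx
    rw [nodes, List.length_cons]
    rcases hx with rfl | hx
    · simp
    · have := length_le_length_forestNodes cs 0 x hx
      omega
theorem length_le_length_forestNodes : ∀ (ts : List (PlaneTree α)) (i : ℕ),
    ∀ x ∈ forestNodes i ts, x.1.length ≤ (forestNodes i ts).length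
  | [], _ => by simp [forestNodes]
  | t :: ts, i => by
    intro x hx
    rw [forestNodes, List.mem_append] at hx
    rw [forestNodes, List.length_append, List.length_map]
    rcases hx with hx | hx
    · obtain ⟨y, hy, rfl⟩ := List.mem_map.1 hx
      have := length_lt_length_nodes t y hy
      simp only [List.length_cons]
      omega
    · have := length_le_length_forestNodes ts (i + 1) x hx
      omega
end

end PlaneTree

/-! ## The rotation of a tree with plugs -/

theorem List.prod_map_formPerm_of_notMem {ι α : Type} [DecidableEq α] (F : ι → List α)
    (L : List ι) {x : α} (hx : ∀ i ∈ L, x ∉ F i) : (L.map fun i => (F i).formPerm).prod x = x := by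
  induction L with
  | nil => simp
  | cons i L ih =>
    rw [List.map_cons, List.prod_cons, Equiv.Perm.mul_apply,
      ih fun j hj => hx j (List.mem_cons_of_mem _ hj),
      List.formPerm_apply_of_notMem (hx i List.mem_cons_self)]

/-- The lists are pairwise disjoint, so all other factors fix `x` and its image. -/
theorem List.prod_map_formPerm_of_mem {ι α : Type} [DecidableEq α] (F : ι → List α)
    (L : List ι) (hL : L.Nodup) (hF : ∀ i j x, x ∈ F i → x ∈ F j → i = j) {i : ι} (hi : i ∈ L)
    {x : α} (hx : x ∈ F i) : (L.map fun i => (F i).formPerm).prod x = (F i).formPerm x := by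
  induction L with
  | nil => simp at hi
  | cons j L ih =>
    rw [List.nodup_cons] at hL
    rw [List.map_cons, List.prod_cons, Equiv.Perm.mul_apply]
    by_cases hij : i = j
    · subst hij
      rw [List.prod_map_formPerm_of_notMem F L]
      intro k hk hxk
      rw [hF k i x hxk hx] at hk
      exact hL.1 hk
    · have hi' : i ∈ L := by
        rcases List.mem_cons.1 hi with h | h
        · exact absurd h hij
        · exact h
      rw [ih hL.2 hi', List.formPerm_apply_of_notMem]
      intro h
      exact hij (hF _ _ _ (List.formPerm_apply_mem_of_mem hx) h)

theorem List.formPerm_apply_of_append {α : Type} [DecidableEq α] {A B : List α} {a b : α}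
    (h : (A ++ a :: b :: B).Nodup) : (A ++ a :: b :: B).formPerm a = b := by
  have := List.formPerm_apply_lt_getElem (A ++ a :: b :: B) h A.length (by simp)
  simpa using this

theorem List.exists_range_eq_append {i k : ℕ} (h : i + 1 < k) :
    ∃ A B, List.range k = A ++ i :: (i + 1) :: B := by
  refine ⟨List.range i, (List.range (k - i - 2)).map (i + 2 + ·), ?_⟩
  have h1 : k = i + (2 + (k - i - 2)) := by omega
  conv_lhs => rw [h1, List.range_add, List.range_add]
  simp [List.range_succ, Function.comp_def, add_assoc]

namespace PlaneTree

variable {T : PlaneTree ℕ}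

theorem Node.ext {u v : T.Node} (h : u.1.1 = v.1.1) : u = v := by
  obtain ⟨⟨l, a⟩, hu⟩ := u
  obtain ⟨⟨m, b⟩, hv⟩ := v
  simp only at h
  subst h
  have : a = b := eq_of_mem_nodes hu hv
  subst this
  rfl

theorem Node.has (u : T.Node) : T.Has u.1.1 := ⟨u.1.2, u.2⟩

theorem mem_nonRootNodes {x : List ℕ × ℕ} : x ∈ T.nonRootNodes ↔ x ∈ T.nodes ∧ x.1 ≠ [] := by
  simp [nonRootNodes]

/-- The lower end of an edge. -/
def Edge.toNode (v : T.Edge) : T.Node := ⟨v.1, (mem_nonRootNodes.1 v.2).1⟩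

@[simp] theorem Edge.toNode_val (v : T.Edge) : v.toNode.1 = v.1 := rfl

theorem Edge.has (v : T.Edge) : T.Has v.1.1 := v.toNode.has

theorem Edge.ne_nil (v : T.Edge) : v.1.1 ≠ [] := (mem_nonRootNodes.1 v.2).2

theorem Edge.ext {u v : T.Edge} (h : u.1.1 = v.1.1) : u = v := by
  have : u.toNode = v.toNode := Node.ext h
  exact Subtype.ext (congrArg (fun w : T.Node => w.1) this)

theorem Has.exists_node {l : List ℕ} (h : T.Has l) : ∃ u : T.Node, u.1.1 = l := by
  obtain ⟨a, ha⟩ := h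
  exact ⟨⟨(l, a), ha⟩, rfl⟩

theorem Has.exists_edge {l : List ℕ} (h : T.Has l) (hl : l ≠ []) : ∃ v : T.Edge, v.1.1 = l := by
  obtain ⟨a, ha⟩ := h
  exact ⟨⟨(l, a), mem_nonRootNodes.2 ⟨ha, hl⟩⟩, rfl⟩

theorem Has.exists_child {l : List ℕ} {i : ℕ} (h : T.Has (l ++ [i])) :
    ∃ v : T.Edge, v.1.1 = l ++ [i] := h.exists_edge (by simp)

theorem Node.eq_root_or_edge (u : T.Node) : u.1.1 = [] ∨ ∃ v : T.Edge, v.toNode = u := by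
  by_cases h : u.1.1 = []
  · exact Or.inl h
  · exact Or.inr ⟨⟨u.1, mem_nonRootNodes.2 ⟨u.2, h⟩⟩, rfl⟩

/-- The upper end of an edge. -/
noncomputable def Edge.parent (v : T.Edge) : T.Node :=
  (v.has.of_prefix (List.dropLast_prefix _)).exists_node.choose

theorem Edge.parent_addr (v : T.Edge) : v.parent.1.1 = v.1.1.dropLast :=
  (v.has.of_prefix (List.dropLast_prefix _)).exists_node.choose_spec

theorem Edge.exists_eq_concat (v : T.Edge) : ∃ i, v.1.1 = v.parent.1.1 ++ [i] :=
  ⟨v.1.1.getLast v.ne_nil, by rw [v.parent_addr, List.dropLast_append_getLast]⟩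

/-- The node to which a half-edge is attached. -/
noncomputable def owner (x : T.HalfEdge) : T.Node := if x.2 then x.1.parent else x.1.toNode

@[simp] theorem owner_false (v : T.Edge) : owner (v, false) = v.toNode := rfl

@[simp] theorem owner_true (v : T.Edge) : owner (v, true) = v.parent := rfl

theorem mem_childEdges {v : T.Edge} {l : List ℕ} : v ∈ T.childEdges l ↔ v.1.1.dropLast = l := by
  simp [childEdges]

theorem nodup_nonRootNodes : T.nonRootNodes.Nodup := T.nodup_nodes.filter _

theorem pairwise_childEdges (l : List ℕ) :
    (T.childEdges l).Pairwise (fun v w => v.1.1 < w.1.1) := by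
  refine List.Pairwise.filter _ ?_
  have h : T.nonRootNodes.Pairwise (fun x y => x.1 < y.1) := T.pairwise_nodes.filter _
  rw [← List.attach_map_subtype_val T.nonRootNodes, List.pairwise_map] at h
  exact h

theorem childEdges_addr (l : List ℕ) {k : ℕ} (hk : ∀ i, T.Has (l ++ [i]) ↔ i < k) :
    (T.childEdges l).map (fun v => v.1.1) = (List.range k).map (fun i => l ++ [i]) := by
  refine List.Pairwise.eq_of_mem_iff (r := (· < ·)) ?_ ?_ ?_
  · rw [List.pairwise_map]; exact T.pairwise_childEdges l
  · rw [List.pairwise_map]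
    refine List.pairwise_lt_range.imp fun h => ?_
    rw [List.append_lt_append_iff]
    exact List.cons_lt_cons_iff.2 (Or.inl h)
  · intro m
    simp only [List.mem_map, mem_childEdges, List.mem_range]
    constructor
    · rintro ⟨v, hv, rfl⟩
      have h := List.dropLast_append_getLast v.ne_nil
      rw [hv] at h
      refine ⟨v.1.1.getLast v.ne_nil, ?_, h⟩
      rw [← hk, h]; exact v.has
    · rintro ⟨i, hi, rfl⟩
      obtain ⟨v, hv⟩ := ((hk i).2 hi).exists_child
      exact ⟨v, by rw [hv, List.dropLast_concat], hv⟩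

open Classical in
/-- The half-edge with a given address. -/
noncomputable def half (T : PlaneTree ℕ) (l : List ℕ) (b : Bool) : T.Dart :=
  -- The plug of the root is a junk value, taken only at addresses that carry no edge.
  if h : ∃ v : T.Edge, v.1.1 = l then Sum.inl (h.choose, b) else Sum.inr T.has_nil.exists_node.choose

theorem half_eq (v : T.Edge) (b : Bool) : T.half v.1.1 b = Sum.inl (v, b) := by
  have h : ∃ w : T.Edge, w.1.1 = v.1.1 := ⟨v, rfl⟩
  rw [half, dif_pos h, Edge.ext h.choose_spec]

theorem childEdges_map_reverse (l : List ℕ) {k : ℕ} (hk : ∀ i, T.Has (l ++ [i]) ↔ i < k) :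
    (T.childEdges l).reverse.map (fun v => (Sum.inl (v, true) : T.Dart)) =
      (List.range k).reverse.map (fun i => T.half (l ++ [i]) true) := by
  have h : (T.childEdges l).map (fun v => (Sum.inl (v, true) : T.Dart)) =
      ((T.childEdges l).map (fun v => v.1.1)).map (fun m => T.half m true) := by
    rw [List.map_map]
    exact List.map_congr_left fun v _ => (half_eq v true).symm
  rw [List.map_reverse, h, childEdges_addr l hk, List.map_reverse, List.map_map]
  rfl

theorem around_root {u : T.Node} (hu : u.1.1 = []) {k : ℕ} (hk : ∀ i, T.Has ([] ++ [i]) ↔ i < k) :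
    T.around u = Sum.inr u :: (List.range k).reverse.map (fun i => T.half ([] ++ [i]) true) := by
  have h : ¬ u.1 ∈ T.nonRootNodes := fun h => (mem_nonRootNodes.1 h).2 hu
  rw [around, dif_neg h, hu, childEdges_map_reverse [] hk, List.nil_append]

theorem around_edge (v : T.Edge) {k : ℕ} (hk : ∀ i, T.Has (v.1.1 ++ [i]) ↔ i < k) :
    T.around v.toNode = Sum.inr v.toNode :: Sum.inl (v, false) ::
      (List.range k).reverse.map (fun i => T.half (v.1.1 ++ [i]) true) := by
  have h : v.toNode.1 ∈ T.nonRootNodes := v.2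
  rw [around, dif_pos h, ← childEdges_map_reverse _ hk]
  rfl

open Classical in
theorem mem_around {d : T.Dart} {u : T.Node} :
    d ∈ T.around u ↔ Sum.elim owner id d = u := by
  rcases d with ⟨v, _ | _⟩ | w
  · simp only [around, List.mem_cons, List.mem_append, Sum.elim_inl, owner_false]
    constructor
    · rintro (h | h | h)
      · simp at h
      · split_ifs at h with hu
        · simp only [List.mem_singleton, Sum.inl.injEq, Prod.mk.injEq, and_true] at h
          rw [h]; rfl
        · simp at h
      · simp at h
    · rintro rfl
      have h : v.toNode.1 ∈ T.nonRootNodes := v.2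
      exact Or.inr (Or.inl (by rw [dif_pos h]; exact List.mem_singleton.2 rfl))
  · simp only [around, List.mem_cons, List.mem_append, Sum.elim_inl, owner_true]
    constructor
    · rintro (h | h | h)
      · simp at h
      · split_ifs at h with hu
        · simp at h
        · simp at h
      · simp only [List.mem_map, List.mem_reverse, mem_childEdges, Sum.inl.injEq, Prod.mk.injEq,
          and_true, exists_eq_right] at h
        exact Node.ext (by rw [v.parent_addr, h])
    · rintro rfl
      refine Or.inr (Or.inr ?_)
      simp only [List.mem_map, List.mem_reverse, mem_childEdges, Sum.inl.injEq, Prod.mk.injEq,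
          and_true, exists_eq_right]
      rw [v.parent_addr]
  · simp only [around, List.mem_cons, List.mem_append, Sum.elim_inr, id]
    constructor
    · rintro (h | h | h)
      · exact Sum.inr_injective h
      · split_ifs at h with hu
        · simp at h
        · simp at h
      · simp at h
    · rintro rfl; exact Or.inl rfl

theorem nodup_around (u : T.Node) : (T.around u).Nodup := by
  rw [around, List.nodup_cons, List.nodup_append]
  refine ⟨?_, ?_, ?_, ?_⟩
  · split_ifs <;> simp
  · split_ifs <;> simp
  · rw [List.map_reverse, List.nodup_reverse]
    refine List.Nodup.map (fun v w h => by simpa using h) ?_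
    exact (T.pairwise_childEdges _).imp fun h h' => by rw [h'] at h; exact lt_irrefl _ h
  · intro a ha b hb
    split_ifs at ha
    · simp only [List.mem_singleton] at ha
      obtain ⟨v, -, rfl⟩ := List.mem_map.1 hb
      rw [ha]; simp
    · simp at ha

theorem initialRotation_apply {d : T.Dart} {u : T.Node} (h : d ∈ T.around u) :
    T.initialRotation d = (T.around u).formPerm d :=
  List.prod_map_formPerm_of_mem T.around _ (List.nodup_attach.2 T.nodup_nodes)
    (fun _ _ _ hi hj => (mem_around.1 hi).symm.trans (mem_around.1 hj)) (List.mem_attach _ _) h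

theorem initialRotation_of_append {u : T.Node} {A B : List T.Dart} {a b : T.Dart}
    (h : T.around u = A ++ a :: b :: B) : T.initialRotation a = b := by
  rw [initialRotation_apply (u := u) (by rw [h]; simp), h]
  exact List.formPerm_apply_of_append (h ▸ nodup_around u)

theorem initialRotation_of_last {u : T.Node} {A : List T.Dart} {a : T.Dart}
    (h : T.around u = Sum.inr u :: A) (ha : (Sum.inr u :: A).getLast (by simp) = a) :
    T.initialRotation a = Sum.inr u := by
  have ha' : a ∈ T.around u := by rw [h, ← ha]; exact List.getLast_mem _
  rw [initialRotation_apply ha', h, ← ha]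
  exact List.formPerm_apply_getLast _ _

/-- From here on the rotation of the tree is computed case by case: after a plug, after the
half-edge to the parent (with or without children), and after the half-edge to a child (with or
without a left sibling). Later arguments use only these values and not `formPerm`. -/
theorem initialRotation_plug (v : T.Edge) :
    T.initialRotation (Sum.inr v.toNode) = Sum.inl (v, false) := by
  obtain ⟨k, hk⟩ := T.exists_numChildren v.1.1
  exact initialRotation_of_append (A := []) (around_edge v hk)

theorem initialRotation_plug_root {u : T.Node} (hu : u.1.1 = []) {w : T.Edge} {i : ℕ}
    (hw : w.1.1 = [i]) (hi : ¬ T.Has [i + 1]) :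
    T.initialRotation (Sum.inr u) = Sum.inl (w, true) := by
  obtain ⟨k, hk⟩ := T.exists_numChildren []
  have hki : k = i + 1 := by
    have h1 := (hk i).1 (by rw [List.nil_append, ← hw]; exact w.has)
    have h2 := (hk (i + 1)).not.1 hi
    omega
  subst hki
  have h := around_root hu hk
  rw [List.range_succ, List.reverse_append, List.map_append] at h
  simp only [List.nil_append, List.reverse_singleton, List.map_cons, List.map_nil, List.singleton_append] at h
  rw [← hw, half_eq] at h
  exact initialRotation_of_append (A := []) h

theorem initialRotation_down {v w : T.Edge} {i : ℕ} (hw : w.1.1 = v.1.1 ++ [i])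
    (hi : ¬ T.Has (v.1.1 ++ [i + 1])) :
    T.initialRotation (Sum.inl (v, false)) = Sum.inl (w, true) := by
  obtain ⟨k, hk⟩ := T.exists_numChildren v.1.1
  have hki : k = i + 1 := by
    have h1 := (hk i).1 (by rw [← hw]; exact w.has)
    have h2 := (hk (i + 1)).not.1 hi
    omega
  subst hki
  have h := around_edge v hk
  rw [List.range_succ, List.reverse_append, List.map_append] at h
  simp only [List.reverse_singleton, List.map_cons, List.map_nil, List.singleton_append] at h
  rw [← hw, half_eq] at h
  exact initialRotation_of_append (A := [_]) h

theorem initialRotation_leaf {v : T.Edge} (hv : ¬ T.Has (v.1.1 ++ [0])) :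
    T.initialRotation (Sum.inl (v, false)) = Sum.inr v.toNode := by
  obtain ⟨k, hk⟩ := T.exists_numChildren v.1.1
  have hk0 : k = 0 := by
    have := (hk 0).not.1 hv
    omega
  subst hk0
  exact initialRotation_of_last (around_edge v hk) (by simp)

theorem exists_around_eq (u : T.Node) {k : ℕ} (hk : ∀ i, T.Has (u.1.1 ++ [i]) ↔ i < k) :
    ∃ A, T.around u = Sum.inr u :: A ++
      (List.range k).reverse.map (fun i => T.half (u.1.1 ++ [i]) true) := by
  rcases u.eq_root_or_edge with h | ⟨v, rfl⟩
  · refine ⟨[], ?_⟩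
    rw [h] at hk ⊢
    exact around_root h hk
  · exact ⟨[_], around_edge v hk⟩

theorem initialRotation_left {v w : T.Edge} {l : List ℕ} {i : ℕ} (hv : v.1.1 = l ++ [i + 1])
    (hw : w.1.1 = l ++ [i]) : T.initialRotation (Sum.inl (v, true)) = Sum.inl (w, true) := by
  obtain ⟨k, hk⟩ := T.exists_numChildren l
  obtain ⟨u, rfl⟩ := (v.has.of_prefix ⟨[i + 1], hv.symm⟩).exists_node
  obtain ⟨A, hA⟩ := exists_around_eq u hk
  obtain ⟨B, C, hr⟩ := List.exists_range_eq_append ((hk (i + 1)).1 (by rw [← hv]; exact v.has))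
  rw [hr] at hA
  simp only [List.reverse_append, List.reverse_cons, List.map_append, List.append_assoc,
    List.map_cons, List.map_nil, List.singleton_append] at hA
  rw [← hv, ← hw, half_eq, half_eq, ← List.append_assoc] at hA
  exact initialRotation_of_append hA

theorem initialRotation_up {v : T.Edge} {u : T.Node} (hv : v.1.1 = u.1.1 ++ [0]) :
    T.initialRotation (Sum.inl (v, true)) = Sum.inr u := by
  obtain ⟨k, hk⟩ := T.exists_numChildren u.1.1
  obtain ⟨A, hA⟩ := exists_around_eq u hk
  have hk0 : 0 < k := (hk 0).1 (by rw [← hv]; exact v.has)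
  obtain ⟨k, rfl⟩ : ∃ k', k = k' + 1 := ⟨k - 1, by omega⟩
  rw [List.range_succ_eq_map] at hA
  simp only [List.reverse_cons, List.map_append, List.map_cons, List.map_nil] at hA
  rw [← hv, half_eq, List.cons_append] at hA
  exact initialRotation_of_last hA (by simp)

end PlaneTree

open RotationSystem

/-! ## Gluing the nodes of a tree along a permutation -/

/-- The cyclic predecessor for the order of an enumeration. -/
def cyclicPred {X : Type} {N : ℕ} (e : Fin N ≃ X) : Equiv.Perm X :=
  e.symm.trans ((finRotate N).symm.trans e)

theorem isCyclicPred_cyclicPred {X : Type} {N : ℕ} (e : Fin N ≃ X) :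
    IsCyclicPred (fun x => (e.symm x).val) (cyclicPred e) := by
  have key : ∀ x, finRotate N (e.symm (cyclicPred e x)) = e.symm x := by
    intro x
    simp only [cyclicPred, Equiv.trans_apply, Equiv.symm_apply_apply, Equiv.apply_symm_apply]
  refine ⟨fun x y h => e.symm.injective (Fin.ext h), fun x hx => ?_, fun x hx y => ?_⟩
  · cases N with
    | zero => exact (e.symm x).elim0
    | succ m =>
      have h := key x
      by_cases h1 : e.symm (cyclicPred e x) = Fin.last m
      · rw [h1, finRotate_last] at h
        exact absurd (by rw [← h]; rfl) hx
      · have h2 := coe_finRotate_of_ne_last h1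
        rw [h] at h2
        exact h2.symm
  · cases N with
    | zero => exact (e.symm x).elim0
    | succ m =>
      have h := key x
      by_cases h1 : e.symm (cyclicPred e x) = Fin.last m
      · simp only [h1]; exact Fin.le_last _
      · have h2 := coe_finRotate_of_ne_last h1
        rw [h] at h2
        have hx' : (e.symm x).val = 0 := hx
        omega

namespace PlaneTree

variable {T : PlaneTree ℕ}

/-- The position of a node in prefix order. -/
def rank (u : T.Node) : ℕ := ((T.nodup_nodes.getEquiv).symm u).val

/-- The node before a given one in prefix order, cyclically. -/
def prevNode (T : PlaneTree ℕ) : Equiv.Perm T.Node := cyclicPred T.nodup_nodes.getEquiv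

theorem isCyclicPred_prevNode : IsCyclicPred (rank (T := T)) T.prevNode :=
  isCyclicPred_cyclicPred _

theorem rank_injective : Function.Injective (rank (T := T)) := isCyclicPred_prevNode.inj

theorem lt_of_rank_lt {u v : T.Node} (h : rank u < rank v) : u.1.1 < v.1.1 := by
  have h1 := List.pairwise_iff_getElem.1 T.pairwise_nodes _ _ (Fin.is_lt _) (Fin.is_lt _) h
  have h2 : ∀ w : T.Node, T.nodes[((T.nodup_nodes.getEquiv).symm w).val] = w.1 := fun w =>
    congrArg Subtype.val (T.nodup_nodes.getEquiv.apply_symm_apply w)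
  rwa [h2, h2] at h1

theorem rank_lt_iff {u v : T.Node} : rank u < rank v ↔ u.1.1 < v.1.1 := by
  refine ⟨lt_of_rank_lt, fun h => ?_⟩
  by_contra h1
  rcases (not_lt.1 h1).lt_or_eq with h2 | h2
  · exact lt_asymm h (lt_of_rank_lt h2)
  · rw [rank_injective h2] at h; exact lt_irrefl _ h

theorem rank_le_iff {u v : T.Node} : rank u ≤ rank v ↔ u.1.1 ≤ v.1.1 := by
  rw [← not_lt, ← not_lt, rank_lt_iff]

theorem prevNode_eq {u z : T.Node} (h : z.1.1 < u.1.1)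
    (hz : ∀ w : T.Node, w.1.1 < u.1.1 → w.1.1 ≤ z.1.1) : T.prevNode u = z := by
  simp only [← rank_lt_iff, ← rank_le_iff] at h hz
  have h1 := isCyclicPred_prevNode.pred u (by omega)
  have h2 := hz (T.prevNode u) (by omega)
  exact rank_injective (by omega)

theorem rank_root {u : T.Node} (hu : u.1.1 = []) : rank u = 0 := by
  by_contra h
  have h1 := isCyclicPred_prevNode.pred u h
  have h2 : rank (T.prevNode u) < rank u := by omega
  rw [rank_lt_iff, hu] at h2
  simp at h2

theorem prevNode_root {u z : T.Node} (hu : u.1.1 = []) (hz : ∀ w : T.Node, w.1.1 ≤ z.1.1) :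
    T.prevNode u = z := by
  have h1 := isCyclicPred_prevNode.last u (rank_root hu) z
  rw [rank_le_iff] at h1
  exact Node.ext (le_antisymm (hz _) h1)

/-- `z` is the last node, in prefix order, of the sub-tree at the address `l`. -/
def IsLastBelow (l : List ℕ) (z : T.Node) : Prop :=
  l <+: z.1.1 ∧ ∀ w : T.Node, l <+: w.1.1 → w.1.1 ≤ z.1.1

theorem Has.exists_isLastBelow {l : List ℕ} (h : T.Has l) : ∃ z : T.Node, IsLastBelow l z := by
  obtain ⟨u, hu⟩ := h.exists_node
  obtain ⟨z, hz, hmax⟩ := Set.exists_max_image {w : T.Node | l <+: w.1.1} rank (Set.toFinite _)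
    ⟨u, by change l <+: u.1.1; rw [hu]⟩
  exact ⟨z, hz, fun w hw => rank_le_iff.1 (hmax w hw)⟩

theorem IsLastBelow.eq {l : List ℕ} {z z' : T.Node} (h : IsLastBelow l z)
    (h' : IsLastBelow l z') : z = z' :=
  Node.ext (le_antisymm (h'.2 z h.1) (h.2 z' h'.1))

/-- The last node of a sub-tree is the last node of the sub-tree of the right-most child. -/
theorem IsLastBelow.child {l : List ℕ} {z : T.Node} (h : IsLastBelow l z) {i : ℕ}
    (hi : T.Has (l ++ [i])) (hi' : ¬ T.Has (l ++ [i + 1])) : IsLastBelow (l ++ [i]) z := by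
  refine ⟨?_, fun w hw => h.2 w ((List.prefix_append _ _).trans hw)⟩
  obtain ⟨c, hc⟩ := hi.exists_node
  have h1 := h.2 c (by rw [hc]; exact List.prefix_append _ _)
  have hne : z.1.1 ≠ l := by
    intro h2
    rw [h2, hc] at h1
    exact absurd h1 (not_le.2 (List.lt_append_cons l i []))
  obtain ⟨j, hj⟩ := List.exists_concat_prefix h.1 hne
  have hj' : T.Has (l ++ [j]) := z.has.of_prefix hj
  rcases lt_trichotomy i j with hij | rfl | hij
  · exact absurd (hj'.of_le hij) hi'
  · exact hj
  · rw [hc] at h1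
    exact absurd (List.lt_succ_of_prefix hij hj) (not_lt.2 h1)

theorem IsLastBelow.eq_of_leaf {u z : T.Node} (h : IsLastBelow u.1.1 z)
    (hu : ¬ T.Has (u.1.1 ++ [0])) : z = u := by
  by_contra hne
  obtain ⟨j, hj⟩ := List.exists_concat_prefix h.1 fun h' => hne (Node.ext h')
  exact hu ((z.has.of_prefix hj).of_le (Nat.zero_le j))

/-- A node strictly between `p` and `u` would be a proper descendant of `p` before its first child.
-/
theorem prevNode_of_leftmost {u p : T.Node} (h : u.1.1 = p.1.1 ++ [0]) : T.prevNode u = p := by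
  refine prevNode_eq (by rw [h]; exact List.lt_append_cons _ _ _) fun w hw => ?_
  by_contra h1
  push Not at h1
  have h2 : p.1.1 <+: w.1.1 :=
    List.prefix_of_between h1.le hw.le (by rw [h]; exact List.prefix_append _ _)
  obtain ⟨j, r, hj⟩ := List.exists_concat_prefix h2 fun h => by rw [h] at h1; exact lt_irrefl _ h1
  rw [h, ← hj, List.append_assoc, List.append_lt_append_iff] at hw
  simp [List.cons_lt_cons_iff] at hw

theorem prevNode_of_sibling {u z : T.Node} {l : List ℕ} {i : ℕ} (h : u.1.1 = l ++ [i + 1])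
    (hz : IsLastBelow (l ++ [i]) z) : T.prevNode u = z := by
  refine prevNode_eq (by rw [h]; exact List.lt_succ_of_prefix (Nat.lt_succ_self i) hz.1)
    fun w hw => ?_
  by_contra h1
  push Not at h1
  rw [h] at hw
  have h2 := List.prefix_of_ge_of_lt_succ (hz.1.lex_le.trans h1.le) hw
  exact absurd (hz.2 w h2) (not_le.2 h1)

theorem owner_initialRotation (d : T.Dart) :
    Sum.elim owner id (T.initialRotation d) = Sum.elim owner id d := by
  have h := mem_around.2 (rfl : Sum.elim owner id d = Sum.elim owner id d)
  have h2 := List.formPerm_apply_mem_of_mem h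
  rw [← initialRotation_apply h] at h2
  exact mem_around.1 h2

theorem exists_initialRotation_plug (hT : T.Has [0]) (u : T.Node) :
    ∃ y, T.initialRotation (Sum.inr u) = Sum.inl y := by
  rcases u.eq_root_or_edge with h | ⟨v, rfl⟩
  · obtain ⟨i, hi, hi'⟩ := Has.exists_last_child (l := []) hT
    obtain ⟨w, hw⟩ := hi.exists_child
    exact ⟨_, initialRotation_plug_root h hw hi'⟩
  · exact ⟨_, initialRotation_plug v⟩

/-- The half-edge that follows the plug of a node. -/
noncomputable def first (hT : T.Has [0]) (u : T.Node) : T.HalfEdge :=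
  (exists_initialRotation_plug hT u).choose

theorem initialRotation_inr (hT : T.Has [0]) (u : T.Node) :
    T.initialRotation (Sum.inr u) = Sum.inl (first hT u) :=
  (exists_initialRotation_plug hT u).choose_spec

theorem first_toNode (hT : T.Has [0]) (v : T.Edge) : first hT v.toNode = (v, false) :=
  Sum.inl_injective ((initialRotation_inr hT _).symm.trans (initialRotation_plug v))

theorem first_root (hT : T.Has [0]) {u : T.Node} (hu : u.1.1 = []) {w : T.Edge} {i : ℕ}
    (hw : w.1.1 = [i]) (hi : ¬ T.Has [i + 1]) : first hT u = (w, true) :=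
  Sum.inl_injective ((initialRotation_inr hT _).symm.trans (initialRotation_plug_root hu hw hi))

theorem owner_first (hT : T.Has [0]) (u : T.Node) : owner (first hT u) = u := by
  have h := owner_initialRotation (Sum.inr u : T.Dart)
  rw [initialRotation_inr hT u] at h
  exact h

theorem exists_initialRotation_eq_plug (hT : T.Has [0]) (u : T.Node) :
    ∃ x, T.initialRotation (Sum.inl x) = Sum.inr u := by
  rcases h : T.initialRotation.symm (Sum.inr u) with x | w
  · exact ⟨x, by rw [← h, Equiv.apply_symm_apply]⟩
  · have h1 : T.initialRotation (Sum.inr w) = Sum.inr u := by rw [← h, Equiv.apply_symm_apply]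
    rw [initialRotation_inr hT] at h1
    simp at h1

/-- The rotation `ρ` is obtained from the tree by merging the nodes along the cycles of `π` and
removing the plugs. -/
structure IsGlued (π : Equiv.Perm T.Node) (ρ : Equiv.Perm T.HalfEdge) : Prop where
  inl : ∀ {x y}, T.initialRotation (Sum.inl x) = Sum.inl y → ρ x = y
  inr : ∀ {x u}, T.initialRotation (Sum.inl x) = Sum.inr u →
    T.initialRotation (Sum.inr (π u)) = Sum.inl (ρ x)

/-- The same, when only the nodes in `Q`, a union of cycles containing all that are not trivial,
have lost their plugs. -/
structure PartiallyGlued (π : Equiv.Perm T.Node) (Q : T.Node → Prop) (σ : Equiv.Perm T.Dart) :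
    Prop where
  fix : ∀ {u}, ¬ Q u → π u = u
  plug_mem : ∀ {u}, Q u → σ (Sum.inr u) = Sum.inr u
  plug_notMem : ∀ {u}, ¬ Q u → σ (Sum.inr u) = T.initialRotation (Sum.inr u)
  inl : ∀ {x y}, T.initialRotation (Sum.inl x) = Sum.inl y → σ (Sum.inl x) = Sum.inl y
  inr_mem : ∀ {x u}, T.initialRotation (Sum.inl x) = Sum.inr u → Q u →
    σ (Sum.inl x) = T.initialRotation (Sum.inr (π u))
  inr_notMem : ∀ {x u}, T.initialRotation (Sum.inl x) = Sum.inr u → ¬ Q u →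
    σ (Sum.inl x) = Sum.inr u

theorem IsGlued.partiallyGlued {π : Equiv.Perm T.Node} {ρ : Equiv.Perm T.HalfEdge}
    (h : IsGlued π ρ) : PartiallyGlued π (fun _ => True) (Equiv.Perm.sumCongr ρ 1) where
  fix h := absurd trivial h
  plug_mem _ := by simp
  plug_notMem h := absurd trivial h
  inl hx := by simp [h.inl hx]
  inr_mem hx _ := by simp [h.inr hx]
  inr_notMem _ h := absurd trivial h

/-- The contour of faces. -/
abbrev contour (σ : Equiv.Perm T.Dart) : Equiv.Perm T.Dart := σ * Equiv.Perm.sumCongr T.flip 1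

theorem contour_inl (σ : Equiv.Perm T.Dart) (v : T.Edge) (b : Bool) :
    contour σ (Sum.inl (v, b)) = σ (Sum.inl (v, !b)) := by
  simp [contour, flip]

-- Face contours of a partially glued tree

section Faces

variable {π : Equiv.Perm T.Node} {Q : T.Node → Prop} {σ : Equiv.Perm T.Dart}

/-- If the plug of `u` is gone, the contour jumps to the first half-edge of `π u`. If it is still
there, then `π u = u` and the contour passes by the plug. -/
theorem PartiallyGlued.sameCycle_plug (h : PartiallyGlued π Q σ) (hT : T.Has [0]) {v : T.Edge}
    {b : Bool} {u : T.Node} (hu : T.initialRotation (Sum.inl (v, !b)) = Sum.inr u) :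
    (contour σ).SameCycle (Sum.inl (v, b)) (Sum.inl (first hT (π u))) := by
  have h1 := sameCycle_apply_self (contour σ) (Sum.inl (v, b))
  rw [contour_inl] at h1
  by_cases hQ : Q u
  · rwa [h.inr_mem hu hQ, initialRotation_inr hT] at h1
  · rw [h.inr_notMem hu hQ] at h1
    have h2 := sameCycle_apply_self (contour σ) (Sum.inr u)
    have h3 : contour σ (Sum.inr u) = Sum.inl (first hT (π u)) := by
      rw [h.fix hQ, ← initialRotation_inr hT, ← h.plug_notMem hQ]
      simp [contour]
    rw [h3] at h2
    exact h1.trans h2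

/-- From the upper half of an edge the contour runs down through the right-most children to the last
node `z` of the sub-tree, and there it meets the place of the plug of `z`. -/
theorem PartiallyGlued.sameCycle_of_isLastBelow (h : PartiallyGlued π Q σ) (hT : T.Has [0])
    {z : T.Node} (n : ℕ) : ∀ v : T.Edge, z.1.1.length = v.1.1.length + n → IsLastBelow v.1.1 z →
    (contour σ).SameCycle (Sum.inl (v, true)) (Sum.inl (first hT (π z))) := by
  induction n with
  | zero =>
    intro v hn hz
    have hzv : z = v.toNode := Node.ext (hz.1.eq_of_length (by omega)).symm
    refine h.sameCycle_plug hT ?_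
    rw [hzv]
    refine initialRotation_leaf fun h0 => ?_
    obtain ⟨w, hw⟩ := h0.exists_node
    have := hz.2 w (by rw [hw]; exact List.prefix_append _ _)
    rw [hw, hzv] at this
    exact absurd this (not_le.2 (List.lt_append_cons _ _ _))
  | succ n ih =>
    intro v hn hz
    obtain ⟨j, hj⟩ := List.exists_concat_prefix hz.1 fun h' => by
      rw [h'] at hn; omega
    obtain ⟨i, hi, hi'⟩ := (z.has.of_prefix hj).exists_last_child
    obtain ⟨w, hw⟩ := hi.exists_child
    have h1 := ih w (by rw [hw, List.length_append, List.length_singleton]; omega)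
      (by rw [hw]; exact hz.child hi hi')
    have h2 := sameCycle_apply_self (contour σ) (Sum.inl (v, true))
    rw [contour_inl, Bool.not_true, h.inl (initialRotation_down hw hi')] at h2
    exact h2.trans h1

/-- The contour from the first half-edge of `u` reaches the plug of the node before `u`. That node
is the parent for a left-most child, the last node below the left sibling for another child, and the
last node of the tree for the root. -/
theorem PartiallyGlued.sameCycle_first (h : PartiallyGlued π Q σ) (hT : T.Has [0]) (u : T.Node) :
    (contour σ).SameCycle (Sum.inl (first hT u)) (Sum.inl (first hT (π (T.prevNode u)))) := by
  rcases u.eq_root_or_edge with hu | ⟨v, rfl⟩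
  · obtain ⟨i, hi, hi'⟩ := Has.exists_last_child (l := []) hT
    obtain ⟨w, hw⟩ := hi.exists_child
    obtain ⟨z, hz⟩ := T.has_nil.exists_isLastBelow
    rw [prevNode_root hu fun w => hz.2 w List.nil_prefix, first_root hT hu hw hi']
    have hz' : IsLastBelow w.1.1 z := by rw [hw]; exact hz.child hi hi'
    refine h.sameCycle_of_isLastBelow hT (z.1.1.length - w.1.1.length) w ?_ hz'
    have := hz'.1.length_le
    omega
  · rw [first_toNode]
    obtain ⟨i, hi⟩ := v.exists_eq_concat
    cases i with
    | zero =>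
      rw [prevNode_of_leftmost (p := v.parent) hi]
      exact h.sameCycle_plug hT (initialRotation_up hi)
    | succ i =>
      obtain ⟨w, hw⟩ := Has.exists_child ((hi ▸ v.has : T.Has _).of_le (Nat.le_succ i))
      obtain ⟨z, hz⟩ := w.has.exists_isLastBelow
      have h1 := sameCycle_apply_self (contour σ) (Sum.inl (v, false))
      rw [contour_inl, Bool.not_false, h.inl (initialRotation_left hi hw)] at h1
      have hp : T.prevNode v.toNode = z := prevNode_of_sibling hi (by rw [← hw]; exact hz)
      rw [hp]
      refine h1.trans (h.sameCycle_of_isLastBelow hT (z.1.1.length - w.1.1.length) w ?_ hz)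
      have := hz.1.length_le
      omega

theorem PartiallyGlued.sameFace (h : PartiallyGlued π Q σ) (hT : T.Has [0]) {u v : T.Node}
    (hu : ¬ Q u) (hv : ¬ Q v) (huv : (π * T.prevNode).SameCycle u v) : T.SameFace σ u v := by
  have h1 : (contour σ).SameCycle (Sum.inl (first hT u)) (Sum.inl (first hT v)) :=
    sameCycle_induction (S := fun w => (contour σ).SameCycle (Sum.inl (first hT u))
      (Sum.inl (first hT w))) (fun w hw => hw.trans (h.sameCycle_first hT w)) huv SameCycle.rfl
  have h2 : ∀ w, ¬ Q w → (contour σ).SameCycle (Sum.inr w) (Sum.inl (first hT w)) := by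
    intro w hw
    have h3 : contour σ (Sum.inr w) = Sum.inl (first hT w) := by
      rw [← initialRotation_inr hT, ← h.plug_notMem hw]
      simp [contour]
    rw [← h3]
    exact sameCycle_apply_self _ _
  exact ((h2 u hu).trans h1).trans (h2 v hv).symm

end Faces

-- Vertices, edges and faces of a glued tree

section Glued

variable {π : Equiv.Perm T.Node} {ρ : Equiv.Perm T.HalfEdge}

theorem sameCycle_sumCongr_one {X Y : Type} [Finite X] [Finite Y] {f : Equiv.Perm X} {x y : X}
    (h : (Equiv.Perm.sumCongr f (1 : Equiv.Perm Y)).SameCycle (Sum.inl x) (Sum.inl y)) :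
    f.SameCycle x y := by
  refine sameCycle_induction (S := fun d => Sum.elim (f.SameCycle x) (fun _ => False) d) ?_ h
    SameCycle.rfl
  rintro (z | z) hz
  · exact SameCycle.trans hz (sameCycle_apply_self f z)
  · exact hz

/-- Nodes and half-edges are compared by `first` and a retraction `r`, which respect the orbits of
the two permutations. -/
theorem numFaces_of_isGlued (h : IsGlued π ρ) (hT : T.Has [0]) :
    numOrbits (ρ * T.flip) = numOrbits (π * T.prevNode) := by
  have hP := h.partiallyGlued
  have hmul : contour (Equiv.Perm.sumCongr ρ 1) =
      Equiv.Perm.sumCongr (ρ * T.flip) (1 : Equiv.Perm T.Node) := by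
    rw [contour, Equiv.Perm.sumCongr_mul, one_mul]
  have hdown : ∀ {x y}, (contour (Equiv.Perm.sumCongr ρ 1)).SameCycle (Sum.inl x) (Sum.inl y) →
      (ρ * T.flip).SameCycle x y := fun {x y} hxy => sameCycle_sumCongr_one (hmul ▸ hxy)
  have hfirst : ∀ u, (ρ * T.flip).SameCycle (first hT u) (first hT (π (T.prevNode u))) :=
    fun u => hdown (hP.sameCycle_first hT u)
  have hlast : ∀ v : T.Edge, ∃ z : T.Node, IsLastBelow v.1.1 z := fun v => v.has.exists_isLastBelow
  choose z hz using hlast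
  -- The contour from the upper half of an edge next meets the plug of the last node below it, and
  -- the contour from `first hT u` next meets that of `T.prevNode u`. This dictates the node that
  -- follows `z x.1`.
  let r : T.HalfEdge → T.Node := fun x => if x.2 then T.prevNode.symm (z x.1) else x.1.toNode
  have hrf : ∀ v, r (v, false) = v.toNode := fun v => rfl
  have hrt : ∀ v, r (v, true) = T.prevNode.symm (z v) := fun v => rfl
  have hr : ∀ u, r (first hT u) = u := by
    intro u
    rcases u.eq_root_or_edge with hu | ⟨v, rfl⟩
    · obtain ⟨i, hi, hi'⟩ := Has.exists_last_child (l := []) hT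
      obtain ⟨w, hw⟩ := hi.exists_child
      rw [first_root hT hu hw hi', hrt, Equiv.symm_apply_eq]
      obtain ⟨z', hz'⟩ := T.has_nil.exists_isLastBelow
      rw [prevNode_root hu fun w => hz'.2 w List.nil_prefix]
      exact (hz w).eq (by rw [hw]; exact hz'.child hi hi')
    · rw [first_toNode, hrf]
  refine numOrbits_eq_of_retract (first hT) r hfirst ?_ (fun y => by rw [hr]) ?_
  · rintro ⟨v, b⟩
    cases b with
    | false =>
      have hval : (ρ * T.flip) (v, false) = ρ (v, true) := by simp [flip]
      rw [hval, hrf]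
      obtain ⟨i, hi⟩ := v.exists_eq_concat
      cases i with
      | zero =>
        have h1 := h.inr (initialRotation_up hi)
        rw [initialRotation_inr hT] at h1
        rw [← Sum.inl_injective h1, hr]
        have h2 := sameCycle_apply_self (π * T.prevNode) v.toNode
        rwa [Equiv.Perm.mul_apply, prevNode_of_leftmost (p := v.parent) hi] at h2
      | succ i =>
        obtain ⟨w, hw⟩ := Has.exists_child ((hi ▸ v.has : T.Has _).of_le (Nat.le_succ i))
        rw [h.inl (initialRotation_left hi hw), hrt]
        have : T.prevNode v.toNode = z w := prevNode_of_sibling hi (by rw [← hw]; exact hz w)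
        rw [← this, Equiv.symm_apply_apply]
    | true =>
      have hval : (ρ * T.flip) (v, true) = ρ (v, false) := by simp [flip]
      rw [hval, hrt]
      by_cases h0 : T.Has (v.1.1 ++ [0])
      · obtain ⟨i, hi, hi'⟩ := h0.exists_last_child
        obtain ⟨w, hw⟩ := hi.exists_child
        rw [h.inl (initialRotation_down hw hi'), hrt]
        rw [((hz v).child hi hi').eq (by rw [← hw]; exact hz w)]
      · have h1 := h.inr (initialRotation_leaf h0)
        rw [initialRotation_inr hT] at h1
        rw [← Sum.inl_injective h1, hr]
        have h2 := sameCycle_apply_self (π * T.prevNode) (T.prevNode.symm (z v))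
        rw [Equiv.Perm.mul_apply, Equiv.apply_symm_apply] at h2
        rwa [(hz v).eq_of_leaf (u := v.toNode) h0] at h2 ⊢
  · rintro ⟨v, b⟩
    cases b with
    | false => rw [hrf, first_toNode]
    | true =>
      rw [hrt]
      have h1 := hfirst (T.prevNode.symm (z v))
      rw [Equiv.apply_symm_apply] at h1
      refine h1.trans (hdown (hP.sameCycle_of_isLastBelow hT
        ((z v).1.1.length - v.1.1.length) v ?_ (hz v))).symm
      have := (hz v).1.length_le
      omega

/-- No plug separates the half-edges of one node after the first, so `ρ` runs through them from
right to left. The induction is on the number of siblings to the right. -/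
theorem IsGlued.sameCycle_first_owner (h : IsGlued π ρ) (hT : T.Has [0]) (x : T.HalfEdge) :
    ρ.SameCycle (first hT (owner x)) x := by
  obtain ⟨v, b⟩ := x
  cases b with
  | false => rw [owner_false, first_toNode]
  | true =>
    rw [owner_true]
    obtain ⟨i, hi⟩ := v.exists_eq_concat
    obtain ⟨k, hk⟩ := T.exists_numChildren v.parent.1.1
    have key : ∀ n i (w : T.Edge), w.1.1 = v.parent.1.1 ++ [i] → k = i + 1 + n →
        ρ.SameCycle (first hT v.parent) (w, true) := by
      intro n
      induction n with
      | zero =>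
        intro i w hw hki
        have hi' : ¬ T.Has (v.parent.1.1 ++ [i + 1]) := by rw [hk]; omega
        rcases v.parent.eq_root_or_edge with hu | ⟨e, he⟩
        · rw [hu] at hw hi'
          rw [first_root hT hu hw hi']
        · rw [← he] at hw hi' ⊢
          rw [first_toNode, ← h.inl (initialRotation_down hw hi')]
          exact sameCycle_apply_self _ _
      | succ n ih =>
        intro i w hw hki
        obtain ⟨w', hw'⟩ := ((hk (i + 1)).2 (by omega)).exists_child
        refine (ih (i + 1) w' hw' (by omega)).trans ?_
        rw [← h.inl (initialRotation_left hw' hw)]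
        exact sameCycle_apply_self _ _
    have : i < k := (hk i).1 (by rw [← hi]; exact v.has)
    exact key (k - i - 1) i v hi (by omega)

theorem IsGlued.sameCycle_first (h : IsGlued π ρ) (hT : T.Has [0]) (u : T.Node) :
    ρ.SameCycle (first hT u) (first hT (π u)) := by
  obtain ⟨x, hx⟩ := exists_initialRotation_eq_plug hT u
  have h1 := owner_initialRotation (Sum.inl x : T.Dart)
  rw [hx] at h1
  have h2 := h.sameCycle_first_owner hT x
  rw [show owner x = u from h1.symm] at h2
  have h3 := h.inr hx
  rw [initialRotation_inr hT] at h3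
  rw [Sum.inl_injective h3]
  exact h2.trans (sameCycle_apply_self _ _)

theorem IsGlued.sameCycle_owner (h : IsGlued π ρ) (hT : T.Has [0]) (x : T.HalfEdge) :
    π.SameCycle (owner x) (owner (ρ x)) := by
  have h1 := owner_initialRotation (Sum.inl x : T.Dart)
  rcases hx : T.initialRotation (Sum.inl x) with y | u
  · rw [hx] at h1
    rw [h.inl hx]
    exact Eq.sameCycle h1.symm _
  · rw [hx] at h1
    have h3 := h.inr hx
    rw [initialRotation_inr hT] at h3
    rw [← Sum.inl_injective h3, owner_first, show owner x = u from h1.symm]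
    exact sameCycle_apply_self _ _

theorem IsGlued.sameCycle_iff (h : IsGlued π ρ) (hT : T.Has [0]) (x y : T.HalfEdge) :
    ρ.SameCycle x y ↔ π.SameCycle (owner x) (owner y) :=
  sameCycle_iff_of_retract (first hT) owner (h.sameCycle_first hT) (h.sameCycle_owner hT)
    (h.sameCycle_first_owner hT) x y

theorem IsGlued.numVertices (h : IsGlued π ρ) (hT : T.Has [0]) : numOrbits ρ = numOrbits π :=
  numOrbits_eq_of_retract (first hT) owner (h.sameCycle_first hT) (h.sameCycle_owner hT)
    (fun y => by rw [owner_first]) (h.sameCycle_first_owner hT)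

theorem flip_apply (v : T.Edge) (b : Bool) : T.flip (v, b) = (v, !b) := by simp [flip]

theorem numOrbits_flip : numOrbits T.flip = Nat.card T.Edge := by
  rw [← numOrbits_one]
  refine numOrbits_eq_of_retract (fun v => (v, false)) Prod.fst (fun y => SameCycle.rfl)
    (fun ⟨v, b⟩ => by rw [flip_apply]) (fun y => by simp) ?_
  rintro ⟨v, _ | _⟩
  · exact SameCycle.rfl
  · have := sameCycle_apply_self T.flip (v, false)
    rwa [flip_apply] at this

theorem card_node (T : PlaneTree ℕ) : Nat.card T.Node = T.nodes.length := by
  rw [← Nat.card_congr T.nodup_nodes.getEquiv, Nat.card_fin]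

theorem card_edge (T : PlaneTree ℕ) : Nat.card T.Edge + 1 = T.nodes.length := by
  rw [← Nat.card_congr (nodup_nonRootNodes (T := T)).getEquiv, Nat.card_fin]
  cases T with
  | node a cs =>
    have h : (node a cs).nonRootNodes = forestNodes 0 cs := by
      rw [nonRootNodes, nodes, List.filter_cons]
      simp only [ne_eq, not_true_eq_false, decide_false, Bool.false_eq_true, if_false]
      refine List.filter_eq_self.2 fun x hx => ?_
      obtain ⟨j, l, h, -⟩ := (pairwise_forestNodes cs 0).2 x hx
      simp [h]
    rw [h, nodes, List.length_cons]

/-- A glued tree is planar iff the gluing permutation is noncrossing. -/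
theorem IsGlued.euler_iff (h : IsGlued π ρ) (hT : T.Has [0]) :
    numOrbits ρ + numOrbits (ρ * T.flip) = numOrbits T.flip + 2 ↔ Noncrossing rank π := by
  obtain ⟨u, hu⟩ := T.has_nil.exists_node
  rw [← numOrbits_add_eq_iff_noncrossing isCyclicPred_prevNode (rank_root hu) π,
    h.numVertices hT, numFaces_of_isGlued h hT, numOrbits_flip, card_node, ← card_edge]

end Glued

end PlaneTree

/-! ## Gluing the plugs of a sticky tree -/

theorem List.formPerm_of_pairwise_lt {X : Type} [DecidableEq X] {rk : X → ℕ} {L : List X}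
    (hL : L.Pairwise (fun x y => rk x < rk y)) {x : X} (hx : x ∈ L) :
    (rk x < rk (L.formPerm x) ∧ ∀ z ∈ L, ¬ (rk x < rk z ∧ rk z < rk (L.formPerm x))) ∨
      (∀ z ∈ L, rk (L.formPerm x) ≤ rk z ∧ rk z ≤ rk x) := by
  have hnd : L.Nodup := hL.imp fun h h' => by rw [h'] at h; exact lt_irrefl _ h
  have hlt := List.pairwise_iff_getElem.1 hL
  have hle : ∀ i j (hi : i < L.length) (hj : j < L.length), i ≤ j → rk L[i] ≤ rk L[j] := by
    intro i j hi hj hij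
    rcases hij.lt_or_eq with h | h
    · exact (hlt i j hi hj h).le
    · subst h; exact le_rfl
  obtain ⟨i, hi, rfl⟩ := List.getElem_of_mem hx
  rw [List.formPerm_apply_getElem L hnd i hi]
  by_cases h : i + 1 < L.length
  · left
    simp only [Nat.mod_eq_of_lt h]
    refine ⟨hlt i (i + 1) hi h (Nat.lt_succ_self i), ?_⟩
    rintro z hz ⟨h1, h2⟩
    obtain ⟨j, hj, rfl⟩ := List.getElem_of_mem hz
    rcases Nat.lt_or_ge i j with h3 | h3
    · have := hle (i + 1) j h hj h3; omega
    · have := hle j i hj hi h3; omega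
  · right
    have h0 : (i + 1) % L.length = 0 := by rw [show i + 1 = L.length by omega, Nat.mod_self]
    simp only [h0]
    intro z hz
    obtain ⟨j, hj, rfl⟩ := List.getElem_of_mem hz
    exact ⟨hle 0 j _ hj (Nat.zero_le _), hle j i hj hi (by omega)⟩

theorem List.formPerm_map_apply {X Y : Type} [DecidableEq X] [DecidableEq Y] {f : X → Y}
    (hf : Function.Injective f) {L : List X} (hL : L.Nodup) {x : X} (hx : x ∈ L) :
    (L.map f).formPerm (f x) = f (L.formPerm x) := by
  obtain ⟨i, hi, rfl⟩ := List.getElem_of_mem hx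
  rw [List.formPerm_apply_getElem L hL i hi]
  have := List.formPerm_apply_getElem (L.map f) (hL.map hf) i (by simpa using hi)
  simpa using this

theorem exists_restrict_perm {X : Type} [Finite X] (π : Equiv.Perm X) (Q : X → Prop)
    (hQ : ∀ x, Q x → Q (π x)) :
    ∃ πQ : Equiv.Perm X, (∀ x, Q x → πQ x = π x) ∧ ∀ x, ¬ Q x → πQ x = x := by
  classical
  have h : ∀ x, Q (π x) ↔ Q x := fun x => ⟨fun hx => mem_of_apply_mem hQ hx, hQ x⟩
  refine ⟨Equiv.Perm.ofSubtype (π.subtypePerm h), fun x hx => ?_, fun x hx => ?_⟩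
  · rw [Equiv.Perm.ofSubtype_apply_of_mem _ hx]; rfl
  · exact Equiv.Perm.ofSubtype_apply_of_not_mem _ hx

namespace PlaneTree

variable {T : PlaneTree ℕ}

/-- Each plug to be removed is followed by a half-edge and not by another plug, so the removals do
not interfere: an arrow into a removed plug is forwarded to the half-edge behind it. -/
theorem foldl_removePlug (ps : List T.Node) (hps : ps.Nodup) : ∀ σ : Equiv.Perm T.Dart,
    (∀ p ∈ ps, ∃ y, σ (Sum.inr p) = Sum.inl y) →
    (∀ p ∈ ps, ps.foldl T.removePlug σ (Sum.inr p) = Sum.inr p) ∧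
    (∀ d, (∀ p ∈ ps, d ≠ Sum.inr p) → (∀ p ∈ ps, σ d ≠ Sum.inr p) →
      ps.foldl T.removePlug σ d = σ d) ∧
    (∀ d, (∀ p ∈ ps, d ≠ Sum.inr p) → ∀ p ∈ ps, σ d = Sum.inr p →
      ps.foldl T.removePlug σ d = σ (Sum.inr p)) := by
  induction ps with
  | nil => intro σ _; simp
  | cons p ps ih =>
    intro σ hσ
    rw [List.nodup_cons] at hps
    obtain ⟨y, hy⟩ := hσ p List.mem_cons_self
    have hne : ∀ q ∈ ps, q ≠ p := fun q hq h => hps.1 (h ▸ hq)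
    have v1 : T.removePlug σ p (Sum.inr p) = Sum.inr p := by simp [removePlug]
    have v2 : ∀ d, σ d = Sum.inr p → T.removePlug σ p d = Sum.inl y := by
      intro d hd; simp [removePlug, hd, hy]
    have v3 : ∀ d, d ≠ Sum.inr p → σ d ≠ Sum.inr p → T.removePlug σ p d = σ d := by
      intro d h1 h2
      refine Equiv.swap_apply_of_ne_of_ne h2 fun h3 => h1 (σ.injective h3)
    have hv : ∀ q ∈ ps, T.removePlug σ p (Sum.inr q) = σ (Sum.inr q) := by
      intro q hq
      obtain ⟨z, hz⟩ := hσ q (List.mem_cons_of_mem _ hq)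
      exact v3 _ (fun h => hne q hq (Sum.inr_injective h)) (by rw [hz]; simp)
    obtain ⟨i1, i2, i3⟩ := ih hps.2 (T.removePlug σ p) fun q hq => by
      rw [hv q hq]; exact hσ q (List.mem_cons_of_mem _ hq)
    simp only [List.foldl_cons]
    refine ⟨fun q hq => ?_, fun d h1 h2 => ?_, fun d h1 q hq hd => ?_⟩
    · rcases List.mem_cons.1 hq with rfl | hq
      · have h3 : ∀ r ∈ ps, (Sum.inr q : T.Dart) ≠ Sum.inr r := fun r hr h =>
          hne r hr (Sum.inr_injective h).symm
        rw [i2 _ h3 (by rw [v1]; exact h3), v1]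
      · exact i1 q hq
    · have h3 := v3 d (h1 p List.mem_cons_self) (h2 p List.mem_cons_self)
      rw [i2 d (fun r hr => h1 r (List.mem_cons_of_mem _ hr))
        (fun r hr => by rw [h3]; exact h2 r (List.mem_cons_of_mem _ hr)), h3]
    · have h1' : ∀ r ∈ ps, d ≠ Sum.inr r := fun r hr => h1 r (List.mem_cons_of_mem _ hr)
      rcases List.mem_cons.1 hq with rfl | hq
      · rw [i2 d h1' (by rw [v2 d hd]; simp), v2 d hd, hy]
      · have h3 := v3 d (h1 p List.mem_cons_self)
          (by rw [hd]; exact fun h => hne q hq (Sum.inr_injective h))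
        rw [i3 d h1' q hq (by rw [h3, hd]), hv q hq]

theorem pairwise_glueClass (u : T.Node) :
    (T.glueClass u).Pairwise (fun v w => rank v < rank w) := by
  simp only [rank_lt_iff]
  refine List.Pairwise.filter _ ?_
  have h := T.pairwise_nodes
  rw [← List.attach_map_subtype_val T.nodes, List.pairwise_map] at h
  exact h

theorem nodup_glueClass (u : T.Node) : (T.glueClass u).Nodup :=
  (pairwise_glueClass u).imp fun h h' => by rw [h'] at h; exact lt_irrefl _ h

theorem mem_glueClass {u v : T.Node} : v ∈ T.glueClass u ↔ u.1.1 <+: v.1.1 ∧ v.1.2 = u.1.2 := by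
  simp [glueClass]

theorem mem_gluingOrder {u : T.Node} : u ∈ T.gluingOrder ↔ u.1.2 = u.1.1.length := by
  simp only [gluingOrder, List.mem_flatMap, List.mem_range, List.mem_filter, List.mem_attach,
    true_and, decide_eq_true_eq]
  constructor
  · rintro ⟨d, -, h1, h2⟩; omega
  · intro h
    exact ⟨u.1.1.length, T.length_lt_length_nodes _ u.2, rfl, h⟩

theorem nodup_gluingOrder : T.gluingOrder.Nodup := by
  rw [gluingOrder, List.nodup_flatMap]
  refine ⟨fun d _ => (List.nodup_attach.2 T.nodup_nodes).filter _, ?_⟩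
  refine List.nodup_range.imp fun {a b} hab => ?_
  rw [Function.onFun, List.disjoint_left]
  intro u h1 h2
  simp only [List.mem_filter, decide_eq_true_eq] at h1 h2
  omega

/-- Condition (1) provides an ancestor `u` of `v` at depth `ℓ(v)`. If `u` precedes `v`, condition
(3) applied to `u` itself shows that its label is at least its depth, and condition (1) gives
equality. -/
theorem IsSticky.exists_rep (hS : T.IsSticky) (v : T.Node) :
    ∃ u : T.Node, u.1.1 <+: v.1.1 ∧ u.1.1.length = v.1.2 ∧ u.1.2 = v.1.2 := by
  have h1 := hS.label_le_depth _ v.2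
  have hp : v.1.1.take v.1.2 <+: v.1.1 := List.take_prefix _ _
  obtain ⟨u, hu⟩ := (v.has.of_prefix hp).exists_node
  have hl : u.1.1.length = v.1.2 := by rw [hu, List.length_take]; omega
  rw [← hu] at hp
  refine ⟨u, hp, hl, ?_⟩
  rcases hp.lex_le.lt_or_eq with h | h
  · have h2 := hS.depth_le_of_before _ u.2 _ v.2 hp hl.symm _ u.2 List.prefix_rfl h
    have h3 := hS.label_le_depth _ u.2
    omega
  · rw [Node.ext h]

/-- The ancestor of a node whose depth is the label of the node. -/
noncomputable def IsSticky.rep (hS : T.IsSticky) (v : T.Node) : T.Node := (hS.exists_rep v).choose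

variable (hS : T.IsSticky)

theorem IsSticky.rep_prefix (v : T.Node) : (hS.rep v).1.1 <+: v.1.1 :=
  (hS.exists_rep v).choose_spec.1

theorem IsSticky.rep_length (v : T.Node) : (hS.rep v).1.1.length = v.1.2 :=
  (hS.exists_rep v).choose_spec.2.1

theorem IsSticky.rep_label (v : T.Node) : (hS.rep v).1.2 = v.1.2 :=
  (hS.exists_rep v).choose_spec.2.2

theorem IsSticky.rep_eq {u v : T.Node} (h1 : u.1.1 <+: v.1.1) (h2 : u.1.1.length = v.1.2) :
    hS.rep v = u :=
  Node.ext ((List.prefix_of_prefix_length_le (hS.rep_prefix v) h1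
    (by rw [hS.rep_length, h2])).eq_of_length (by rw [hS.rep_length, h2]))

theorem IsSticky.mem_glueClass_iff {u v : T.Node} (hu : u.1.2 = u.1.1.length) :
    v ∈ T.glueClass u ↔ hS.rep v = u := by
  rw [mem_glueClass]
  constructor
  · rintro ⟨h1, h2⟩
    exact hS.rep_eq h1 (by omega)
  · rintro rfl
    exact ⟨hS.rep_prefix v, (hS.rep_label v).symm⟩

theorem IsSticky.rep_nonderived (v : T.Node) : (hS.rep v).1.2 = (hS.rep v).1.1.length := by
  rw [hS.rep_label, hS.rep_length]

theorem IsSticky.mem_glueClass_rep (v : T.Node) : v ∈ T.glueClass (hS.rep v) :=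
  (hS.mem_glueClass_iff (hS.rep_nonderived v)).2 rfl

theorem IsSticky.rep_formPerm (v : T.Node) :
    hS.rep ((T.glueClass (hS.rep v)).formPerm v) = hS.rep v :=
  (hS.mem_glueClass_iff (hS.rep_nonderived v)).1
    (List.formPerm_apply_mem_of_mem (hS.mem_glueClass_rep v))

/-- The next node in prefix order in the same class, cyclically. -/
noncomputable def IsSticky.perm : Equiv.Perm T.Node :=
  Equiv.ofBijective (fun v => (T.glueClass (hS.rep v)).formPerm v) <|
    Finite.injective_iff_bijective.1 fun v w h => by
      have h1 : hS.rep v = hS.rep w := by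
        rw [← hS.rep_formPerm v, ← hS.rep_formPerm w]; exact congrArg _ h
      simp only [h1] at h
      exact (T.glueClass (hS.rep w)).formPerm.injective h

theorem IsSticky.perm_apply (v : T.Node) : hS.perm v = (T.glueClass (hS.rep v)).formPerm v := rfl

theorem IsSticky.rep_perm (v : T.Node) : hS.rep (hS.perm v) = hS.rep v := hS.rep_formPerm v

theorem IsSticky.perm_cases (x : T.Node) :
    (rank x < rank (hS.perm x) ∧ ∀ z, hS.rep z = hS.rep x →
      ¬ (rank x < rank z ∧ rank z < rank (hS.perm x))) ∨
    (∀ z, hS.rep z = hS.rep x → rank (hS.perm x) ≤ rank z ∧ rank z ≤ rank x) := by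
  have h := List.formPerm_of_pairwise_lt (pairwise_glueClass (hS.rep x)) (hS.mem_glueClass_rep x)
  simp only [hS.mem_glueClass_iff (hS.rep_nonderived x)] at h
  exact h

/-- The classes of a sticky tree do not cross. -/
theorem IsSticky.rep_eq_of_crossing {a b c d : T.Node} (hab : rank a < rank b)
    (hbc : rank b < rank c) (hcd : rank c < rank d) (hac : hS.rep a = hS.rep c)
    (hbd : hS.rep b = hS.rep d) : hS.rep a = hS.rep b := by
  rw [rank_lt_iff] at hab hbc hcd
  set A := hS.rep c with hA
  set B := hS.rep d with hB
  have hAa : A.1.1 <+: a.1.1 := hac ▸ hS.rep_prefix a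
  have hAc : A.1.1 <+: c.1.1 := hS.rep_prefix c
  have hBb : B.1.1 <+: b.1.1 := hbd ▸ hS.rep_prefix b
  have hBd : B.1.1 <+: d.1.1 := hS.rep_prefix d
  have hBc : B.1.1 <+: c.1.1 := List.prefix_of_between (hBb.lex_le.trans hbc.le) hcd.le hBd
  have hAb : A.1.1 <+: b.1.1 := List.prefix_of_between (hAa.lex_le.trans hab.le) hbc.le hAc
  -- Condition (3) is used twice: at `B`, since `c` precedes `d`, and at `A`, since `b` precedes
  -- `c`. The labels of `c` and `b` are the depths of `A` and `B`, so these two ancestors of `c`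
  -- have equal depth.
  have h1 := hS.depth_le_of_before _ B.2 _ d.2 hBd (hS.rep_length d).symm _ c.2 hBc hcd
  have h2 := hS.depth_le_of_before _ A.2 _ c.2 hAc (hS.rep_length c).symm _ b.2 hAb hbc
  have h3 := hS.rep_length c
  have h4 := hS.rep_length b
  rw [← hA] at h3
  rw [hbd] at h4
  rw [hac, hbd]
  exact Node.ext ((List.prefix_of_prefix_length_le hAc hBc (by omega)).eq_of_length (by omega))

/-- Inside a class the image is the cyclically next member, so no member is skipped. For two
classes, a violation of either clause exhibits four nodes that alternate between them, which
`rep_eq_of_crossing` excludes. -/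
theorem IsSticky.noncrossing_perm : Noncrossing rank hS.perm := by
  intro x z
  have hz := hS.rep_perm z
  have hx := hS.rep_perm x
  have hne : ∀ {u v : T.Node}, hS.rep u ≠ hS.rep v → rank u ≠ rank v :=
    fun h h' => h (by rw [rank_injective h'])
  by_cases hzx : hS.rep z = hS.rep x
  · rcases hS.perm_cases x with ⟨h1, h2⟩ | h1
    · have := h2 z hzx
      exact ⟨fun h3 h4 => absurd ⟨h3, h4⟩ this, fun h3 h4 => by omega⟩
    · have := h1 z hzx
      have := h1 _ (hz.trans hzx)
      exact ⟨fun h3 h4 => by omega, fun h3 h4 => by omega⟩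
  · have n1 := hne hzx
    have n2 : rank (hS.perm z) ≠ rank x := hne (by rw [hz]; exact hzx)
    have n3 : rank (hS.perm z) ≠ rank (hS.perm x) := hne (by rw [hz, hx]; exact hzx)
    have n4 : rank z ≠ rank (hS.perm x) := hne (by rw [hx]; exact hzx)
    refine ⟨fun h3 h4 => ?_, fun h3 h4 => ?_⟩
    · constructor
      · by_contra h5
        exact hzx (hz.symm.trans
          (hS.rep_eq_of_crossing (a := hS.perm z) (b := x) (c := z) (d := hS.perm x)
          (by omega) (by omega) (by omega) hz hx.symm))
      · by_contra h5
        exact hzx (hS.rep_eq_of_crossing (a := x) (b := z) (c := hS.perm x) (d := hS.perm z)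
          (by omega) (by omega) (by omega) hx.symm hz.symm).symm
    · constructor
      · by_contra h5
        exact hzx (hz.symm.trans ((hS.rep_eq_of_crossing (a := hS.perm z) (b := hS.perm x) (c := z)
          (d := x) (by omega) (by omega) (by omega) hz hx).trans hx))
      · by_contra h5
        exact hzx ((hS.rep_eq_of_crossing (a := hS.perm x) (b := z) (c := x) (d := hS.perm z)
          (by omega) (by omega) (by omega) hx hz.symm).symm.trans hx)

/-- The last node of the cycle is sent to the smallest node of the class. This is the
representative, because an ancestor precedes its descendants. -/
theorem IsSticky.sameCycle_rep (x : T.Node) : hS.perm.SameCycle x (hS.rep x) := by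
  obtain ⟨y, hy, hmax⟩ := hS.noncrossing_perm.exists_last x
  have hrep : ∀ {a b}, hS.perm.SameCycle a b → hS.rep a = hS.rep b := fun {a b} h =>
    sameCycle_induction (S := fun z => hS.rep a = hS.rep z)
      (fun z hz => hz.trans (hS.rep_perm z).symm) h rfl
  have h1 := (hmax y hy).1
  have h2 : hS.perm y = hS.rep x := by
    rcases hS.perm_cases y with h3 | h3
    · have := (hmax _ (hy.trans (sameCycle_apply_self _ _))).2; omega
    · have h4 : hS.rep (hS.rep x) = hS.rep y := by
        rw [← hrep hy]
        exact hS.rep_eq List.prefix_rfl (hS.rep_nonderived x).symm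
      have h5 := (h3 _ h4).1
      have h6 : (hS.rep x).1.1 <+: (hS.perm y).1.1 := by
        have := hS.rep_prefix (hS.perm y)
        rwa [hS.rep_perm, ← hrep hy] at this
      exact rank_injective (le_antisymm h5 (rank_le_iff.2 h6.lex_le))
  rw [← h2]
  exact hy.trans (sameCycle_apply_self _ _)

theorem IsSticky.sameCycle_perm_iff (x y : T.Node) :
    hS.perm.SameCycle x y ↔ hS.rep x = hS.rep y := by
  constructor
  · intro h
    exact sameCycle_induction (S := fun z => hS.rep x = hS.rep z)
      (fun z hz => hz.trans (hS.rep_perm z).symm) h rfl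
  · intro h
    have := hS.sameCycle_rep y
    rw [← h] at this
    exact (hS.sameCycle_rep x).trans this.symm

/-- The next node of the class is on the right, or it is the first visited one. -/
theorem IsSticky.perm_prefix_or_lt (x : T.Node) :
    (hS.perm x).1.1 <+: x.1.1 ∨ x.1.1 < (hS.perm x).1.1 := by
  rcases hS.perm_cases x with h | h
  · exact Or.inr (rank_lt_iff.1 h.1)
  · left
    have h4 : hS.rep (hS.rep x) = hS.rep x :=
      hS.rep_eq List.prefix_rfl (hS.rep_nonderived x).symm
    have h5 := (h _ h4).1
    have h6 : (hS.rep x).1.1 <+: (hS.perm x).1.1 := by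
      have := hS.rep_prefix (hS.perm x)
      rwa [hS.rep_perm] at this
    have : hS.perm x = hS.rep x := rank_injective (le_antisymm h5 (rank_le_iff.2 h6.lex_le))
    rw [this]
    exact hS.rep_prefix x

/-- `σ` is the rotation after gluing the classes in `Q`. -/
def IsSticky.GluedOn (Q : T.Node → Prop) (σ : Equiv.Perm T.Dart) : Prop :=
  (∀ x, Q x → Q (hS.perm x)) ∧ ∃ πQ : Equiv.Perm T.Node, (∀ x, Q x → πQ x = hS.perm x) ∧
    (∀ x, ¬ Q x → πQ x = x) ∧ PartiallyGlued πQ Q σ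

theorem IsSticky.gluedOn_initial :
    hS.GluedOn (fun _ => False) T.initialRotation := by
  refine ⟨fun _ h => h, 1, fun _ h => h.elim, fun _ _ => rfl, ?_⟩
  exact ⟨fun _ => rfl, fun h => h.elim, fun _ => rfl, fun h => h, fun _ h => h.elim, fun h _ => h⟩

/-- The test on faces succeeds because the cycles already glued do not separate the members of this
one. The `formPerm` of the plugs redirects the arrow into a plug to the next plug of the class, and
the removal of plugs forwards it to the half-edge behind that plug, as `hS.perm` prescribes. -/
theorem IsSticky.gluedOn_glue (hT : T.Has [0]) {Q : T.Node → Prop} {σ : Equiv.Perm T.Dart}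
    (h : hS.GluedOn Q σ) {u : T.Node} (hu : u.1.2 = u.1.1.length)
    (hd : ∀ v, hS.rep v = u → ¬ Q v) :
    ∃ σ', T.glue σ u = some σ' ∧ hS.GluedOn (fun v => Q v ∨ hS.rep v = u) σ' := by
  obtain ⟨hinv, πQ, hQ, hnQ, hG⟩ := h
  have hmem : ∀ {v}, v ∈ T.glueClass u ↔ hS.rep v = u := hS.mem_glueClass_iff hu
  have hface : ∀ p ∈ T.glueClass u, ∀ q ∈ T.glueClass u, T.SameFace σ p q := by
    intro p hp q hq
    rw [hmem] at hp hq
    refine hG.sameFace hT (hd p hp) (hd q hq) ?_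
    exact hS.noncrossing_perm.sameCycle_of_partial isCyclicPred_prevNode hQ hnQ hinv (hd p hp)
      (hd q hq) ((hS.sameCycle_perm_iff p q).2 (hp.trans hq.symm))
  refine ⟨_, if_pos hface, ?_⟩
  have hinv' : ∀ x, Q x ∨ hS.rep x = u → Q (hS.perm x) ∨ hS.rep (hS.perm x) = u := by
    rintro x (hx | hx)
    · exact Or.inl (hinv x hx)
    · exact Or.inr (by rw [hS.rep_perm, hx])
  obtain ⟨π', h1, h2⟩ := exists_restrict_perm hS.perm (fun v => Q v ∨ hS.rep v = u) hinv'
  refine ⟨hinv', π', h1, h2, ?_⟩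
  set ps := T.glueClass u with hps
  set σ₁ := (ps.map Sum.inr).formPerm * σ with hσ₁
  have e1 : ∀ d, (∀ p ∈ ps, σ d ≠ Sum.inr p) → σ₁ d = σ d := by
    intro d hd
    refine List.formPerm_apply_of_notMem fun hm => ?_
    obtain ⟨p, hp, hpd⟩ := List.mem_map.1 hm
    exact hd p hp hpd.symm
  have e2 : ∀ d, ∀ p ∈ ps, σ d = Sum.inr p → σ₁ d = Sum.inr (hS.perm p) := by
    intro d p hp hdp
    rw [hσ₁, Equiv.Perm.mul_apply, hdp,
      List.formPerm_map_apply Sum.inr_injective (nodup_glueClass u) hp, hS.perm_apply, hmem.1 hp]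
  have hplug : ∀ p ∈ ps, σ₁ (Sum.inr p) = Sum.inl (first hT p) := by
    intro p hp
    have h3 : σ (Sum.inr p) = Sum.inl (first hT p) := by
      rw [hG.plug_notMem (hd p (hmem.1 hp)), initialRotation_inr hT]
    rw [e1 _ (by rw [h3]; simp), h3]
  obtain ⟨r1, r2, r3⟩ := foldl_removePlug ps (nodup_glueClass u) σ₁ fun p hp => ⟨_, hplug p hp⟩
  have hR : T.mergePlugs σ ps = ps.foldl T.removePlug σ₁ := rfl
  rw [hR]
  set R := ps.foldl T.removePlug σ₁
  have r4 : ∀ d, (∀ p ∈ ps, d ≠ Sum.inr p) → (∀ p ∈ ps, σ d ≠ Sum.inr p) → R d = σ d := by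
    intro d h3 h4
    rw [r2 d h3 (by rw [e1 d h4]; exact h4), e1 d h4]
  refine ⟨fun h => h2 _ h, ?_, ?_, ?_, ?_, ?_⟩
  · rintro v (hv | hv)
    · have h3 : ∀ p ∈ ps, (Sum.inr v : T.Dart) ≠ Sum.inr p := by
        intro p hp h
        rw [Sum.inr_injective h] at hv
        exact hd p (hmem.1 hp) hv
      have h4 := hG.plug_mem hv
      rw [r4 _ h3 (by rw [h4]; exact h3), h4]
    · exact r1 v (hmem.2 hv)
  · intro v hv
    push Not at hv
    have h4 := hG.plug_notMem hv.1
    rw [r4 _ (fun p hp h => hv.2 (by rw [Sum.inr_injective h]; exact hmem.1 hp))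
      (by rw [h4, initialRotation_inr hT]; simp), h4]
  · intro x y hxy
    have h4 := hG.inl hxy
    rw [r4 _ (by simp) (by rw [h4]; simp), h4]
  · rintro x v hxv (hv | hv)
    · have h4 := hG.inr_mem hxv hv
      rw [r4 _ (by simp) (by rw [h4, initialRotation_inr hT]; simp), h4, hQ v hv, h1 v (Or.inl hv)]
    · have h4 := hG.inr_notMem hxv (hd v hv)
      have h5 : hS.perm v ∈ ps := hmem.2 (by rw [hS.rep_perm, hv])
      rw [r3 _ (by simp) _ h5 (e2 _ v (hmem.2 hv) h4), hplug _ h5, h1 v (Or.inr hv),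
        initialRotation_inr hT]
  · intro x v hxv hv
    push Not at hv
    have h4 := hG.inr_notMem hxv hv.1
    rw [r4 _ (by simp) (by
      rw [h4]; exact fun p hp h => hv.2 (by rw [Sum.inr_injective h]; exact hmem.1 hp)), h4]

/-- Increasing depth plays no role in the success of the gluings: any list of representatives
without repetition works. -/
theorem IsSticky.gluedOn_foldlM (hT : T.Has [0]) (L : List T.Node) (hL : L.Nodup)
    (hlab : ∀ u ∈ L, u.1.2 = u.1.1.length) : ∀ (Q : T.Node → Prop) (σ : Equiv.Perm T.Dart),
    hS.GluedOn Q σ → (∀ v, hS.rep v ∈ L → ¬ Q v) →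
    ∃ σ', L.foldlM T.glue σ = some σ' ∧ hS.GluedOn (fun v => Q v ∨ hS.rep v ∈ L) σ' := by
  induction L with
  | nil =>
    intro Q σ h _
    exact ⟨σ, rfl, by simpa using h⟩
  | cons u L ih =>
    intro Q σ h hd
    rw [List.nodup_cons] at hL
    obtain ⟨σ₁, h1, h2⟩ := hS.gluedOn_glue hT h (hlab u List.mem_cons_self)
      (fun v hv => hd v (by rw [hv]; exact List.mem_cons_self))
    obtain ⟨σ₂, h3, h4⟩ := ih hL.2 (fun w hw => hlab w (List.mem_cons_of_mem _ hw)) _ σ₁ h2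
      (fun v hv => by
        rintro (h5 | h5)
        · exact hd v (List.mem_cons_of_mem _ hv) h5
        · rw [h5] at hv; exact hL.1 hv)
    refine ⟨σ₂, ?_, ?_⟩
    · rw [List.foldlM_cons, h1]; exact h3
    · simpa only [List.mem_cons, or_assoc] using h4

theorem IsSticky.exists_finalRotation (hT : T.Has [0]) :
    ∃ σ, T.finalRotation = some σ ∧ PartiallyGlued hS.perm (fun _ => True) σ := by
  obtain ⟨σ, h1, -, πQ, h2, -, h4⟩ := hS.gluedOn_foldlM hT T.gluingOrder nodup_gluingOrder
    (fun u hu => mem_gluingOrder.1 hu) _ _ hS.gluedOn_initial (fun _ _ h => h)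
  have hall : ∀ v, hS.rep v ∈ T.gluingOrder := fun v => mem_gluingOrder.2 (hS.rep_nonderived v)
  have hπ : πQ = hS.perm := Equiv.ext fun x => h2 x (Or.inr (hall x))
  subst hπ
  have hQ : (fun v => False ∨ hS.rep v ∈ T.gluingOrder) = fun _ => True := by
    funext v; simp [hall v]
  rw [hQ] at h4
  exact ⟨σ, h1, h4⟩

theorem exists_getLast?_childEdges (hT : T.Has [0]) :
    ∃ v : T.Edge, ∃ i, (T.childEdges []).getLast? = some v ∧ v.1.1 = [i] ∧ ¬ T.Has [i + 1] := by
  obtain ⟨k, hk⟩ := T.exists_numChildren []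
  have h := childEdges_addr [] hk
  have hk0 : 0 < k := (hk 0).1 hT
  obtain ⟨k, rfl⟩ : ∃ k', k = k' + 1 := ⟨k - 1, by omega⟩
  have h1 := congrArg List.getLast? h
  rw [List.range_succ, List.map_append, List.map_singleton, List.getLast?_concat,
    List.getLast?_map, Option.map_eq_some_iff] at h1
  obtain ⟨v, hv, hvk⟩ := h1
  exact ⟨v, k, hv, hvk, (hk (k + 1)).not.2 (by omega)⟩

/-- The map obtained from a sticky tree. -/
theorem IsSticky.treeToMap_eq (hT : T.Has [0]) :
    ∃ (ρ : Equiv.Perm T.HalfEdge) (v : T.Edge) (i : ℕ), IsGlued hS.perm ρ ∧ v.1.1 = [i] ∧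
      ¬ T.Has [i + 1] ∧ treeToMap T = some ⟦T.toRotationSystem ρ (v, true)⟧ := by
  obtain ⟨σ, hσ, hG⟩ := hS.exists_finalRotation hT
  obtain ⟨v, i, hv, hvi, hi⟩ := exists_getLast?_childEdges hT
  have hval : ∀ x, ∃ y, σ (Sum.inl x) = Sum.inl y := by
    intro x
    rcases hx : T.initialRotation (Sum.inl x) with y | u
    · exact ⟨y, hG.inl hx⟩
    · exact ⟨_, (hG.inr_mem hx trivial).trans (initialRotation_inr hT _)⟩
  have hleft : ∀ x : T.HalfEdge, (σ (Sum.inl x)).isLeft := by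
    intro x
    obtain ⟨y, hy⟩ := hval x
    rw [hy]; rfl
  have hres : ∀ x, Sum.inl (T.restrictRotation σ hleft x) = σ (Sum.inl x) := fun x =>
    Sum.inl_getLeft _ (hleft x)
  refine ⟨T.restrictRotation σ hleft, v, i, ⟨fun {x y} hx => ?_, fun {x u} hx => ?_⟩, hvi, hi, ?_⟩
  · exact Sum.inl_injective ((hres x).trans (hG.inl hx))
  · rw [hres, hG.inr_mem hx trivial]
  · rw [treeToMap, hσ, Option.bind_some, hv, Option.bind_some, dif_pos hleft]

end PlaneTree

/-! ## The exploration as a relation -/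

namespace PlaneTree

variable {α β : Type}

/-- Induction for the nested inductive type in one predicate on forests: the head splits into its
root and its children. -/
theorem forest_induction {P : List (PlaneTree α) → Prop} (nil : P [])
    (cons : ∀ a cs ts, P cs → P ts → P (node a cs :: ts)) : ∀ ts, P ts
  | [] => nil
  | node a cs :: ts => cons a cs ts (forest_induction nil cons cs) (forest_induction nil cons ts)

theorem mapForest_append (f : α → β) (ts ss : List (PlaneTree α)) :
    mapForest f (ts ++ ss) = mapForest f ts ++ mapForest f ss := by
  induction ts with
  | nil => simp [mapForest]
  | cons t ts ih => simp [mapForest, ih]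

theorem mirrorForest_append (ts ss : List (PlaneTree α)) :
    mirrorForest (ts ++ ss) = mirrorForest ss ++ mirrorForest ts := by
  induction ts with
  | nil => simp [mirrorForest]
  | cons t ts ih => simp [mirrorForest, ih]

theorem length_mirrorForest (ts : List (PlaneTree α)) : (mirrorForest ts).length = ts.length := by
  induction ts with
  | nil => simp [mirrorForest]
  | cons t ts ih => simp [mirrorForest, ih]

theorem mirrorForest_mirrorForest (ts : List (PlaneTree α)) :
    mirrorForest (mirrorForest ts) = ts := by
  induction ts using forest_induction with
  | nil => simp [mirrorForest]
  | cons a cs ts h1 h2 =>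
    simp only [mirrorForest, mirrorForest_append, mirror, h1, h2]
    rfl

theorem mirror_mirror (T : PlaneTree α) : T.mirror.mirror = T := by
  cases T with
  | node a cs => simp only [mirror, mirrorForest_mirrorForest]

theorem mapForest_mirrorForest (f : α → β) (ts : List (PlaneTree α)) :
    mapForest f (mirrorForest ts) = mirrorForest (mapForest f ts) := by
  induction ts using forest_induction with
  | nil => simp [mirrorForest, mapForest]
  | cons a cs ts h1 h2 =>
    simp only [mirrorForest, mapForest_append, mapForest, mirror, map, h1, h2]

theorem map_mirror (f : α → β) (T : PlaneTree α) : T.mirror.map f = (T.map f).mirror := by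
  cases T with
  | node a cs => simp only [mirror, map, mapForest_mirrorForest]

theorem forestNodes_append (i : ℕ) (ts ss : List (PlaneTree α)) :
    forestNodes i (ts ++ ss) = forestNodes i ts ++ forestNodes (i + ts.length) ss := by
  induction ts generalizing i with
  | nil => simp [forestNodes]
  | cons t ts ih =>
    simp only [List.cons_append, forestNodes, ih, List.append_assoc, List.length_cons]
    congr 3
    omega

/-- The node `x` of the mirrored forest is at the address `l`. -/
def ForestAt (F : List (PlaneTree α)) (l : List ℕ) (x : α) : Prop :=
  (l, x) ∈ forestNodes 0 (mirrorForest F)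

theorem not_forestAt_nil {l : List ℕ} {x : α} : ¬ ForestAt [] l x := by
  simp [ForestAt, mirrorForest, forestNodes]

/-- The head of the list is explored first and becomes the right-most tree after mirroring, so its
index is the number of the remaining trees. -/
theorem forestAt_cons {b : α} {cs ts : List (PlaneTree α)} {l : List ℕ} {x : α} :
    ForestAt (node b cs :: ts) l x ↔ ForestAt ts l x ∨ (l = [ts.length] ∧ x = b) ∨
      ∃ m, l = ts.length :: m ∧ ForestAt cs m x := by
  simp only [ForestAt, mirrorForest, forestNodes_append, forestNodes, mirror, nodes,
    List.mem_append, length_mirrorForest, List.append_nil, List.map_cons, List.mem_cons,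
    List.mem_map, Prod.mk.injEq, zero_add, Prod.exists]
  refine or_congr Iff.rfl (or_congr Iff.rfl ⟨?_, ?_⟩)
  · rintro ⟨m, y, h, h1, rfl⟩; exact ⟨m, h1.symm, h⟩
  · rintro ⟨m, h1, h⟩; exact ⟨m, x, h, h1.symm, rfl⟩

theorem ForestAt.exists_cons {F : List (PlaneTree α)} {l : List ℕ} {x : α} (h : ForestAt F l x) :
    ∃ i m, l = i :: m ∧ i < F.length := by
  obtain ⟨j, t, m, h1, -, h3⟩ := mem_forestNodes.1 h
  refine ⟨j, m, by simpa using h3, ?_⟩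
  rw [← length_mirrorForest]
  exact (List.getElem?_eq_some_iff.1 h1).1

theorem exists_forestAt_singleton {F : List (PlaneTree α)} {j : ℕ} (hj : j < F.length) :
    ∃ c, ForestAt F [j] c := by
  have hlen : j < (mirrorForest F).length := by rwa [length_mirrorForest]
  obtain ⟨⟨c, ds⟩, ht⟩ : ∃ t, (mirrorForest F)[j]? = some t := ⟨_, List.getElem?_eq_getElem hlen⟩
  exact ⟨c, mem_forestNodes.2 ⟨j, _, [], ht, mem_nodes_nil.2 rfl, by simp⟩⟩

end PlaneTree

open PlaneTree

/-- The loop of the exploration leads from the set `V` of visited half-edges and the half-edge `h`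
to the set `V'` and the half-edge `e`, exploring the trees of `F`. -/
inductive Explores {D : Type} [DecidableEq D] (σ τ : Equiv.Perm D) :
    Finset D → D → List (PlaneTree D) → Finset D → D → Prop
  | nil (V : Finset D) (h : D) : Explores σ τ V h [] V h
  | cons {V V₁ V₂ : Finset D} {h e₁ e₂ : D} {cs ts : List (PlaneTree D)} (hV : h ∉ V)
      (below : Explores σ τ (insert h (insert (τ h) V)) (σ (τ h)) cs V₁ e₁) (he : e₁ ∈ V₁)
      (next : Explores σ τ V₁ (σ h) ts V₂ e₂) : Explores σ τ V h (node (τ h) cs :: ts) V₂ e₂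

section Explores

variable {D : Type} [DecidableEq D] {σ τ : Equiv.Perm D}

theorem Explores.append {V V₁ V₂ : Finset D} {h h₁ h₂ : D} {F G : List (PlaneTree D)}
    (h1 : Explores σ τ V h F V₁ h₁) (h2 : Explores σ τ V₁ h₁ G V₂ h₂) :
    Explores σ τ V h (F ++ G) V₂ h₂ := by
  induction h1 with
  | nil V h => exact h2
  | cons hV below he next _ ih => exact Explores.cons hV below he (ih h2)

/-- `Explores` also describes unfinished outer loops, which is what lets runs be concatenated. A run
is complete once it arrives at a visited half-edge. -/
theorem Explores.explore_eq [Fintype D] {V V' : Finset D} {h e : D} {F : List (PlaneTree D)}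
    (hE : Explores σ τ V h F V' e) (he : e ∈ V') : explore σ τ V h = (F, V') := by
  induction hE with
  | nil V h => exact explore_of_mem σ τ he
  | cons hV below he₁ next ih1 ih2 => rw [explore_of_notMem σ τ hV, ih1 he₁, ih2 he]

theorem exists_explores [Fintype D] (n : ℕ) : ∀ (V : Finset D) (h : D), Vᶜ.card ≤ n →
    ∃ e ∈ (explore σ τ V h).2,
      Explores σ τ V h (explore σ τ V h).1 (explore σ τ V h).2 e := by
  induction n using Nat.strong_induction_on with
  | _ n ih =>
    intro V h hn
    by_cases hV : h ∈ V
    · rw [explore_of_mem σ τ hV]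
      exact ⟨h, hV, Explores.nil V h⟩
    · have key : ∀ W : Finset D, V ⊆ W → h ∈ W → Wᶜ.card < n := by
        intro W hW hh
        refine lt_of_lt_of_le (Finset.card_lt_card
          (Finset.ssubset_iff_of_subset ?_ |>.2 ⟨h, ?_, ?_⟩)) hn
        · exact Finset.compl_subset_compl.2 hW
        · simpa using hV
        · simpa using hh
      have hsub := subset_explore σ τ (insert h (insert (τ h) V)) (σ (τ h))
      obtain ⟨e₁, he₁, h1⟩ := ih _ (key (insert h (insert (τ h) V))
        (fun x hx => Finset.mem_insert_of_mem (Finset.mem_insert_of_mem hx))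
        (Finset.mem_insert_self _ _)) (insert h (insert (τ h) V)) (σ (τ h)) le_rfl
      obtain ⟨e₂, he₂, h2⟩ := ih _ (key (explore σ τ (insert h (insert (τ h) V)) (σ (τ h))).2
        (fun x hx => hsub (Finset.mem_insert_of_mem (Finset.mem_insert_of_mem hx)))
        (hsub (Finset.mem_insert_self _ _)))
        (explore σ τ (insert h (insert (τ h) V)) (σ (τ h))).2 (σ h) le_rfl
      rw [explore_of_notMem σ τ hV]
      exact ⟨e₂, he₂, Explores.cons hV h1 he₁ h2⟩

/-- The half-edge `e` has been visited, at the end of the exploration below the node `l`. -/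
def VisitedBelow (τ : Equiv.Perm D) (V : Finset D) (F : List (PlaneTree D)) (l : List ℕ) (e : D) :
    Prop :=
  e ∈ V ∨ ∃ m b, ForestAt F m b ∧ (l ≤ m ∨ m <+: l) ∧ (e = b ∨ e = τ b)

theorem Explores.mem_iff {V V' : Finset D} {h e : D} {F : List (PlaneTree D)}
    (hE : Explores σ τ V h F V' e) (hτ : ∀ x, τ (τ x) = x) (x : D) :
    x ∈ V' ↔ x ∈ V ∨ ∃ m b, ForestAt F m b ∧ (x = b ∨ x = τ b) := by
  induction hE with
  | nil V h => simp [not_forestAt_nil]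
  | @cons V V₁ V₂ h e₁ e₂ cs ts hV below he₁ next ih1 ih2 =>
    rw [ih2, ih1, Finset.mem_insert, Finset.mem_insert]
    constructor
    · rintro (((rfl | rfl | h1) | ⟨m, b, h1, h2⟩) | ⟨m, b, h1, h2⟩)
      · exact Or.inr ⟨_, _, forestAt_cons.2 (Or.inr (Or.inl ⟨rfl, rfl⟩)), Or.inr (hτ x).symm⟩
      · exact Or.inr ⟨_, _, forestAt_cons.2 (Or.inr (Or.inl ⟨rfl, rfl⟩)), Or.inl rfl⟩
      · exact Or.inl h1
      · exact Or.inr ⟨_, b, forestAt_cons.2 (Or.inr (Or.inr ⟨m, rfl, h1⟩)), h2⟩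
      · exact Or.inr ⟨m, b, forestAt_cons.2 (Or.inl h1), h2⟩
    · rintro (h1 | ⟨m, b, h1, h2⟩)
      · exact Or.inl (Or.inl (Or.inr (Or.inr h1)))
      · rcases forestAt_cons.1 h1 with h1 | ⟨-, rfl⟩ | ⟨m', -, h1⟩
        · exact Or.inr ⟨m, b, h1, h2⟩
        · rw [hτ] at h2
          exact Or.inl (Or.inl (by tauto))
        · exact Or.inl (Or.inr ⟨m', b, h1, h2⟩)

theorem Explores.closed {V V' : Finset D} {h e : D} {F : List (PlaneTree D)}
    (hE : Explores σ τ V h F V' e) (hτ : ∀ x, τ (τ x) = x) (hV : ∀ x ∈ V, τ x ∈ V) :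
    ∀ x ∈ V', τ x ∈ V' := by
  intro x hx
  rw [hE.mem_iff hτ] at hx ⊢
  rcases hx with hx | ⟨m, b, h1, rfl | rfl⟩
  · exact Or.inl (hV x hx)
  · exact Or.inr ⟨m, x, h1, Or.inr rfl⟩
  · exact Or.inr ⟨m, b, h1, Or.inl (hτ b)⟩

/-- Every explored edge is new, and is explored once. -/
theorem Explores.distinct {V V' : Finset D} {h e : D} {F : List (PlaneTree D)}
    (hE : Explores σ τ V h F V' e) (hτ : ∀ x, τ (τ x) = x) (hτ' : ∀ x, τ x ≠ x)
    (hcl : ∀ x ∈ V, τ x ∈ V) :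
    (∀ l b, ForestAt F l b → b ∉ V) ∧
    (∀ l b m c, ForestAt F l b → ForestAt F m c → b = c → l = m) ∧
    (∀ l b m c, ForestAt F l b → ForestAt F m c → b ≠ τ c) := by
  induction hE with
  | nil V h =>
    exact ⟨fun _ _ h => (not_forestAt_nil h).elim, fun _ _ _ _ h => (not_forestAt_nil h).elim,
      fun _ _ _ _ h => (not_forestAt_nil h).elim⟩
  | @cons V V₁ V₂ h e₁ e₂ cs ts hV below he₁ next ih1 ih2 =>
    have hcl0 : ∀ x ∈ insert h (insert (τ h) V), τ x ∈ insert h (insert (τ h) V) := by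
      intro x hx
      simp only [Finset.mem_insert] at hx ⊢
      rcases hx with rfl | rfl | hx
      · exact Or.inr (Or.inl rfl)
      · exact Or.inl (hτ h)
      · exact Or.inr (Or.inr (hcl x hx))
    have hcl1 := below.closed hτ hcl0
    obtain ⟨a1, a2, a3⟩ := ih1 hcl0
    obtain ⟨b1, b2, b3⟩ := ih2 hcl1
    have hsub : ∀ x, x ∈ insert h (insert (τ h) V) → x ∈ V₁ := fun x hx =>
      (below.mem_iff hτ x).2 (Or.inl hx)
    have hc : ∀ m c, ForestAt cs m c → c ∈ V₁ := fun m c hm =>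
      (below.mem_iff hτ c).2 (Or.inr ⟨m, c, hm, Or.inl rfl⟩)
    have hτV : τ h ∉ V := fun h1 => hV (by have := hcl _ h1; rwa [hτ] at this)
    have hh : h ∈ V₁ := hsub _ (Finset.mem_insert_self _ _)
    have hth : τ h ∈ V₁ := hsub _ (Finset.mem_insert_of_mem (Finset.mem_insert_self _ _))
    refine ⟨fun l b hl₀ => ?_, fun l b m c hl₀ hm₀ hbc => ?_, fun l b m c hl₀ hm₀ hbc => ?_⟩
    · rcases forestAt_cons.1 hl₀ with hl | ⟨-, rfl⟩ | ⟨l', -, hl⟩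
      · exact fun h1 => b1 l b hl (hsub b (Finset.mem_insert_of_mem (Finset.mem_insert_of_mem h1)))
      · exact hτV
      · exact fun h1 => a1 l' b hl (Finset.mem_insert_of_mem (Finset.mem_insert_of_mem h1))
    · subst hbc
      rcases forestAt_cons.1 hl₀ with hl | ⟨rfl, rfl⟩ | ⟨l', rfl, hl⟩ <;>
        rcases forestAt_cons.1 hm₀ with hm | ⟨rfl, hb⟩ | ⟨m', rfl, hm⟩
      · exact b2 l b m b hl hm rfl
      · exact (b1 l b hl (hb ▸ hth)).elim
      · exact (b1 l b hl (hc m' b hm)).elim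
      · exact (b1 m _ hm hth).elim
      · rfl
      · exact (a1 m' _ hm (by simp)).elim
      · exact (b1 m b hm (hc l' b hl)).elim
      · exact (a1 l' b hl (by rw [hb]; simp)).elim
      · rw [a2 l' b m' b hl hm rfl]
    · rcases forestAt_cons.1 hl₀ with hl | ⟨rfl, rfl⟩ | ⟨l', rfl, hl⟩ <;>
        rcases forestAt_cons.1 hm₀ with hm | ⟨rfl, rfl⟩ | ⟨m', rfl, hm⟩
      · exact b3 l b m c hl hm hbc
      · exact b1 l b hl (by rw [hbc, hτ]; exact hh)
      · exact b1 l b hl (by rw [hbc]; exact hcl1 _ (hc m' c hm))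
      · exact b1 m c hm (τ.injective hbc ▸ hh)
      · exact hτ' _ hbc.symm
      · exact a1 m' c hm (τ.injective hbc ▸ Finset.mem_insert_self _ _)
      · exact b1 m c hm (by rw [← hτ c, ← hbc]; exact hcl1 _ (hc l' b hl))
      · exact a1 l' b hl (by rw [hbc, hτ]; simp)
      · exact a3 l' b m' c hl hm hbc

/-- The half-edges around the starting point of the loop. -/
theorem Explores.root_chain {V V' : Finset D} {h e : D} {F : List (PlaneTree D)}
    (hE : Explores σ τ V h F V' e) (hτ : ∀ x, τ (τ x) = x) :
    (F = [] → e = h) ∧ (∀ i b, ForestAt F [i] b → i + 1 = F.length → τ b = h) ∧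
    (∀ i b c, ForestAt F [i + 1] b → ForestAt F [i] c → τ c = σ (τ b)) ∧
    (∀ b, ForestAt F [0] b → e = σ (τ b)) := by
  induction hE with
  | nil V h =>
    exact ⟨fun _ => rfl, fun _ _ h => (not_forestAt_nil h).elim,
      fun _ _ _ h => (not_forestAt_nil h).elim, fun _ h => (not_forestAt_nil h).elim⟩
  | @cons V V₁ V₂ h e₁ e₂ cs ts hV below he₁ next ih1 ih2 =>
    obtain ⟨b1, b2, b3, b4⟩ := ih2
    have hat : ∀ i b, ForestAt (node (τ h) cs :: ts) [i] b →
        ForestAt ts [i] b ∨ (i = ts.length ∧ τ b = h) := by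
      intro i b hb
      rcases forestAt_cons.1 hb with hb | ⟨hi, rfl⟩ | ⟨m, hm, hb⟩
      · exact Or.inl hb
      · exact Or.inr ⟨by simpa using hi, hτ h⟩
      · obtain ⟨j, m', rfl, -⟩ := hb.exists_cons
        simp at hm
    have hlt : ∀ i b, ForestAt ts [i] b → i < ts.length := by
      intro i b hb
      obtain ⟨j, m', h1, h2⟩ := hb.exists_cons
      simp only [List.cons.injEq] at h1
      omega
    refine ⟨fun h1 => by simp at h1, fun i b hb hi => ?_, fun i b c hb hc => ?_, fun b hb => ?_⟩
    · rw [List.length_cons] at hi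
      rcases hat i b hb with hb | ⟨-, hb⟩
      · have := hlt i b hb; omega
      · exact hb
    · rcases hat _ b hb with hb | ⟨hi, hb⟩
      · rcases hat _ c hc with hc | ⟨hi, -⟩
        · exact b3 i b c hb hc
        · have := hlt _ b hb; omega
      · rcases hat _ c hc with hc | ⟨hi', -⟩
        · rw [hb, b2 i c hc hi]
        · omega
    · rcases hat 0 b hb with hb | ⟨hi, hb⟩
      · exact b4 b hb
      · rw [hb]
        exact b1 (List.length_eq_zero_iff.1 hi.symm)

/-- The half-edges around the explored nodes. -/
theorem Explores.node_chain {V V' : Finset D} {h e : D} {F : List (PlaneTree D)}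
    (hE : Explores σ τ V h F V' e) (hτ : ∀ x, τ (τ x) = x) :
    ∀ l a, ForestAt F l a →
    ((¬ ∃ b, ForestAt F (l ++ [0]) b) → VisitedBelow τ V F l (σ a)) ∧
    (∀ i b, ForestAt F (l ++ [i]) b → (¬ ∃ c, ForestAt F (l ++ [i + 1]) c) → τ b = σ a) ∧
    (∀ i b c, ForestAt F (l ++ [i + 1]) b → ForestAt F (l ++ [i]) c → τ c = σ (τ b)) ∧
    (∀ b, ForestAt F (l ++ [0]) b → VisitedBelow τ V F l (σ (τ b))) := by
  induction hE with
  | nil V h => exact fun _ _ h => (not_forestAt_nil h).elim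
  | @cons V V₁ V₂ h e₁ e₂ cs ts hV below he₁ next ih1 ih2 =>
    obtain ⟨r1, r2, r3, r4⟩ := below.root_chain hτ
    have hroot : ForestAt (node (τ h) cs :: ts) [ts.length] (τ h) :=
      forestAt_cons.2 (Or.inr (Or.inl ⟨rfl, rfl⟩))
    have hsub : ∀ {m b}, ForestAt cs m b → ForestAt (node (τ h) cs :: ts) (ts.length :: m) b :=
      fun hm => forestAt_cons.2 (Or.inr (Or.inr ⟨_, rfl, hm⟩))
    have hsub' : ∀ {m b}, m ≠ [] → ForestAt (node (τ h) cs :: ts) (ts.length :: m) b →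
        ForestAt cs m b := by
      intro m b hm hb
      rcases forestAt_cons.1 hb with hb | ⟨hi, -⟩ | ⟨m', hm', hb⟩
      · obtain ⟨j, m', h1, h2⟩ := hb.exists_cons
        simp only [List.cons.injEq] at h1
        omega
      · simp [hm] at hi
      · simp only [List.cons.injEq, true_and] at hm'
        exact hm' ▸ hb
    have htail : ∀ {m b}, ForestAt ts m b → ForestAt (node (τ h) cs :: ts) m b := fun hm =>
      forestAt_cons.2 (Or.inl hm)
    have htail' : ∀ {i m b}, i < ts.length → ForestAt (node (τ h) cs :: ts) (i :: m) b →
        ForestAt ts (i :: m) b := by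
      intro i m b hi hb
      rcases forestAt_cons.1 hb with hb | ⟨hi', -⟩ | ⟨m', hm', hb⟩
      · exact hb
      · simp only [List.cons.injEq] at hi'; omega
      · simp only [List.cons.injEq] at hm'; omega
    -- visits at the time when the loop at the new node ends
    have hvis : ∀ {m x}, VisitedBelow τ (insert h (insert (τ h) V)) cs m x →
        VisitedBelow τ V (node (τ h) cs :: ts) (ts.length :: m) x := by
      rintro m x (hx | ⟨m', b, h1, h2, h3⟩)
      · simp only [Finset.mem_insert] at hx
        rcases hx with rfl | rfl | hx
        · exact Or.inr ⟨_, _, hroot, Or.inr (by simp), Or.inr (hτ x).symm⟩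
        · exact Or.inr ⟨_, _, hroot, Or.inr (by simp), Or.inl rfl⟩
        · exact Or.inl hx
      · refine Or.inr ⟨_, b, hsub h1, ?_, h3⟩
        rcases h2 with h2 | h2
        · exact Or.inl ((List.append_le_append_iff [ts.length]).2 h2)
        · exact Or.inr (by simpa using h2)
    -- The trees of `ts` are explored after the first one and lie to its left, so what was visited
    -- in the first one has larger addresses.
    have hvis' : ∀ {i m x}, i < ts.length → VisitedBelow τ V₁ ts (i :: m) x →
        VisitedBelow τ V (node (τ h) cs :: ts) (i :: m) x := by
      rintro i m x hi (hx | ⟨m', b, h1, h2, h3⟩)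
      · have hlt : ∀ m', i :: m ≤ ts.length :: m' := fun m' =>
          (List.cons_lt_cons_iff.2 (Or.inl hi)).le
        rw [below.mem_iff hτ] at hx
        simp only [Finset.mem_insert] at hx
        rcases hx with (rfl | rfl | hx) | ⟨m', b, h1, h2⟩
        · exact Or.inr ⟨_, _, hroot, Or.inl (hlt _), Or.inr (hτ x).symm⟩
        · exact Or.inr ⟨_, _, hroot, Or.inl (hlt _), Or.inl rfl⟩
        · exact Or.inl hx
        · exact Or.inr ⟨_, b, hsub h1, Or.inl (hlt _), h2⟩
      · exact Or.inr ⟨m', b, htail h1, h2, h3⟩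
    -- The loop at the new node stops on `e₁`. At that moment only `V`, the new edge and the edges
    -- below it have been visited.
    have hend : VisitedBelow τ V (node (τ h) cs :: ts) [ts.length] e₁ := by
      refine hvis ?_
      rcases (below.mem_iff hτ e₁).1 he₁ with h1 | ⟨m, b, h1, h2⟩
      · exact Or.inl h1
      · exact Or.inr ⟨m, b, h1, Or.inl (not_lt.1 (List.not_lt_nil _)), h2⟩
    intro l a hl₀
    rcases forestAt_cons.1 hl₀ with hl | ⟨rfl, rfl⟩ | ⟨m, rfl, hl⟩
    · obtain ⟨i, m, rfl, hi⟩ := hl.exists_cons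
      obtain ⟨c1, c2, c3, c4⟩ := ih2 _ a hl
      refine ⟨fun h1 => ?_, fun j b hb hn => ?_, fun j b c hb hc => ?_, fun b hb => ?_⟩
      · exact hvis' hi (c1 fun ⟨b, hb⟩ => h1 ⟨b, htail hb⟩)
      · exact c2 j b (htail' hi hb) fun ⟨c, hc⟩ => hn ⟨c, htail hc⟩
      · exact c3 j b c (htail' hi hb) (htail' hi hc)
      · exact hvis' hi (c4 b (htail' hi hb))
    · refine ⟨fun h1 => ?_, fun j b hb hn => ?_, fun j b c hb hc => ?_, fun b hb => ?_⟩
      · cases cs with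
        | nil => rw [← r1 rfl]; exact hend
        | cons t cs =>
          exfalso
          obtain ⟨b, hb⟩ := exists_forestAt_singleton (F := t :: cs) (j := 0) (by simp)
          exact h1 ⟨b, hsub hb⟩
      · have hb' : ForestAt cs [j] b := hsub' (by simp) hb
        refine r2 j b hb' ?_
        by_contra hj
        obtain ⟨i, m', h3, h4⟩ := hb'.exists_cons
        simp only [List.cons.injEq] at h3
        obtain ⟨c, hc⟩ := exists_forestAt_singleton (F := cs) (j := j + 1) (by omega)
        exact hn ⟨c, hsub hc⟩
      · exact r3 j b c (hsub' (by simp) hb) (hsub' (by simp) hc)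
      · rw [← r4 b (hsub' (by simp) hb)]; exact hend
    · obtain ⟨c1, c2, c3, c4⟩ := ih1 _ a hl
      refine ⟨fun h1 => ?_, fun j b hb hn => ?_, fun j b c hb hc => ?_, fun b hb => ?_⟩
      · exact hvis (c1 fun ⟨b, hb⟩ => h1 ⟨b, hsub hb⟩)
      · exact c2 j b (hsub' (by simp) hb) fun ⟨c, hc⟩ => hn ⟨c, hsub hc⟩
      · exact c3 j b c (hsub' (by simp) hb) (hsub' (by simp) hc)
      · exact hvis (c4 b (hsub' (by simp) hb))

end Explores

/-! ## The exploration of a glued tree -/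

namespace PlaneTree

section WithAddr

variable {α β : Type}

mutual
/-- Record at each node its address, preceded by `pre`. -/
def withAddr (pre : List ℕ) : PlaneTree α → PlaneTree (List ℕ × α)
  | node a cs => node (pre, a) (withAddrForest pre 0 cs)
/-- The same for the forest of the sub-trees of the node at the address `pre`, from the `i`-th. -/
def withAddrForest (pre : List ℕ) : ℕ → List (PlaneTree α) → List (PlaneTree (List ℕ × α))
  | _, [] => []
  | i, t :: ts => withAddr (pre ++ [i]) t :: withAddrForest pre (i + 1) ts
end

theorem withAddrForest_facts (ts : List (PlaneTree α)) : ∀ (pre : List ℕ) (i : ℕ),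
    mapForest Prod.snd (withAddrForest pre i ts) = ts ∧
      forestNodes i (withAddrForest pre i ts) =
        (forestNodes i ts).map (fun x => (x.1, (pre ++ x.1, x.2))) := by
  induction ts using forest_induction with
  | nil => intro pre i; simp [withAddrForest, mapForest, forestNodes]
  | cons a cs ts h1 h2 =>
    intro pre i
    obtain ⟨a1, a2⟩ := h1 (pre ++ [i]) 0
    obtain ⟨b1, b2⟩ := h2 pre (i + 1)
    constructor
    · simp only [withAddrForest, withAddr, mapForest, map, a1, b1]
    · simp only [withAddrForest, withAddr, forestNodes, nodes, a2, b2]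
      simp [Function.comp_def]

theorem map_snd_withAddr (T : PlaneTree α) (pre : List ℕ) : (T.withAddr pre).map Prod.snd = T := by
  cases T with
  | node a cs => simp only [withAddr, map, (withAddrForest_facts cs pre 0).1]

theorem nodes_withAddr (T : PlaneTree α) (pre : List ℕ) :
    (T.withAddr pre).nodes = T.nodes.map (fun x => (x.1, (pre ++ x.1, x.2))) := by
  cases T with
  | node a cs => simp [withAddr, nodes, (withAddrForest_facts cs pre 0).2]

theorem find?_forestNodes_mirrorForest {p : α → Bool} {F : List (PlaneTree α)}
    (hF : ∀ m b, (m, b) ∈ forestNodes 0 F → p b = false) (i : ℕ) :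
    (forestNodes i (mirrorForest F)).find? (fun x => p x.2) = none := by
  rw [List.find?_eq_none]
  intro x hx
  have hmir : ∀ F : List (PlaneTree α), ∀ i j m b, (m, b) ∈ forestNodes i (mirrorForest F) →
      ∃ m', (m', b) ∈ forestNodes j F := by
    intro F
    induction F using forest_induction with
    | nil => intro i j m b h; simp [mirrorForest, forestNodes] at h
    | cons a cs ts h1 h2 =>
      intro i j m b h
      simp only [mirrorForest, forestNodes_append, List.mem_append, forestNodes, List.append_nil,
        List.mem_map, mirror, nodes, List.mem_cons] at h ⊢
      rcases h with h | ⟨⟨m', b'⟩, h | h, h'⟩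
      · obtain ⟨m', hm'⟩ := h2 i (j + 1) m b h
        exact ⟨m', Or.inr hm'⟩
      · simp only [Prod.mk.injEq] at h h'
        exact ⟨_, Or.inl ⟨([], a), Or.inl rfl, by rw [← h'.2, h.2]⟩⟩
      · simp only [Prod.mk.injEq] at h'
        obtain ⟨m'', hm''⟩ := h1 0 0 m' b' h
        exact ⟨_, Or.inl ⟨(m'', b'), Or.inr hm'', by rw [h'.2]⟩⟩
  obtain ⟨m', hm'⟩ := hmir F i 0 x.1 x.2 hx
  simp [hF m' _ hm']

/-- If the nodes with the property `p` are all below the one at the address `l`, then that one is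
the first of them in the mirrored tree. -/
theorem find?_nodes_mirror {p : α → Bool} (l : List ℕ) : ∀ (T : PlaneTree α) (a : α),
    (l, a) ∈ T.nodes → p a = true → (∀ m b, (m, b) ∈ T.nodes → p b = true → l <+: m) →
    (T.mirror.nodes.find? (fun x => p x.2)).map (fun x => x.1.length) = some l.length := by
  induction l with
  | nil =>
    rintro ⟨b, cs⟩ a ha hp -
    rw [mem_nodes_nil] at ha
    subst ha
    simp [mirror, nodes, hp]
  | cons i l ih =>
    rintro ⟨b, cs⟩ a ha hp hbelow
    obtain ⟨t, ht, hat⟩ := mem_nodes_cons.1 ha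
    have hb : p b = false := by
      by_contra h
      have := hbelow [] b (mem_nodes_nil.2 rfl) (by simpa using h)
      simp at this
    obtain ⟨hi, hti⟩ := List.getElem?_eq_some_iff.1 ht
    have hcs : cs = cs.take i ++ t :: cs.drop (i + 1) := by
      rw [← hti, List.getElem_cons_drop, List.take_append_drop]
    have hother : ∀ j s m c, cs[j]? = some s → (m, c) ∈ s.nodes → p c = true → j = i := by
      intro j s m c h1 h2 h3
      have := hbelow _ c (mem_nodes_cons.2 ⟨s, h1, h2⟩) h3
      simp only [List.cons_prefix_cons] at this
      exact this.1.symm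
    have hR : ∀ m c, (m, c) ∈ forestNodes 0 (cs.drop (i + 1)) → p c = false := by
      intro m c h
      obtain ⟨j, s, m', h1, h2, -⟩ := mem_forestNodes.1 h
      rw [List.getElem?_drop] at h1
      by_contra h3
      have := hother _ s m' c h1 h2 (by simpa using h3)
      omega
    have hmirror : (node b cs).mirror.nodes = ([], b) ::
        (forestNodes 0 (mirrorForest (cs.drop (i + 1))) ++
          (t.mirror.nodes.map (fun x => ((cs.drop (i + 1)).length :: x.1, x.2)) ++
          forestNodes ((cs.drop (i + 1)).length + 1) (mirrorForest (cs.take i)))) := by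
      conv_lhs => rw [hcs]
      simp only [mirror, nodes, mirrorForest_append, mirrorForest, forestNodes_append,
        List.append_assoc, length_mirrorForest, List.length_singleton,
        forestNodes, List.append_nil, zero_add]
    have hti' := ih t a hat hp fun m c hm hc => by
      have := hbelow _ c (mem_nodes_cons.2 ⟨t, ht, hm⟩) hc
      simpa using this
    obtain ⟨y, hy, hyl⟩ := Option.map_eq_some_iff.1 hti'
    rw [hmirror, List.find?_cons_of_neg (by simp [hb]), List.find?_append,
      find?_forestNodes_mirrorForest hR, Option.none_or, List.find?_append, List.find?_map]
    simp only [Function.comp_def]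
    rw [hy]
    simp [hyl]

end WithAddr

variable {T : PlaneTree ℕ} {π : Equiv.Perm T.Node} {ρ : Equiv.Perm T.HalfEdge}

open Classical in
/-- The half-edges visited when, at the node `l`, the children from the `i`-th on have been
explored. -/
noncomputable def visited (T : PlaneTree ℕ) (l : List ℕ) (i : ℕ) : Finset T.HalfEdge :=
  Finset.univ.filter fun x => x.1.1.1 <+: l ∨ l ++ [i] ≤ x.1.1.1

theorem mem_visited {l : List ℕ} {i : ℕ} {x : T.HalfEdge} :
    x ∈ T.visited l i ↔ x.1.1.1 <+: l ∨ l ++ [i] ≤ x.1.1.1 := by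
  simp [visited]

/-- The half-edge to be inspected after the children from the `i`-th on have been explored. -/
def Inspects (π : Equiv.Perm T.Node) (l : List ℕ) (h : T.HalfEdge) : ℕ → Prop
  | 0 => ∀ u : T.Node, u.1.1 = l → T.initialRotation (Sum.inr (π u)) = Sum.inl h
  | i + 1 => ∀ w : T.Edge, w.1.1 = l ++ [i] → h = (w, true)

/-- No address lies strictly between `l` and `l ++ [0]`. -/
theorem List.concat_zero_le_of_lt {l m : List ℕ} (h : l < m) : l ++ [0] ≤ m := by
  by_cases hp : l <+: m
  · obtain ⟨j, r, rfl⟩ := List.exists_concat_prefix hp h.ne'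
    rw [List.append_assoc, List.append_le_append_iff, ← not_lt]
    simp [List.cons_lt_cons_iff]
  · exact (List.lt_of_lt_of_not_prefix h hp (List.prefix_append _ _)).le

/-- The loop at the `i`-th child ends at the moment when the children of `l` from the `i`-th on are
done. -/
theorem visited_concat_zero (l : List ℕ) (i : ℕ) : T.visited (l ++ [i]) 0 = T.visited l i := by
  ext ⟨w, b⟩
  simp only [mem_visited]
  constructor
  · rintro (h | h)
    · rw [List.prefix_concat_iff] at h
      rcases h with h | h
      · exact Or.inr h.ge
      · exact Or.inl h
    · exact Or.inr ((List.lt_append_cons _ 0 []).le.trans h)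
  · rintro (h | h)
    · exact Or.inl (h.trans (List.prefix_append _ _))
    · rcases h.lt_or_eq with h | h
      · exact Or.inr (List.concat_zero_le_of_lt h)
      · exact Or.inl (by rw [h])

/-- The state on entering the `i`-th child. As `k` is its number of children, none of them has been
explored yet. -/
theorem insert_visited {w : T.Edge} {l : List ℕ} {i k : ℕ} (hw : w.1.1 = l ++ [i])
    (hk : ∀ j, T.Has (l ++ [i] ++ [j]) ↔ j < k) :
    insert (w, true) (insert (T.flip (w, true)) (T.visited l (i + 1))) =
      T.visited (l ++ [i]) k := by
  ext ⟨v, b⟩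
  simp only [Finset.mem_insert, mem_visited, flip_apply]
  have hv : ∀ b b', ((v, b) : T.HalfEdge) = (w, b') → v.1.1 = l ++ [i] := by
    intro b b' h
    rw [← hw, (Prod.mk.inj h).1]
  constructor
  · rintro (h | h | h | h)
    · exact Or.inl (by rw [hv _ _ h])
    · exact Or.inl (by rw [hv _ _ h])
    · exact Or.inl (h.trans (List.prefix_append _ _))
    · refine Or.inr (le_trans (le_of_lt ?_) h)
      exact List.lt_succ_of_prefix (Nat.lt_succ_self i) (List.prefix_append _ _)
  · rintro (h | h)
    · rw [List.prefix_concat_iff] at h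
      rcases h with h | h
      · have : v = w := Edge.ext (h.trans hw.symm)
        subst this
        cases b
        · exact Or.inr (Or.inl rfl)
        · exact Or.inl rfl
      · exact Or.inr (Or.inr (Or.inl h))
    · refine Or.inr (Or.inr (Or.inr ?_))
      by_contra h1
      push Not at h1
      have h2 : l ++ [i] < v.1.1 := (List.lt_append_cons _ k []).trans_le h
      obtain ⟨j, hj⟩ := List.exists_concat_prefix (List.prefix_of_ge_of_lt_succ h2.le h1) h2.ne'
      have h3 := (hk j).1 (v.has.of_prefix hj)
      exact absurd (List.lt_succ_of_prefix h3 hj) (not_lt.2 h)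

/-- The loop at the node `l` is followed from the right-most child down to the `i`-th, with
`Inspects` as the invariant for the current half-edge. Between plugs `ρ` is the rotation of the
tree, so the loop enters the children one by one; `hπ` makes it stop where a plug was. -/
theorem exists_explores_glued (h : IsGlued π ρ) (hT : T.Has [0])
    (hπ : ∀ u, (π u).1.1 <+: u.1.1 ∨ u.1.1 < (π u).1.1) (ts : List (PlaneTree ℕ)) :
    ∀ (l : List ℕ) (i : ℕ) (x : T.HalfEdge),
      (∀ j m a, (l ++ (i + j) :: m, a) ∈ T.nodes ↔ ∃ t, ts[j]? = some t ∧ (m, a) ∈ t.nodes) →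
      Inspects π l x (i + ts.length) →
      ∃ F y, Explores ρ T.flip (T.visited l (i + ts.length)) x F (T.visited l i) y ∧
        Inspects π l y i ∧
        mapForest (fun x => (owner x).1) F = mirrorForest (withAddrForest l i ts) := by
  induction ts using forest_induction with
  | nil =>
    intro l i x _ hx
    exact ⟨[], x, Explores.nil _ _, hx, by simp [mapForest, withAddrForest, mirrorForest]⟩
  | cons a cs ts ih1 ih2 =>
    intro l i x hsub hx
    have hlen : i + (node a cs :: ts).length = i + 1 + ts.length := by
      rw [List.length_cons]; omega
    rw [hlen] at hx ⊢
    -- The trees of `ts` are to the right of the head, so they are explored before it.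
    obtain ⟨F, y, hF, hy, hFm⟩ := ih2 l (i + 1) x (fun j m b => by
      rw [show i + 1 + j = i + (j + 1) by omega, hsub]; simp) hx
    have ha : (l ++ [i], a) ∈ T.nodes := by
      have := (hsub 0 [] a).2 ⟨node a cs, by simp, mem_nodes_nil.2 rfl⟩
      simpa using this
    obtain ⟨w, hw⟩ : ∃ w : T.Edge, w.1.1 = l ++ [i] := Has.exists_child ⟨a, ha⟩
    have hwa : w.1 = (l ++ [i], a) := by
      refine Prod.ext hw (eq_of_mem_nodes (T := T) (l := l ++ [i]) ?_ ha)
      rw [← hw]; exact w.toNode.2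
    have hyw : y = (w, true) := hy w hw
    subst hyw
    have hk : ∀ j, T.Has (l ++ [i] ++ [j]) ↔ j < cs.length := by
      intro j
      have h1 : ∀ b, (l ++ [i] ++ [j], b) ∈ T.nodes ↔ ∃ t, cs[j]? = some t ∧ ([], b) ∈ t.nodes := by
        intro b
        have := hsub 0 [j] b
        simp only [add_zero, List.getElem?_cons_zero, Option.some.injEq, exists_eq_left',
          mem_nodes_cons] at this
        rw [← this]
        simp
      constructor
      · rintro ⟨b, hb⟩
        obtain ⟨t, ht, -⟩ := (h1 b).1 hb
        exact (List.getElem?_eq_some_iff.1 ht).1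
      · intro hj
        obtain ⟨⟨b, ds⟩, ht⟩ : ∃ t, cs[j]? = some t := ⟨_, List.getElem?_eq_getElem hj⟩
        exact ⟨b, (h1 b).2 ⟨_, ht, mem_nodes_nil.2 rfl⟩⟩
    have hstart : Inspects π (l ++ [i]) (ρ (w, false)) (0 + cs.length) := by
      rw [zero_add]
      cases hc : cs.length with
      | zero =>
        intro u hu
        have huw : u = w.toNode := Node.ext (hu.trans hw.symm)
        subst huw
        refine h.inr (initialRotation_leaf ?_)
        rw [hw, hk]; omega
      | succ k =>
        intro c hc'
        refine h.inl (initialRotation_down (by rw [hw]; exact hc') ?_)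
        rw [hw, hk]; omega
    obtain ⟨G, z, hG, hz, hGm⟩ := ih1 (l ++ [i]) 0 (ρ (w, false)) (fun j m b => by
      have := hsub 0 (j :: m) b
      simp only [add_zero, List.getElem?_cons_zero, Option.some.injEq, exists_eq_left',
          mem_nodes_cons] at this
      rw [← this]
      simp) hstart
    rw [zero_add] at hG
    -- Here `hπ` is used. The half-edge `z` follows the plug of the image of `w`, which is on the
    -- path to the root or later in prefix order. The root has no parent: its first half-edge leads
    -- to its right-most child, whose edge is on that path or to the right of it.
    have hzv : z ∈ T.visited (l ++ [i]) 0 := by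
      have hz' := hz w.toNode hw
      have hs := hπ w.toNode
      rw [Edge.toNode_val, hw] at hs
      rcases (π w.toNode).eq_root_or_edge with hr | ⟨v, hv⟩
      · obtain ⟨k, hk1, hk2⟩ := Has.exists_last_child (l := []) hT
        obtain ⟨c, hc⟩ := hk1.exists_child
        rw [initialRotation_plug_root hr hc hk2] at hz'
        have hzc : z = (c, true) := (Sum.inl_injective hz').symm
        rw [hzc, visited_concat_zero, mem_visited, hc, List.nil_append]
        obtain ⟨j, m, hjm⟩ : ∃ j m, l ++ [i] = j :: m := by
          cases l with
          | nil => exact ⟨i, [], rfl⟩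
          | cons j l => exact ⟨j, l ++ [i], rfl⟩
        have hj : T.Has ([] ++ [j]) :=
          Has.of_prefix ⟨a, ha⟩ (by rw [hjm]; simp)
        rcases lt_trichotomy j k with hjk | rfl | hjk
        · right
          rw [hjm]
          exact (List.cons_lt_cons_iff.2 (Or.inl hjk)).le
        · cases l with
          | nil =>
            simp only [List.nil_append, List.cons.injEq] at hjm
            exact Or.inr (by rw [hjm.1]; exact le_rfl)
          | cons j' l =>
            simp only [List.cons_append, List.cons.injEq] at hjm
            exact Or.inl (by rw [hjm.1]; simp)
        · exact absurd (hj.of_le hjk) hk2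
      · rw [← hv, initialRotation_plug] at hz'
        have hzc : z = (v, false) := (Sum.inl_injective hz').symm
        rw [hzc, mem_visited]
        rw [← hv, Edge.toNode_val] at hs
        exact hs.imp id List.concat_zero_le_of_lt
    have hnot : (w, true) ∉ T.visited l (i + 1) := by
      rw [mem_visited, hw]
      rintro (h1 | h1)
      · have := h1.length_le
        simp at this
      · exact absurd (List.lt_succ_of_prefix (Nat.lt_succ_self i) List.prefix_rfl) (not_lt.2 h1)
    rw [← insert_visited hw hk] at hG
    have hstep := Explores.cons (σ := ρ) hnot (by rw [flip_apply w true]; exact hG) hzv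
      (Explores.nil _ _)
    rw [visited_concat_zero] at hstep
    refine ⟨_, _, hF.append hstep, ?_, ?_⟩
    · cases i with
      | zero =>
        intro u hu
        exact h.inr (initialRotation_up (by rw [hw, hu]))
      | succ i =>
        intro c hc
        exact h.inl (initialRotation_left hw hc)
    · rw [mapForest_append, hFm, withAddrForest, mirrorForest, withAddr, mirror, ← hGm, mapForest,
        mapForest, map, flip_apply, Bool.not_true, owner_false, Edge.toNode_val, hwa]

/-- The node to which a half-edge of a glued tree is attached. -/
noncomputable def nodeOf (ρ : Equiv.Perm T.HalfEdge) (r : T.HalfEdge)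
    (x : (T.toRotationSystem ρ r).D) : T.Node := owner (T := T) x

/-- The exploration of a glued tree recovers the tree. -/
theorem map_owner_searchTree (h : IsGlued π ρ)
    (hπ : ∀ u, (π u).1.1 <+: u.1.1 ∨ u.1.1 < (π u).1.1) {v : T.Edge} {i : ℕ} (hv : v.1.1 = [i])
    (hi : ¬ T.Has [i + 1]) :
    ((T.toRotationSystem ρ (v, true)).searchTree.mirror).map
      (fun x => (nodeOf ρ (v, true) x).1) = T.withAddr [] := by
  have hT : T.Has [0] := Has.of_le (l := []) (by rw [List.nil_append, ← hv]; exact v.has)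
    (Nat.zero_le i)
  have hTc : ∃ a cs, T = node a cs := by
    cases T with
    | node a cs => exact ⟨a, cs, rfl⟩
  obtain ⟨a, cs, hTc⟩ := hTc
  have hmem : ∀ j m b, (([] : List ℕ) ++ (0 + j) :: m, b) ∈ T.nodes ↔
      ∃ t, cs[j]? = some t ∧ (m, b) ∈ t.nodes := by
    intro j m b
    rw [List.nil_append, zero_add, hTc, mem_nodes_cons]
  have hlen : cs.length = i + 1 := by
    have hk : ∀ j, T.Has [j] ↔ j < cs.length := by
      intro j
      constructor
      · rintro ⟨b, hb⟩
        rw [hTc] at hb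
        obtain ⟨t, ht, -⟩ := mem_nodes_cons.1 hb
        exact (List.getElem?_eq_some_iff.1 ht).1
      · intro hj
        obtain ⟨⟨b, ds⟩, ht⟩ : ∃ t, cs[j]? = some t := ⟨_, List.getElem?_eq_getElem hj⟩
        exact ⟨b, by rw [hTc]; exact mem_nodes_cons.2 ⟨_, ht, mem_nodes_nil.2 rfl⟩⟩
    have h1 := (hk i).1 (by rw [← hv]; exact v.has)
    rw [hk] at hi
    omega
  obtain ⟨F, y, hF, -, hFm⟩ := exists_explores_glued h hT hπ cs [] 0 (v, true) hmem (by
    rw [zero_add, hlen]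
    intro w hw
    rw [Edge.ext (hw.trans (by rw [hv]; rfl) : w.1.1 = v.1.1)])
  have hV : T.visited [] (0 + cs.length) = ∅ := by
    ext ⟨w, b⟩
    rw [mem_visited]
    simp only [Finset.notMem_empty, iff_false]
    rintro (h1 | h1)
    · exact w.ne_nil (List.prefix_nil.1 h1)
    · obtain ⟨j, hj⟩ := List.exists_concat_prefix (l := []) List.nil_prefix w.ne_nil
      have h2 : T.Has ([] ++ [j]) := w.has.of_prefix hj
      have h3 : j < 0 + cs.length := by
        by_contra h3
        exact hi (h2.of_le (by omega))
      exact absurd (List.lt_succ_of_prefix h3 hj) (not_lt.2 h1)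
  rw [hV] at hF
  have hy : y ∈ T.visited [] 0 := by
    rw [mem_visited]
    refine Or.inr (List.concat_zero_le_of_lt ?_)
    exact lt_of_le_of_ne (not_lt.1 (List.not_lt_nil _)) y.1.ne_nil.symm
  have hE := hF.explore_eq hy
  have hroot : (owner ((v, true) : T.HalfEdge)).1 = ([], a) := by
    have h1 : v.parent.1.1 = [] := by rw [v.parent_addr, hv]; rfl
    refine Prod.ext h1 (eq_of_mem_nodes (T := T) (l := []) ?_ ?_)
    · rw [← h1]; exact v.parent.2
    · rw [hTc]; exact mem_nodes_nil.2 rfl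
  have hmap : (T.toRotationSystem ρ (v, true)).searchTree.map
      (fun x => (nodeOf ρ (v, true) x).1) =
      node (owner ((v, true) : T.HalfEdge)).1 (mapForest (fun x => (owner x).1) F) := by
    change map (fun x : T.HalfEdge => (owner x).1)
      (node (v, true) (explore ρ T.flip ∅ (v, true)).1) = _
    rw [hE, map]
  rw [map_mirror, hmap, hFm, hroot, mirror, mirrorForest_mirrorForest]
  conv_rhs => rw [hTc, withAddr]

theorem nodeOf_addr (h : IsGlued π ρ)
    (hπ : ∀ u, (π u).1.1 <+: u.1.1 ∨ u.1.1 < (π u).1.1) {v : T.Edge} {i : ℕ} (hv : v.1.1 = [i])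
    (hi : ¬ T.Has [i + 1]) {m : List ℕ} {b : (T.toRotationSystem ρ (v, true)).D}
    (hb : (m, b) ∈ (T.toRotationSystem ρ (v, true)).searchTree.mirror.nodes) :
    (nodeOf ρ (v, true) b).1.1 = m := by
  have h1 : (m, (nodeOf ρ (v, true) b).1) ∈ ((T.toRotationSystem ρ (v, true)).searchTree.mirror.map
      fun x => (nodeOf ρ (v, true) x).1).nodes := by
    rw [nodes_map]; exact List.mem_map.2 ⟨_, hb, rfl⟩
  rw [map_owner_searchTree h hπ hv hi, nodes_withAddr] at h1
  obtain ⟨y, -, hy⟩ := List.mem_map.1 h1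
  simp only [List.nil_append, Prod.mk.injEq] at hy
  rw [← hy.2, ← hy.1]

theorem vertexLabel_eq (M : RotationSystem) {x b : M.D} {l : List ℕ}
    (hb : (l, b) ∈ M.searchTree.mirror.nodes) (hbx : M.σ.SameCycle b x)
    (hmin : ∀ m c, (m, c) ∈ M.searchTree.mirror.nodes → M.σ.SameCycle c x → l <+: m) :
    M.vertexLabel x = l.length := by
  have key := find?_nodes_mirror (p := fun y => decide (M.σ.SameCycle y x)) l
    M.searchTree.mirror b hb (decide_eq_true hbx)
    (fun m c hm hc => hmin m c hm (of_decide_eq_true hc))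
  rw [mirror_mirror] at key
  rw [vertexLabel, key, Option.getD_some]

/-- The label of a vertex of a glued tree is the depth of its highest copy. -/
theorem vertexLabel_glued (h : IsGlued π ρ)
    (hπ : ∀ u, (π u).1.1 <+: u.1.1 ∨ u.1.1 < (π u).1.1) {v : T.Edge} {i : ℕ} (hv : v.1.1 = [i])
    (hi : ¬ T.Has [i + 1]) {x : T.HalfEdge} {u : T.Node} (hu : π.SameCycle u (owner x))
    (hmin : ∀ w, π.SameCycle w (owner x) → u.1.1 <+: w.1.1) :
    (T.toRotationSystem ρ (v, true)).vertexLabel x = u.1.1.length := by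
  have hT : T.Has [0] := Has.of_le (l := []) (by rw [List.nil_append, ← hv]; exact v.has)
    (Nat.zero_le i)
  have hmap := map_owner_searchTree h hπ hv hi
  set M := T.toRotationSystem ρ (v, true) with hM
  have hat : ∀ m (b : M.D), (m, b) ∈ M.searchTree.mirror.nodes →
      (nodeOf ρ (v, true) b).1.1 = m := fun m b hb => nodeOf_addr h hπ hv hi hb
  obtain ⟨b, hb⟩ : ∃ b, (u.1.1, b) ∈ M.searchTree.mirror.nodes := by
    have h1 : (u.1.1, u.1) ∈ (T.withAddr []).nodes := by
      rw [nodes_withAddr]; exact List.mem_map.2 ⟨u.1, u.2, rfl⟩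
    rw [← hmap, nodes_map] at h1
    obtain ⟨y, hy, hy'⟩ := List.mem_map.1 h1
    simp only [Prod.mk.injEq] at hy'
    exact ⟨y.2, by rw [← hy'.1]; exact hy⟩
  have hbu : nodeOf ρ (v, true) b = u := Node.ext (hat _ _ hb)
  refine vertexLabel_eq M hb ?_ fun m c hm hc => ?_
  · exact (h.sameCycle_iff hT b x).2 (by rw [← hbu] at hu; exact hu)
  · rw [← hat m c hm]
    exact hmin _ ((h.sameCycle_iff hT c x).1 hc)

end PlaneTree

/-! ## Every connected map is a glued tree -/

namespace PlaneTree

variable {T : PlaneTree ℕ}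

/-- A rotation that agrees with the tree between consecutive half-edges of a node comes from a
gluing. -/
theorem exists_isGlued (hT : T.Has [0]) {ρ : Equiv.Perm T.HalfEdge}
    (hρ : ∀ {x y}, T.initialRotation (Sum.inl x) = Sum.inl y → ρ x = y) :
    ∃ π : Equiv.Perm T.Node, IsGlued π ρ := by
  have h1 : ∀ u : T.Node, ∃ x, T.initialRotation (Sum.inl x) = Sum.inr u :=
    exists_initialRotation_eq_plug hT
  choose x hx using h1
  have h2 : ∀ u, ∃ w, T.initialRotation (Sum.inr w) = Sum.inl (ρ (x u)) := by
    intro u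
    rcases h : T.initialRotation.symm (Sum.inl (ρ (x u))) with y | w
    · have h3 : T.initialRotation (Sum.inl y) = Sum.inl (ρ (x u)) := by
        rw [← h, Equiv.apply_symm_apply]
      have h4 := ρ.injective (hρ h3)
      rw [h4, hx] at h3
      simp at h3
    · exact ⟨w, by rw [← h, Equiv.apply_symm_apply]⟩
  choose f hf using h2
  have hinj : Function.Injective f := by
    intro u w huw
    have h3 := hf u
    rw [huw, hf w] at h3
    have h4 := ρ.injective (Sum.inl_injective h3)
    have h5 := hx u
    rw [← h4, hx w] at h5
    exact (Sum.inr_injective h5).symm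
  refine ⟨Equiv.ofBijective f (Finite.injective_iff_bijective.1 hinj), hρ, fun {y u} hy => ?_⟩
  have h3 : y = x u := Sum.inl_injective (T.initialRotation.injective (hy.trans (hx u).symm))
  rw [h3]
  exact hf u

end PlaneTree

namespace RotationSystem

theorem labelledTree_eq (M : RotationSystem) :
    M.labelledTree = M.searchTree.mirror.map M.vertexLabel := by
  rw [labelledTree, PlaneTree.map_mirror]

open PlaneTree in
/-- A connected map is obtained by gluing the nodes of its exploration tree. -/
theorem exists_glued_iso (M : RotationSystem) (hM : M.ConnectedBy Set.univ) :
    ∃ (π : Equiv.Perm M.labelledTree.Node) (ρ : Equiv.Perm M.labelledTree.HalfEdge)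
      (v : M.labelledTree.Edge) (i : ℕ), IsGlued π ρ ∧
      (∀ u, (π u).1.1 <+: u.1.1 ∨ u.1.1 < (π u).1.1) ∧ v.1.1 = [i] ∧
      ¬ M.labelledTree.Has [i + 1] ∧ Iso (M.labelledTree.toRotationSystem ρ (v, true)) M := by
  obtain ⟨e, he, hE⟩ := exists_explores (σ := M.σ) (τ := M.τ) _ ∅ M.root le_rfl
  have hst : M.searchTree = .node M.root (explore M.σ M.τ ∅ M.root).1 := rfl
  have hTe := M.labelledTree_eq
  set F := (explore M.σ M.τ ∅ M.root).1
  set V := (explore M.σ M.τ ∅ M.root).2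
  set T := M.labelledTree with hTdef
  rw [hst] at hTe
  have hHas : ∀ l, l ≠ [] → (T.Has l ↔ ∃ x, ForestAt F l x) := by
    intro l hl
    rw [hTe, has_map]
    simp [Has, mirror, nodes, ForestAt, hl]
  have hmem := hE.mem_iff M.τ_τ
  obtain ⟨-, hd2, hd3⟩ := hE.distinct M.τ_τ M.τ_ne (by simp)
  obtain ⟨-, hr2, hr3, hr4⟩ := hE.root_chain M.τ_τ
  have hchain := hE.node_chain M.τ_τ
  have hch : ∀ l i, T.Has (l ++ [i]) ↔ ∃ x, ForestAt F (l ++ [i]) x := fun l i => hHas _ (by simp)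
  -- Nothing is visited at the start and the loop stops on a visited half-edge, so some tree has
  -- been explored.
  have hT : T.Has [0] := by
    rcases (hmem e).1 he with h | ⟨m, b, h1, -⟩
    · simp at h
    · obtain ⟨i, m', rfl, -⟩ := h1.exists_cons
      have h2 : T.Has (i :: m') := (hHas _ (by simp)).2 ⟨b, h1⟩
      exact Has.of_le (l := []) (h2.of_prefix (l := [] ++ [i]) (by simp)) (Nat.zero_le i)
  have hat : ∀ l b m c, ForestAt F l b → ForestAt F m c → l = m → b = c := by
    rintro l b m c h1 h2 rfl
    have h3 : ∀ {x}, ForestAt F l x → (l, x) ∈ (PlaneTree.node M.root F).mirror.nodes := fun h => by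
      rw [mirror, nodes]; exact List.mem_cons_of_mem _ h
    exact eq_of_mem_nodes (h3 h1) (h3 h2)
  have hcarr : ∀ v : T.Edge, ∃ x, ForestAt F v.1.1 x := fun v => (hHas _ v.ne_nil).1 v.has
  choose c hc using hcarr
  -- all half-edges have been visited
  have hroot : M.root ∈ V := by
    obtain ⟨b, hb⟩ := (hch [] 0).1 hT
    obtain ⟨j, m', h1, h2⟩ := hb.exists_cons
    obtain ⟨b', hb'⟩ := exists_forestAt_singleton (F := F) (j := F.length - 1) (by omega)
    refine (hmem _).2 (Or.inr ⟨_, b', hb', Or.inr (hr2 _ b' hb' (by omega)).symm⟩)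
  have hVis : ∀ {l x}, VisitedBelow M.τ ∅ F l x → x ∈ V := by
    rintro l x (h | ⟨m, b, h1, -, h2⟩)
    · simp at h
    · exact (hmem x).2 (Or.inr ⟨m, b, h1, h2⟩)
  have hVin : ∀ {l b}, ForestAt F l b → M.τ b ∈ V := fun h =>
    (hmem _).2 (Or.inr ⟨_, _, h, Or.inr rfl⟩)
  -- After a visited half-edge comes either the half-edge to the next child or the one on which a
  -- loop stopped; both are visited. Connectedness then gives all half-edges.
  have hσV : ∀ x, x ∈ V → M.σ x ∈ V := by
    intro x hx
    rcases (hmem x).1 hx with h | ⟨m, b, h1, rfl | rfl⟩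
    · simp at h
    · obtain ⟨c1, c2, -, -⟩ := hchain m x h1
      by_cases h0 : ∃ b, ForestAt F (m ++ [0]) b
      · obtain ⟨i, hi, hi'⟩ := ((hch m 0).2 h0).exists_last_child
        obtain ⟨b, hb⟩ := (hch m i).1 hi
        rw [← c2 i b hb (fun h => hi' ((hch m (i + 1)).2 h))]
        exact hVin hb
      · exact hVis (c1 h0)
    · obtain ⟨l, i, rfl⟩ : ∃ l i, m = l ++ [i] := by
        obtain ⟨j, m', rfl, -⟩ := h1.exists_cons
        exact ⟨_, _, (List.dropLast_append_getLast (by simp)).symm⟩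
      cases i with
      | zero =>
        by_cases hl : l = []
        · subst hl
          rw [← hr4 b h1]; exact he
        · obtain ⟨a, ha⟩ := (hHas l hl).1 (((hch l 0).2 ⟨b, h1⟩).of_prefix (List.prefix_append _ _))
          exact hVis ((hchain l a ha).2.2.2 b h1)
      | succ i =>
        obtain ⟨d, hdd⟩ := (hch l i).1 (((hch l (i + 1)).2 ⟨b, h1⟩).of_le (Nat.le_succ i))
        by_cases hl : l = []
        · subst hl
          rw [← hr3 i b d h1 hdd]; exact hVin hdd
        · obtain ⟨a, ha⟩ := (hHas l hl).1
            (((hch l (i + 1)).2 ⟨b, h1⟩).of_prefix (List.prefix_append _ _))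
          rw [← (hchain l a ha).2.2.1 i b d h1 hdd]; exact hVin hdd
  have hτV : ∀ x, x ∈ V → M.τ x ∈ V := hE.closed M.τ_τ (by simp)
  have hall : ∀ x, x ∈ V := by
    intro x
    have key : ∀ a b, Relation.EqvGen (fun a b => M.σ.SameCycle a b ∨
        (a ∈ (Set.univ : Set M.D) ∧ b = M.τ a)) a b → (a ∈ V ↔ b ∈ V) := by
      intro a b hab
      induction hab with
      | rel a b h =>
        rcases h with h | ⟨-, rfl⟩
        · exact ⟨fun ha => sameCycle_induction hσV h ha,
            fun hb => sameCycle_induction hσV h.symm hb⟩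
        · exact ⟨hτV a, fun h => by have := hτV _ h; rwa [M.τ_τ] at this⟩
      | refl a => exact Iff.rfl
      | symm a b _ ih => exact ih.symm
      | trans a b c _ _ ih1 ih2 => exact ih1.trans ih2
    exact (key _ _ (hM M.root x)).1 hroot
  -- the bijection with the half-edges of the tree
  let f : T.HalfEdge → M.D := fun x => if x.2 then M.τ (c x.1) else c x.1
  have hff : ∀ v, f (v, false) = c v := fun _ => rfl
  have hft : ∀ v, f (v, true) = M.τ (c v) := fun _ => rfl
  have hcinj : ∀ v w, c v = c w → v = w := fun v w h =>
    Edge.ext (hd2 _ _ _ _ (hc v) (hc w) h)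
  have hfbij : Function.Bijective f := by
    constructor
    · rintro ⟨v, _ | _⟩ ⟨w, _ | _⟩ h
      · rw [hff, hff] at h; rw [hcinj v w h]
      · exact (hd3 _ _ _ _ (hc v) (hc w) h).elim
      · exact (hd3 _ _ _ _ (hc w) (hc v) h.symm).elim
      · rw [hft, hft] at h; rw [hcinj v w (M.τ.injective h)]
    · intro y
      rcases (hmem y).1 (hall y) with h | ⟨m, b, h1, h2⟩
      · simp at h
      · obtain ⟨v, hv⟩ := Has.exists_edge ((hHas m (by
          obtain ⟨j, m', rfl, -⟩ := h1.exists_cons; simp)).2 ⟨b, h1⟩) (by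
          obtain ⟨j, m', rfl, -⟩ := h1.exists_cons; simp)
        have hb : c v = b := hat _ _ _ _ (hc v) h1 hv
        rcases h2 with rfl | rfl
        · exact ⟨(v, false), hb⟩
        · exact ⟨(v, true), by rw [hft, hb]⟩
  let E : T.HalfEdge ≃ M.D := Equiv.ofBijective f hfbij
  have hEf : ∀ x, E x = f x := fun _ => rfl
  let ρ : Equiv.Perm T.HalfEdge := (E.trans M.σ).trans E.symm
  have hρ : ∀ x, E (ρ x) = M.σ (E x) := fun x => by simp [ρ]
  have hτE : ∀ x, E (T.flip x) = M.τ (E x) := by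
    rintro ⟨v, _ | _⟩
    · rfl
    · rw [flip_apply, hEf, hEf, hft, M.τ_τ]; rfl
  have hlocal : ∀ {x y}, T.initialRotation (Sum.inl x) = Sum.inl y → ρ x = y := by
    intro x y hxy
    refine E.injective ?_
    rw [hρ, hEf, hEf]
    obtain ⟨v, _ | _⟩ := x
    · by_cases h0 : T.Has (v.1.1 ++ [0])
      · obtain ⟨i, hi, hi'⟩ := h0.exists_last_child
        obtain ⟨w, hw⟩ := hi.exists_child
        rw [initialRotation_down hw hi'] at hxy
        rw [← Sum.inl_injective hxy, hff, hft]
        exact ((hchain _ _ (hc v)).2.1 i _ (hw ▸ hc w)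
          (fun h => hi' ((hch _ _).2 h))).symm
      · rw [initialRotation_leaf h0] at hxy
        simp at hxy
    · obtain ⟨i, hi⟩ := v.exists_eq_concat
      cases i with
      | zero =>
        rw [initialRotation_up hi] at hxy
        simp at hxy
      | succ i =>
        obtain ⟨w, hw⟩ := Has.exists_child ((hi ▸ v.has : T.Has _).of_le (Nat.le_succ i))
        rw [initialRotation_left hi hw] at hxy
        rw [← Sum.inl_injective hxy, hft, hft]
        rcases v.parent.eq_root_or_edge with hp | ⟨u, hu⟩
        · rw [hp, List.nil_append] at hi hw
          exact (hr3 i _ _ (hi ▸ hc v) (hw ▸ hc w)).symm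
        · rw [← hu] at hi hw
          exact ((hchain _ _ (hc u)).2.2.1 i _ _ (hi ▸ hc v) (hw ▸ hc w)).symm
  obtain ⟨π, hG⟩ := exists_isGlued hT hlocal
  obtain ⟨i, hi, hi'⟩ := Has.exists_last_child (l := []) hT
  obtain ⟨v, hv⟩ := hi.exists_child
  -- The rotation leaves `u` by the half-edge on which the loop at `u` stopped. Having been visited
  -- before, it belongs to the path to the root or to a later node. The cases of the root are
  -- immediate.
  have hs3 : ∀ u, (π u).1.1 <+: u.1.1 ∨ u.1.1 < (π u).1.1 := by
    intro u
    rcases (π u).eq_root_or_edge with hr | ⟨w, hw⟩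
    · rw [hr]; exact Or.inl List.nil_prefix
    rcases u.eq_root_or_edge with hur | ⟨t, rfl⟩
    · rw [hur, ← hw]
      exact Or.inr (lt_of_le_of_ne (not_lt.1 (List.not_lt_nil _)) w.ne_nil.symm)
    have hlast : ∃ x, T.initialRotation (Sum.inl x) = Sum.inr t.toNode ∧
        VisitedBelow M.τ ∅ F t.1.1 (M.σ (f x)) := by
      by_cases h0 : T.Has (t.1.1 ++ [0])
      · obtain ⟨d, hd⟩ := h0.exists_child
        refine ⟨(d, true), initialRotation_up hd, ?_⟩
        exact (hchain _ _ (hc t)).2.2.2 _ (hd ▸ hc d)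
      · exact ⟨(t, false), initialRotation_leaf h0,
          (hchain _ _ (hc t)).1 fun h => h0 ((hch _ _).2 h)⟩
    obtain ⟨x, hx, hvis⟩ := hlast
    have h1 := hG.inr hx
    rw [← hw, initialRotation_plug] at h1
    have h2 := hρ x
    rw [← Sum.inl_injective h1, hEf, hEf, hff] at h2
    rw [← h2] at hvis
    rcases hvis with h | ⟨m, b, h3, h4, h5⟩
    · simp at h
    · rcases h5 with h5 | h5
      · have h6 : w.1.1 = m := hd2 _ _ _ _ (hc w) h3 h5
        rw [← hw, Edge.toNode_val, Edge.toNode_val, h6]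
        rcases h4 with h4 | h4
        · rcases h4.lt_or_eq with h4 | h4
          · exact Or.inr h4
          · exact Or.inl (by rw [h4])
        · exact Or.inl h4
      · exact (hd3 _ _ _ _ (hc w) h3 h5).elim
  refine ⟨π, ρ, v, i, hG, hs3, hv, hi', E, hρ, hτE, ?_⟩
  change f (v, true) = M.root
  rw [hft]
  refine hr2 i (c v) (by rw [← List.nil_append [i], ← hv]; exact hc v) ?_
  obtain ⟨j, m', h1, h2⟩ := (hc v).exists_cons
  rw [hv] at h1
  simp only [List.nil_append, List.cons.injEq] at h1
  by_contra h3
  exact hi' ((hch [] (i + 1)).2 (exists_forestAt_singleton (by omega)))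

end RotationSystem

/-! ## Isomorphic maps -/

namespace RotationSystem

theorem sameCycle_of_equiv {X Y : Type} [Finite X] [Finite Y] {f : Equiv.Perm X}
    {g : Equiv.Perm Y} (e : X ≃ Y) (h : ∀ x, e (f x) = g (e x)) (x x' : X) :
    f.SameCycle x x' ↔ g.SameCycle (e x) (e x') := by
  refine sameCycle_iff_of_retract e.symm e (fun y => ?_) (fun x => ?_)
    (fun x => by rw [e.symm_apply_apply]) x x'
  · have : e.symm (g y) = f (e.symm y) := by
      rw [Equiv.symm_apply_eq, h, Equiv.apply_symm_apply]
    rw [this]; exact sameCycle_apply_self _ _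
  · rw [h]; exact sameCycle_apply_self _ _

theorem numOrbits_eq_of_equiv {X Y : Type} [Finite X] [Finite Y] {f : Equiv.Perm X}
    {g : Equiv.Perm Y} (e : X ≃ Y) (h : ∀ x, e (f x) = g (e x)) : numOrbits f = numOrbits g := by
  refine Nat.card_congr (Quotient.congr e fun x x' => ?_)
  exact sameCycle_of_equiv e h x x'

variable {M M' : RotationSystem}

theorem Iso.numEdges_eq (h : Iso M M') : M.numEdges = M'.numEdges := by
  obtain ⟨e, -, h2, -⟩ := h
  exact numOrbits_eq_of_equiv e h2

theorem Iso.isBridgelessPlanarMap (h : Iso M M') (hM : M'.IsBridgelessPlanarMap) :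
    M.IsBridgelessPlanarMap := by
  obtain ⟨e, h1, h2, -⟩ := h
  have hcon : ∀ A : Set M'.D, M'.ConnectedBy A → M.ConnectedBy (e ⁻¹' A) := by
    intro A hA x y
    have key : ∀ a b, Relation.EqvGen (fun a b => M'.σ.SameCycle a b ∨ (a ∈ A ∧ b = M'.τ a)) a b →
        Relation.EqvGen (fun a b => M.σ.SameCycle a b ∨ (a ∈ e ⁻¹' A ∧ b = M.τ a))
          (e.symm a) (e.symm b) := by
      intro a b hab
      induction hab with
      | rel a b h =>
        refine Relation.EqvGen.rel _ _ ?_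
        rcases h with h | ⟨ha, rfl⟩
        · exact Or.inl ((sameCycle_of_equiv e h1 _ _).2 (by simpa using h))
        · refine Or.inr ⟨by simpa using ha, ?_⟩
          rw [Equiv.symm_apply_eq, h2, Equiv.apply_symm_apply]
      | refl a => exact Relation.EqvGen.refl _
      | symm a b _ ih => exact ih.symm
      | trans a b c _ _ ih1 ih2 => exact ih1.trans _ _ _ ih2
    have := key _ _ (hA (e x) (e y))
    simpa using this
  refine ⟨⟨hcon _ hM.connected, ?_⟩, fun x hx => hx ?_⟩
  · have hv : M.numVertices = M'.numVertices := numOrbits_eq_of_equiv e h1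
    have he : M.numEdges = M'.numEdges := numOrbits_eq_of_equiv e h2
    have hf : M.numFaces = M'.numFaces := numOrbits_eq_of_equiv e fun x => by
      rw [Equiv.Perm.mul_apply, Equiv.Perm.mul_apply, h1, h2]
    rw [hv, he, hf]; exact hM.euler
  · have h3 := hM.bridgeless (e x)
    rw [IsBridge, not_not] at h3
    have h4 := hcon _ h3
    convert h4 using 1
    ext y
    simp [← h2]

/-- If `b` is not in the cycle of `a` and `c`, that cycle jumps over `b` by an arc from `x` to `π
x`. The elements strictly under the arc are closed under `π`, so they include `d`, then `c`, and
then `x` itself, a contradiction. -/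
theorem Noncrossing.sameCycle_of_crossing {X : Type} [Finite X] {rk : X → ℕ} {π : Equiv.Perm X}
    (h : Noncrossing rk π) (hinj : Function.Injective rk) {a b c d : X} (hab : rk a < rk b)
    (hbc : rk b < rk c) (hcd : rk c < rk d) (hac : π.SameCycle a c) (hbd : π.SameCycle b d) :
    π.SameCycle a b := by
  by_contra hn
  obtain ⟨x, hax, hxb, hbx⟩ : ∃ x, π.SameCycle a x ∧ rk x < rk b ∧ rk b < rk (π x) := by
    by_contra hcon
    push Not at hcon
    have := sameCycle_induction (S := fun x => π.SameCycle a x ∧ rk x < rk b) (fun x hx => by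
      have h1 := hcon x hx.1 hx.2
      have h2 : π.SameCycle a (π x) := hx.1.trans (sameCycle_apply_self _ _)
      have h3 : rk (π x) ≠ rk b := fun h3 => hn (hinj h3 ▸ h2)
      exact ⟨h2, by omega⟩) hac ⟨SameCycle.rfl, hab⟩
    omega
  have hcl : ∀ z, rk x < rk z ∧ rk z < rk (π x) → rk x < rk (π z) ∧ rk (π z) < rk (π x) :=
    fun z hz => (h x z).1 hz.1 hz.2
  have h1 := sameCycle_induction hcl hbd ⟨hxb, hbx⟩
  have h2 := sameCycle_induction hcl (hac.symm.trans hax) ⟨by omega, by omega⟩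
  omega

end RotationSystem

/-! ## Sticky trees and bridgeless planar maps -/

namespace PlaneTree

variable {T : PlaneTree ℕ} {π : Equiv.Perm T.Node} {ρ : Equiv.Perm T.HalfEdge}

theorem IsGlued.unique {ρ' : Equiv.Perm T.HalfEdge} (h : IsGlued π ρ) (h' : IsGlued π ρ') :
    ρ = ρ' := by
  refine Equiv.ext fun x => ?_
  rcases hx : T.initialRotation (Sum.inl x) with y | u
  · rw [h.inl hx, h'.inl hx]
  · exact Sum.inl_injective ((h.inr hx).symm.trans (h'.inr hx))

theorem numEdges_toRotationSystem (r : T.HalfEdge) :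
    (T.toRotationSystem ρ r).numEdges = T.numEdges := by
  have h : (T.toRotationSystem ρ r).numEdges = Nat.card T.Edge := numOrbits_flip
  rw [h, PlaneTree.numEdges, ← card_edge, Nat.add_sub_cancel]

/-- The map of a sticky tree remains connected when an edge is deleted. -/
theorem IsSticky.connectedBy (hS : T.IsSticky) (hT : T.Has [0]) (hG : IsGlued hS.perm ρ)
    (r : T.HalfEdge) (v₀ : T.Edge) {A : Set T.HalfEdge}
    (hA : ∀ w : T.Edge, w ≠ v₀ → (w, false) ∈ A) :
    (T.toRotationSystem ρ r).ConnectedBy A := by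
  let R : T.HalfEdge → T.HalfEdge → Prop :=
    Relation.EqvGen (fun a b => ρ.SameCycle a b ∨ (a ∈ A ∧ b = T.flip a))
  have htrans : ∀ {a b c}, R a b → R b c → R a c := fun h1 h2 => Relation.EqvGen.trans _ _ _ h1 h2
  have hcyc : ∀ {a b}, hS.perm.SameCycle (owner a) (owner b) → R a b := fun h =>
    Relation.EqvGen.rel _ _ (Or.inl ((hG.sameCycle_iff hT _ _).2 h))
  let N : T.Node → T.Node → Prop := fun u w => R (first hT u) (first hT w)
  have hNcyc : ∀ {u w}, hS.perm.SameCycle u w → N u w := fun {u w} h =>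
    hcyc (by rw [owner_first, owner_first]; exact h)
  have hNedge : ∀ w : T.Edge, w ≠ v₀ → N w.toNode w.parent := by
    intro w hw
    have h1 : R (w, false) (w, true) := by
      refine Relation.EqvGen.rel _ _ (Or.inr ⟨hA w hw, ?_⟩)
      rw [flip_apply]; rfl
    have h2 : R (w, true) (first hT w.parent) := hcyc (by rw [owner_first]; exact SameCycle.rfl)
    change R (first hT w.toNode) _
    rw [first_toNode]
    exact htrans h1 h2
  obtain ⟨o, ho⟩ := T.has_nil.exists_node
  -- Nodes outside the sub-tree of `v₀` climb to the root without using the edge `v₀`; those inside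
  -- climb to the top of the sub-tree.
  have houter : ∀ n (u : T.Node), u.1.1.length = n → ¬ v₀.1.1 <+: u.1.1 → N u o := by
    intro n
    induction n with
    | zero =>
      intro u hu _
      rw [Node.ext ((List.length_eq_zero_iff.1 hu).trans ho.symm)]
      exact Relation.EqvGen.refl _
    | succ n ih =>
      intro u hu hnot
      rcases u.eq_root_or_edge with h | ⟨w, rfl⟩
      · rw [h] at hu; simp at hu
      · obtain ⟨i, hi⟩ := w.exists_eq_concat
        refine htrans (hNedge w fun h => hnot (by rw [h, Edge.toNode_val])) (ih _ ?_ fun h => hnot ?_)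
        · rw [Edge.toNode_val, hi] at hu
          simpa using hu
        · rw [Edge.toNode_val, hi]
          exact h.trans (List.prefix_append _ _)
  have hinner : ∀ n (u : T.Node), u.1.1.length = n → v₀.1.1 <+: u.1.1 → N u v₀.toNode := by
    intro n
    induction n with
    | zero =>
      intro u hu hp
      rw [List.length_eq_zero_iff.1 hu] at hp
      exact (v₀.ne_nil (List.prefix_nil.1 hp)).elim
    | succ n ih =>
      intro u hu hp
      rcases u.eq_root_or_edge with h | ⟨w, rfl⟩
      · rw [h] at hu; simp at hu
      · by_cases hw : w = v₀
        · rw [hw]; exact Relation.EqvGen.refl _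
        · obtain ⟨i, hi⟩ := w.exists_eq_concat
          refine htrans (hNedge w hw) (ih _ ?_ ?_)
          · rw [Edge.toNode_val, hi] at hu
            simpa using hu
          · rw [Edge.toNode_val, hi, List.prefix_concat_iff] at hp
            rcases hp with hp | hp
            · exact (hw (Edge.ext (hi.trans hp.symm))).elim
            · exact hp
  -- Condition (2) gives a node of the sub-tree with label less than the depth of `v₀`. Its
  -- representative has that label as depth, so it lies outside, and the gluing bypasses the deleted
  -- edge.
  have hv₀ : N v₀.toNode o := by
    obtain ⟨z, hz, hp, hlt⟩ := hS.exists_label_lt _ v₀.toNode.2 (List.length_pos_iff.2 v₀.ne_nil)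
    have h1 := hinner _ ⟨z, hz⟩ rfl hp
    have h2 : N ⟨z, hz⟩ (hS.rep ⟨z, hz⟩) := hNcyc (hS.sameCycle_rep _)
    have h3 := houter _ (hS.rep ⟨z, hz⟩) rfl fun h => by
      have := h.length_le
      rw [hS.rep_length] at this
      exact absurd hlt (not_lt.2 this)
    exact htrans (Relation.EqvGen.symm _ _ h1) (htrans h2 h3)
  have hall : ∀ u, N u o := by
    intro u
    by_cases h : v₀.1.1 <+: u.1.1
    · exact htrans (hinner _ u rfl h) hv₀
    · exact houter _ u rfl h
  have hx : ∀ x : T.HalfEdge, R x (first hT o) := fun x =>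
    htrans (hcyc (by rw [owner_first])) (hall (owner x))
  exact fun x y => htrans (hx x) (Relation.EqvGen.symm _ _ (hx y))

theorem IsSticky.isBridgelessPlanarMap (hS : T.IsSticky) (hT : T.Has [0])
    (hG : IsGlued hS.perm ρ) (r : T.HalfEdge) :
    (T.toRotationSystem ρ r).IsBridgelessPlanarMap := by
  refine ⟨⟨hS.connectedBy hT hG r r.1 fun _ _ => Set.mem_univ _, ?_⟩, ?_⟩
  · exact (hG.euler_iff hT).2 hS.noncrossing_perm
  · rintro ⟨v, b⟩ h
    refine h (hS.connectedBy hT hG r v fun w hw => ?_)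
    change ((w, false) : T.HalfEdge) ∉ ({(v, b), T.flip (v, b)} : Set T.HalfEdge)
    rw [flip_apply]
    simp [hw]

/-- The representative is the topmost copy of its vertex, hence the first one visited, and its depth
is the common label of the class. -/
theorem IsSticky.labelledTree_eq (hS : T.IsSticky) (hG : IsGlued hS.perm ρ) {v : T.Edge} {i : ℕ}
    (hv : v.1.1 = [i]) (hi : ¬ T.Has [i + 1]) :
    (T.toRotationSystem ρ (v, true)).labelledTree = T := by
  have hlab : (T.toRotationSystem ρ (v, true)).vertexLabel =
      Prod.snd ∘ fun x => (nodeOf ρ (v, true) x).1 := by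
    funext x
    have h1 := vertexLabel_glued hG hS.perm_prefix_or_lt hv hi (x := x)
      (u := hS.rep (nodeOf ρ (v, true) x)) (hS.sameCycle_rep _).symm (fun w hw => by
        have h2 : hS.rep w = hS.rep (nodeOf ρ (v, true) x) := (hS.sameCycle_perm_iff _ _).1 hw
        rw [← h2]
        exact hS.rep_prefix w)
    rw [h1, hS.rep_length]
    rfl
  rw [RotationSystem.labelledTree_eq, hlab, ← map_map,
    map_owner_searchTree hG hS.perm_prefix_or_lt hv hi, map_snd_withAddr]

/-- The labelled exploration tree of a bridgeless planar map is sticky, and determines the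
gluing. -/
theorem isSticky_of_glued (hG : IsGlued π ρ)
    (hπ : ∀ u, (π u).1.1 <+: u.1.1 ∨ u.1.1 < (π u).1.1) {v : T.Edge} {i : ℕ} (hv : v.1.1 = [i])
    (hi : ¬ T.Has [i + 1]) (hB : (T.toRotationSystem ρ (v, true)).IsBridgelessPlanarMap)
    (hL : (T.toRotationSystem ρ (v, true)).labelledTree = T) :
    ∃ hS : T.IsSticky, hS.perm = π := by
  have hT : T.Has [0] := Has.of_le (l := []) (by rw [List.nil_append, ← hv]; exact v.has)
    (Nat.zero_le i)
  have hnc : Noncrossing rank π := (hG.euler_iff hT).1 hB.euler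
  -- The largest node of the cycle is sent to the smallest, which cannot come later and so is an
  -- ancestor or the node itself. The other nodes of the cycle lie between the two in prefix order,
  -- hence below the smallest.
  have htop : ∀ u : T.Node, ∃ t : T.Node, π.SameCycle t u ∧
      ∀ w, π.SameCycle w u → t.1.1 <+: w.1.1 := by
    intro u
    obtain ⟨y, hy, hmax⟩ := hnc.exists_last u
    have h1 : π.SameCycle u (π y) := hy.trans (sameCycle_apply_self _ _)
    have h2 : (π y).1.1 <+: y.1.1 := by
      rcases hπ y with h | h
      · exact h
      · have h3 := (hmax _ h1).2
        rw [rank_le_iff] at h3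
        exact absurd h (not_lt.2 h3)
    refine ⟨π y, h1.symm, fun w hw => ?_⟩
    have h3 := hmax w hw.symm
    rw [rank_le_iff, rank_le_iff] at h3
    exact List.prefix_of_between h3.1 h3.2 h2
  choose top htop1 htop2 using htop
  have htop_eq : ∀ u w, π.SameCycle u w → top u = top w := by
    intro u w huw
    have h1 := htop2 u (top w) ((htop1 w).trans huw.symm)
    have h2 := htop2 w (top u) ((htop1 u).trans huw)
    exact Node.ext (h1.eq_of_length (le_antisymm h1.length_le h2.length_le))
  have hpre : ∀ u, (top u).1.1 <+: u.1.1 := fun u => htop2 u u SameCycle.rfl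
  have hlab : ∀ u : T.Node, u.1.2 = (top u).1.1.length := by
    intro u
    have h1 : u.1 ∈ (T.toRotationSystem ρ (v, true)).labelledTree.nodes := by
      rw [hL]; exact u.2
    rw [RotationSystem.labelledTree_eq, nodes_map] at h1
    obtain ⟨⟨l, b⟩, hb, hbu⟩ := List.mem_map.1 h1
    have h2 := nodeOf_addr hG hπ hv hi hb
    have h3 : nodeOf ρ (v, true) b = u := Node.ext (by rw [h2, ← hbu])
    have h4 := vertexLabel_glued hG hπ hv hi (x := b) (u := top u)
      (by rw [← h3]; exact htop1 _) (fun w hw => by rw [← h3] at *; exact htop2 _ w hw)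
    rw [← h4, ← hbu]
  have hS : T.IsSticky := by
    refine ⟨fun u hu => ?_, fun u hu hpos => ?_, fun u hu v hv' huv hlen w hw huw hwv => ?_⟩
    · have h1 := hlab ⟨u, hu⟩
      have h2 := (hpre ⟨u, hu⟩).length_le
      simp only at h1 h2
      omega
    -- If no label in the sub-tree is less than its depth, every cycle that meets the sub-tree has
    -- its top in it and stays inside. The edge above is then a bridge.
    · by_contra hcon
      push Not at hcon
      obtain ⟨v₀, hv₀⟩ : ∃ v₀ : T.Edge, v₀.1 = u :=
        ⟨⟨u, mem_nonRootNodes.2 ⟨hu, List.length_pos_iff.1 hpos⟩⟩, rfl⟩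
      subst hv₀
      have hbr := not_not.1 (hB.bridgeless (v₀, false))
      have hcyc : ∀ a b : T.HalfEdge, ρ.SameCycle a b → v₀.1.1 <+: (owner a).1.1 →
          v₀.1.1 <+: (owner b).1.1 := by
        intro a b hab ha
        rw [hG.sameCycle_iff hT] at hab
        have h1 := hcon _ (owner a).2 ha
        rw [hlab (owner a)] at h1
        have h2 := List.prefix_of_prefix_length_le ha (hpre _) h1
        exact h2.trans (htop2 _ _ hab.symm)
      have hedge : ∀ w : T.Edge, w ≠ v₀ →
          (v₀.1.1 <+: w.toNode.1.1 ↔ v₀.1.1 <+: w.parent.1.1) := by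
        intro w hw
        obtain ⟨j, hj⟩ := w.exists_eq_concat
        rw [Edge.toNode_val, hj, List.prefix_concat_iff]
        constructor
        · rintro (h | h)
          · exact (hw (Edge.ext (hj.trans h.symm))).elim
          · exact h
        · exact Or.inr
      have key : ∀ a b : T.HalfEdge, Relation.EqvGen (fun a b => ρ.SameCycle a b ∨
          (a ∈ ({(v₀, false), T.flip (v₀, false)} : Set T.HalfEdge)ᶜ ∧ b = T.flip a)) a b →
          (v₀.1.1 <+: (owner a).1.1 ↔ v₀.1.1 <+: (owner b).1.1) := by
        intro a b hab
        induction hab with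
        | rel a b h =>
          rcases h with h | ⟨ha, rfl⟩
          · exact ⟨hcyc a b h, hcyc b a h.symm⟩
          · obtain ⟨w, b⟩ := a
            have hw : w ≠ v₀ := by
              rintro rfl
              refine ha ?_
              rw [flip_apply]
              cases b <;> simp
            rw [flip_apply]
            cases b
            · exact hedge w hw
            · exact (hedge w hw).symm
        | refl a => exact Iff.rfl
        | symm a b _ ih => exact ih.symm
        | trans a b c _ _ ih1 ih2 => exact ih1.trans ih2
      have h1 := (key (v₀, false) (v₀, true) (hbr _ _)).1 (by rw [owner_false, Edge.toNode_val])
      have h2 := h1.length_le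
      obtain ⟨j, hj⟩ := v₀.exists_eq_concat
      rw [owner_true] at h2
      have h3 := congrArg List.length hj
      rw [List.length_append, List.length_singleton] at h3
      omega
    -- A node `W` of smaller label would give `top W`, `U`, `W`, `V` in this order, with `top W` and
    -- `W` in one cycle and `U` and `V` in another: a crossing.
    · let U : T.Node := ⟨u, hu⟩
      let V : T.Node := ⟨v, hv'⟩
      let W : T.Node := ⟨w, hw⟩
      have hVU : top V = U := by
        refine Node.ext ?_
        have h1 : (top V).1.1.length = u.1.length := by rw [← hlab V]; exact hlen
        exact (List.prefix_of_prefix_length_le (hpre V) huv h1.le).eq_of_length h1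
      by_contra hlt
      have hW : (top W).1.1.length < u.1.length := by
        rw [← hlab W]; exact not_le.1 hlt
      have hUV : π.SameCycle U V := hVU ▸ htop1 V
      have hUU : top U = U := (htop_eq U V hUV).trans hVU
      have hWU : (top W).1.1 <+: U.1.1 := List.prefix_of_prefix_length_le (hpre W) huw hW.le
      have h1 : rank (top W) < rank U := by
        rw [rank_lt_iff]
        refine lt_of_le_of_ne hWU.lex_le fun h => ?_
        rw [h] at hW; exact lt_irrefl _ hW
      have h2 : rank U < rank W := by
        rw [rank_lt_iff]
        refine lt_of_le_of_ne huw.lex_le fun h => ?_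
        rw [← Node.ext h, hUU] at hW
        exact lt_irrefl _ hW
      have h3 : rank W < rank V := rank_lt_iff.2 hwv
      have h4 := hnc.sameCycle_of_crossing rank_injective h1 h2 h3 (htop1 W) hUV
      have h5 : top W = U := by
        rw [← hUU, ← htop_eq _ _ h4, htop_eq _ _ (htop1 W)]
      rw [h5] at hW
      exact lt_irrefl _ hW
  refine ⟨hS, hS.noncrossing_perm.eq_of_sameCycle_iff rank_injective hnc fun x y => ?_⟩
  rw [hS.sameCycle_perm_iff, hS.rep_eq (hpre x) (hlab x).symm, hS.rep_eq (hpre y) (hlab y).symm]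
  constructor
  · intro h
    have h1 := htop1 x
    rw [h] at h1
    exact h1.symm.trans (htop1 y)
  · exact htop_eq x y

theorem has_zero_of_numEdges {n : ℕ} (hn : 1 ≤ n) (h : T.numEdges = n) : T.Has [0] := by
  cases T with
  | node a cs =>
    cases cs with
    | nil => simp [PlaneTree.numEdges, nodes, forestNodes] at h; omega
    | cons t ts =>
      obtain ⟨b, ds⟩ := t
      exact ⟨b, mem_nodes_cons.2 ⟨node b ds, by simp, mem_nodes_nil.2 rfl⟩⟩

theorem exists_map_of_mem_stickyTrees {n : ℕ} (hn : 1 ≤ n) (hT : T ∈ stickyTrees n) :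
    ∃ B ∈ bridgelessMaps n, treeToMap T = some B ∧ mapToTree B = T := by
  obtain ⟨hS, hTn⟩ := hT
  have h0 := has_zero_of_numEdges hn hTn
  obtain ⟨ρ, v, i, hG, hv, hi, hmap⟩ := hS.treeToMap_eq h0
  refine ⟨_, ⟨_, hS.isBridgelessPlanarMap h0 hG (v, true), ?_, rfl⟩, hmap, ?_⟩
  · rw [numEdges_toRotationSystem, hTn]
  · exact hS.labelledTree_eq hG hv hi

/-- The permutation read off from the exploration is the one prescribed by the labels, and `IsGlued`
determines the rotation, so the gluing of plugs rebuilds the map. -/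
theorem mapToTree_mem_stickyTrees {n : ℕ} {B : RootedMap} (hB : B ∈ bridgelessMaps n) :
    mapToTree B ∈ stickyTrees n ∧ treeToMap (mapToTree B) = some B := by
  obtain ⟨M, hM, hMn, rfl⟩ := hB
  change M.labelledTree ∈ stickyTrees n ∧ treeToMap M.labelledTree = _
  obtain ⟨π, ρ, v, i, hG, hπ, hv, hi, hiso⟩ := M.exists_glued_iso hM.connected
  have hL := labelledTree_eq_of_iso hiso
  have hE := hiso.numEdges_eq
  have hQ : (⟦M⟧ : RootedMap) = ⟦M.labelledTree.toRotationSystem ρ (v, true)⟧ :=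
    (Quotient.sound hiso).symm
  have hB := hiso.isBridgelessPlanarMap hM
  obtain ⟨hS, hperm⟩ := isSticky_of_glued hG hπ hv hi hB hL
  rw [numEdges_toRotationSystem, hMn] at hE
  refine ⟨⟨hS, hE⟩, ?_⟩
  have h0 : M.labelledTree.Has [0] :=
    Has.of_le (l := []) (by rw [List.nil_append, ← hv]; exact v.has) (Nat.zero_le i)
  obtain ⟨ρ', v', i', hG', hv', hi', hmap⟩ := hS.treeToMap_eq h0
  rw [hperm] at hG'
  -- Both are the index of the right-most child of the root, so the root half-edges agree.
  have hii : i = i' := by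
    have a1 : M.labelledTree.Has ([] ++ [i]) := by rw [List.nil_append, ← hv]; exact v.has
    have a2 : M.labelledTree.Has ([] ++ [i']) := by rw [List.nil_append, ← hv']; exact v'.has
    rcases lt_trichotomy i i' with h | h | h
    · exact (hi (a2.of_le h)).elim
    · exact h
    · exact (hi' (a1.of_le h)).elim
  have hvv : v' = v := Edge.ext (by rw [hv, hv', hii])
  rw [hmap, hQ, hG.unique hG', hvv]

end PlaneTree

theorem mainTheorem1 (n : ℕ) (hn : 1 ≤ n) :
    Set.BijOn mapToTree (bridgelessMaps n) (stickyTrees n) ∧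
      (∀ T ∈ stickyTrees n, ∃ B ∈ bridgelessMaps n, treeToMap T = some B) ∧
      (∀ B ∈ bridgelessMaps n, treeToMap (mapToTree B) = some B) ∧
      (∀ T ∈ stickyTrees n, ∀ B, treeToMap T = some B → mapToTree B = T) := by
  refine ⟨⟨fun B hB => (PlaneTree.mapToTree_mem_stickyTrees hB).1, fun B hB B' hB' h => ?_,
    fun T hT => ?_⟩, fun T hT => ?_, fun B hB => (PlaneTree.mapToTree_mem_stickyTrees hB).2, fun T hT B hB => ?_⟩
  · have h1 := (PlaneTree.mapToTree_mem_stickyTrees hB).2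
    rw [h, (PlaneTree.mapToTree_mem_stickyTrees hB').2] at h1
    exact (Option.some.inj h1).symm
  · obtain ⟨B, hB, -, h⟩ := PlaneTree.exists_map_of_mem_stickyTrees hn hT
    exact ⟨B, hB, h⟩
  · obtain ⟨B, hB, h, -⟩ := PlaneTree.exists_map_of_mem_stickyTrees hn hT
    exact ⟨B, hB, h⟩
  · obtain ⟨B', -, h1, h2⟩ := PlaneTree.exists_map_of_mem_stickyTrees hn hT
    rw [hB] at h1
    rw [Option.some.inj h1, h2]
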